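/- **Theorem 3.2.** Let $n\ge 2$, $Q=n+2\ge 4$, and consider $\mathbb R^{n+1}\ni(x,t)$, $x\in\mathbb R^n$, $t\in\mathbb R$, with the Grushin gradient $\nabla_G=(\nabla_x,|x|\partial_t)$, the gauge $\varrho(x,t)=(|x|^4+4t^2)^{1/4}$, the origin $o$, and the gauge balls $B_R(o)=\{\varrho<R\}$, $0<R\le\infty$. Use polar coordinates $x=\varrho(\sin\phi)^{1/2}w$, $t=\tfrac{\varrho^2}{2}\cos\phi$ with $\sigma=(\phi,w)$, $0<\phi<\pi$, $w\in\mathbb S^{n-1}$, the measure $d\Omega=(\sin\phi)^{n/2}\,d\phi\,dw$ on $\Omega=\{\varrho=1\}$, and the radial gradient $\nabla_{\varrho,G}=|\nabla_G\varrho|\,(\partial_\varrho,0,0)$. For $k\ge 0$ let $\mathcal H_k\subset L^2(\Omega,d\Omega)$ be the span of the functions $$(\sin\phi)^{l/2}\,C^{\frac l2+\frac n4}_{\frac{k-l}{2}}(\cos\phi)\,Y_l(w),\qquad 0\le l\le k,\ l\equiv k\ (\mathrm{mod}\ 2),$$ where $C^a_m$ are the Gegenbauer polynomials and $Y_l$ ranges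 over the spherical harmonics of degree $l$ on $\mathbb S^{n-1}$, and let $\mathcal P_k u(\varrho,\cdot)$ be the $L^2(\Omega,d\Omega)$-orthogonal projection of $u(\varrho,\cdot)$ onto $\mathcal H_k$. For an integer $j\ge -1$ and $U\subset\mathbb R^{n+1}\setminus\{o\}$ put $\mathcal S_j(U)=\{u\in C_c^\infty(U):\mathcal P_0u=\dots=\mathcal P_ju=0\}$, so that $\mathcal S_{-1}(U)=C_c^\infty(U)$; functions are real-valued. (a) Let $0<R\le\infty$ and let $(V,W)$ be a $Q$-dimensional Bessel pair on $(0,R)$ with positive solution $f$, that is, $V,W$ are $C^1$ on $(0,R)$ and $f>0$ is a $C^1$ function with $(\varrho^{Q-1}Vf')'+\varrho^{Q-1}Wf=0$ on $(0,R)$. Assume $V\ge 0$. Then for every $u\in\mathcal S_j(B_R(o)\setminus\{o\})$ all the integrals below converge absolutely and $$\begin{aligned}\int_{B_R(o)}V(\varrho)|\nabla_Gu|^2\,dx\,dt\ \ge\ &\int_{B_R(o)}W(\varrho)u^2|\nabla_G\varrho|^2\,dx\,dt+(j+1)(Q+j-1)\int_{B_R(o)}\frac{V(\varrho)}{\varrho^2}u^2|\nabla_G\varrho|^2\,dx\,dt\\&+\int_{B_R(o)}V(\varrho)\Big|\nabla_{\varrho,G}\Big(\frac{u}{f(\varrho)}\Big)\Big|^2f(\varrho)^2\,dx\,dt.\end{aligned}$$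 (b) In particular, for every $u\in\mathcal S_j(\mathbb R^{n+1}\setminus\{o\})$, $$\int_{\mathbb R^{n+1}}|\nabla_Gu|^2\,dx\,dt\ \ge\ \Big[\frac{(Q-2)^2}{4}+(j+1)(Q+j-1)\Big]\int_{\mathbb R^{n+1}}\frac{u^2}{\varrho^2}|\nabla_G\varrho|^2\,dx\,dt,$$ and for $j\ge 0$ the constant in brackets is larger than $(Q-2)^2/4$. -/

import Mathlib

open MeasureTheory Set
open scoped ContDiff ENNReal

namespace Grushin

noncomputable section

/-! ### The Grushin space and its vector fields -/

/-- The underlying space `ℝ^{n+1} = ℝⁿ × ℝ`, with points `(x, t)`. -/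
abbrev Space (n : ℕ) : Type := EuclideanSpace ℝ (Fin n) × ℝ

/-- The unit sphere `𝕊^{n-1}` of `ℝⁿ`. -/
abbrev Sphere (n : ℕ) : Type := Metric.sphere (0 : EuclideanSpace ℝ (Fin n)) 1

/-- The homogeneous norm `ϱ(x,t) = (|x|⁴ + 4t²)^{1/4}`. -/
def gauge {n : ℕ} (p : Space n) : ℝ := (‖p.1‖ ^ 4 + 4 * p.2 ^ 2) ^ ((1 : ℝ) / 4)

/-- The vector fields `X_i u = ∂u/∂x_i`. -/
def fieldX {n : ℕ} (i : Fin n) (u : Space n → ℝ) (p : Space n) : ℝ :=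
  fderiv ℝ u p (EuclideanSpace.single i 1, 0)

/-- The vector field `Y u = |x| ∂u/∂t`. -/
def fieldY {n : ℕ} (u : Space n → ℝ) (p : Space n) : ℝ :=
  ‖p.1‖ * fderiv ℝ u p (0, 1)

/-- `|∇_G u|²`, where `∇_G = (X_1, …, X_n, Y)`. -/
def gradSq {n : ℕ} (u : Space n → ℝ) (p : Space n) : ℝ :=
  ∑ i, fieldX i u p ^ 2 + fieldY u p ^ 2

/-- The anisotropic dilation `δ_s(x,t) = (s x, s² t)`. -/
def dilation {n : ℕ} (s : ℝ) (p : Space n) : Space n := (s • p.1, s ^ 2 * p.2)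

/-- The derivative `∂_ϱ u` in the polar coordinates `(ϱ, σ)`: the derivative of
`s ↦ u(δ_s σ)` at `s = ϱ(p)`, where `σ = δ_{1/ϱ(p)} p` is the point of the gauge sphere
`{ϱ = 1}` on the dilation ray through `p`. -/
def radialDeriv {n : ℕ} (u : Space n → ℝ) (p : Space n) : ℝ :=
  deriv (fun s : ℝ => u (dilation s (dilation (gauge p)⁻¹ p))) (gauge p)

/-- `|∇_{ϱ,G} u|²`, where `∇_{ϱ,G} = |∇_G ϱ| (∂_ϱ, 0, 0)` is the radial Grushin gradient. -/
def radialGradSq {n : ℕ} (u : Space n → ℝ) (p : Space n) : ℝ :=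
  gradSq gauge p * radialDeriv u p ^ 2

/-- The interval `(0, R)` for `0 < R ≤ ∞`. -/
def radii (R : EReal) : Set ℝ := {r | 0 < r ∧ (r : EReal) < R}

/-- The gauge ball `B_R(o) = {ϱ < R}` for `0 < R ≤ ∞`. -/
def gaugeBall (n : ℕ) (R : EReal) : Set (Space n) := {p | (gauge p : EReal) < R}

/-! ### Bessel pairs -/

/-- `(V, W)` is a `Q`-dimensional Bessel pair on `(0, R)` with positive solution `f`: `V`, `W` are
`C¹` on `(0, R)` and `f > 0` is a classical solution of
`(r^{Q-1} V f')' + r^{Q-1} W f = 0` on `(0, R)`. -/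
structure IsBesselPair (Q : ℕ) (R : EReal) (V W f : ℝ → ℝ) : Prop where
  contDiffOn_V : ContDiffOn ℝ 1 V (radii R)
  contDiffOn_W : ContDiffOn ℝ 1 W (radii R)
  contDiffOn_f : ContDiffOn ℝ 1 f (radii R)
  pos : ∀ r ∈ radii R, 0 < f r
  ode : ∀ r ∈ radii R,
    HasDerivAt (fun s => s ^ (Q - 1) * V s * deriv f s) (-(r ^ (Q - 1) * W r * f r)) r

/-! ### Polar coordinates and spherical harmonics on the gauge sphere `Ω = {ϱ = 1}` -/

/-- Polar coordinates: the point with gauge `r` and angular coordinates `σ = (φ, w)`, that is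
`x = r (sin φ)^{1/2} w` and `t = (r² / 2) cos φ`, with `0 < φ < π` and `w ∈ 𝕊^{n-1}`. -/
def polar {n : ℕ} (r : ℝ) (σ : ℝ × Sphere n) : Space n :=
  ((r * √(Real.sin σ.1)) • (σ.2 : EuclideanSpace ℝ (Fin n)), r ^ 2 / 2 * Real.cos σ.1)

/-- The measure `dΩ = (sin φ)^{n/2} dφ dw` on `Ω` in the coordinates `(φ, w)`, `0 < φ < π`, where
`dw` is the usual surface measure of `𝕊^{n-1}`. -/
def sphereMeasure (n : ℕ) : Measure (ℝ × Sphere n) :=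
  (((volume : Measure ℝ).restrict (Ioo 0 Real.pi)).withDensity
    (fun φ => ENNReal.ofReal (Real.sin φ ^ ((n : ℝ) / 2)))).prod
      (volume : Measure (EuclideanSpace ℝ (Fin n))).toSphere

/-- The Gegenbauer polynomial `C_m^a`,
`C_m^a(s) = ∑_{i ≤ m/2} (-1)^i (a)_{m-i} / (i! (m-2i)!) (2s)^{m-2i}`,
with `(a)_k = a (a+1) ⋯ (a+k-1)`. -/
def gegenbauer (m : ℕ) (a s : ℝ) : ℝ :=
  ∑ i ∈ Finset.range (m / 2 + 1),
    (-1) ^ i * (ascPochhammer ℝ (m - i)).eval a / (i.factorial * (m - 2 * i).factorial) *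
      (2 * s) ^ (m - 2 * i)

/-- `P` is a harmonic homogeneous polynomial of degree `l` on `ℝⁿ`; the spherical harmonics of
degree `l` are the restrictions of such polynomials to `𝕊^{n-1}`. -/
def IsSolidHarmonic {n : ℕ} (l : ℕ) (P : MvPolynomial (Fin n) ℝ) : Prop :=
  P.IsHomogeneous l ∧ ∑ i, MvPolynomial.pderiv i (MvPolynomial.pderiv i P) = 0

/-- `g_{l,k}(φ, w) = (sin φ)^{l/2} C_{(k-l)/2}^{l/2 + n/4}(cos φ) Y_l(w)`,
with `Y_l` the restriction of `P` to `𝕊^{n-1}`. -/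
def harmonicFun {n : ℕ} (l k : ℕ) (P : MvPolynomial (Fin n) ℝ) (σ : ℝ × Sphere n) : ℝ :=
  Real.sin σ.1 ^ ((l : ℝ) / 2) *
    gegenbauer ((k - l) / 2) ((l : ℝ) / 2 + (n : ℝ) / 4) (Real.cos σ.1) *
    MvPolynomial.eval (fun i => (σ.2 : EuclideanSpace ℝ (Fin n)) i) P

lemma memLp_of_continuous {n : ℕ} {F : ℝ × Sphere n → ℝ} (hF : Continuous F) :
    MemLp F 2 (sphereMeasure n) := by
  have hfin : IsFiniteMeasure (((volume : Measure ℝ).restrict (Ioo 0 Real.pi)).withDensity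
      (fun φ => ENNReal.ofReal (Real.sin φ ^ ((n : ℝ) / 2)))) := by
    apply isFiniteMeasure_withDensity
    apply ne_of_lt
    calc ∫⁻ φ in Ioo 0 Real.pi, ENNReal.ofReal (Real.sin φ ^ ((n : ℝ) / 2))
        ≤ ∫⁻ φ in Ioo 0 Real.pi, 1 := by
          apply setLIntegral_mono measurable_const
          intro φ hφ
          have h0 := Real.sin_nonneg_of_mem_Icc (Ioo_subset_Icc_self hφ)
          rw [ENNReal.ofReal_le_one]
          exact Real.rpow_le_one h0 (Real.sin_le_one φ) (by positivity)
      _ < ⊤ := by simp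
  have hfin' : IsFiniteMeasure (sphereMeasure n) := by
    unfold sphereMeasure; infer_instance
  obtain ⟨C, hC⟩ := (isCompact_Icc (a := (0 : ℝ)) (b := Real.pi)).prod
    (isCompact_univ (X := Sphere n)) |>.exists_bound_of_continuousOn hF.continuousOn
  refine MemLp.of_bound hF.aestronglyMeasurable C ?_
  have h1 : ∀ᵐ φ ∂(((volume : Measure ℝ).restrict (Ioo 0 Real.pi)).withDensity
      (fun φ => ENNReal.ofReal (Real.sin φ ^ ((n : ℝ) / 2)))), φ ∈ Ioo 0 Real.pi :=
    (withDensity_absolutelyContinuous _ _).ae_le (ae_restrict_mem measurableSet_Ioo)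
  have h2 := (Measure.quasiMeasurePreserving_fst
    (ν := (volume : Measure (EuclideanSpace ℝ (Fin n))).toSphere)).ae h1
  filter_upwards [h2] with σ hσ
  exact hC σ ⟨Ioo_subset_Icc_self hσ, mem_univ _⟩

lemma continuous_polar {n : ℕ} (r : ℝ) : Continuous (polar (n := n) r) := by
  unfold polar; fun_prop

lemma continuous_harmonicFun {n : ℕ} (l k : ℕ) (P : MvPolynomial (Fin n) ℝ) :
    Continuous (harmonicFun l k P) := by
  unfold harmonicFun gegenbauer
  refine Continuous.mul (Continuous.mul ?_ (by fun_prop)) ?_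
  · exact (by fun_prop : Continuous fun σ : ℝ × Sphere n => Real.sin σ.1).rpow_const
      (fun _ => Or.inr (by positivity))
  · exact (MvPolynomial.continuous_eval P).comp (by fun_prop)

/-- The space `𝓗_k ⊆ L²(Ω, dΩ)` of spherical harmonics of order `k`: the (closed) span of the
functions `g_{l,k}` with `0 ≤ l ≤ k`, `l ≡ k (mod 2)` and `Y_l` any spherical harmonic of
degree `l` on `𝕊^{n-1}`. -/
def harmonics (n k : ℕ) : Submodule ℝ (Lp ℝ 2 (sphereMeasure n)) :=
  (Submodule.span ℝ {F | ∃ (l : ℕ) (P : MvPolynomial (Fin n) ℝ), l ≤ k ∧ l % 2 = k % 2 ∧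
    IsSolidHarmonic l P ∧
    F = (memLp_of_continuous (continuous_harmonicFun l k P)).toLp _}).topologicalClosure

instance (n k : ℕ) : CompleteSpace (harmonics n k) := by
  unfold harmonics; infer_instance

/-- The projection `𝓟_k u` of a continuous function `u = u(ϱ, σ)`: for each `r > 0`,
`(𝓟_k u)(r, ·)` is the `L²(Ω, dΩ)`-orthogonal projection of `u(r, ·)` onto `𝓗_k`. -/
def proj {n : ℕ} (k : ℕ) (u : C(Space n, ℝ)) (r : ℝ) : Lp ℝ 2 (sphereMeasure n) :=
  (harmonics n k).starProjection
    ((memLp_of_continuous (u.continuous.comp (continuous_polar r))).toLp _)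

/-- `u ∈ 𝓢_j(U)`: `u ∈ C_c^∞(U)` and `𝓟_0 u = ⋯ = 𝓟_j u = 0`. For `j = -1` the second condition is
void, so that `𝓢_{-1}(U) = C_c^∞(U)`. -/
structure IsInS {n : ℕ} (j : ℤ) (U : Set (Space n)) (u : Space n → ℝ) : Prop where
  smooth : ContDiff ℝ ∞ u
  hasCompactSupport : HasCompactSupport u
  tsupport_subset : tsupport u ⊆ U
  proj_eq_zero : ∀ k : ℕ, (k : ℤ) ≤ j → ∀ r : ℝ, 0 < r → proj k ⟨u, smooth.continuous⟩ r = 0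

end

end Grushin

namespace Grushin

noncomputable section

/-! ### Grushin operators on polynomials in `(x, t)` -/

/-! Write Z = x·∇_x + 2t∂_t for the generator of the dilations and N = ϱ⁴. The gradient of N pairs
with ∇_G u to give 4|x|² Zu, so the radial part of ∇_G u is carried by Zu = ϱ ∂_ϱ u, and ϱ⁴|∇_G u|²
= |x|²(Zu)² + `angForm u u`. The last term is nonnegative by Cauchy–Schwarz and is the energy along
the gauge spheres. The two parts are estimated separately.

Radial part (`integral_ray_eq_zero`, `integral_radial_identity`). On each dilation ray the Bessel
equation makes V(∂_ϱ u)² − W u² − V(∂_ϱ(u/f))² f², multiplied by ϱ^{Q−1}, the exact derivative of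
ϱ^{Q−1} V f' u²/f. This vanishes at both ends of the ray, so the radial energy equals the W term
plus the remainder, with equality.

Angular part (`angular_gap`). The functions spanning `harmonics n k` extend to polynomials that are
annihilated by the Grushin operator and homogeneous of degree k under dilations. Integration by
parts along a gauge sphere shows that they are eigenfunctions of `angForm` with eigenvalue k(k+n)
relative to the weight |x|². Since |x|² = ϱ² sin φ, this weight turns the angular part of Lebesgue
measure into dΩ. Distinct eigenvalues give orthogonality. Completeness (`mem_approximable`) comes
from Stone–Weierstrass, the decomposition of polynomials in x into harmonic ones, and the fact that
|x|² is a continuous function of t on a gauge sphere. Hence a function without components of order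
at most j satisfies a Poincaré inequality with the eigenvalue of order j+1, which is (j+1)(j+1+n) =
(j+1)(Q+j−1).

Adding the two parts gives (a). The pair V = 1, W = ((Q−2)/2)²/ϱ² with f = ϱ^{−(Q−2)/2} gives (b)
after the remainder is dropped. -/

/-- Polynomials in the variables `x_i = X (some i)` and `t = X none`. -/
abbrev GPoly (n : ℕ) : Type := MvPolynomial (Option (Fin n)) ℝ

open MvPolynomial in
/-- The polynomial `|x|²`. -/
def normSqPoly (n : ℕ) : GPoly n := ∑ i : Fin n, X (some i) ^ 2

open MvPolynomial in
/-- The polynomial `t`. -/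
def timePoly (n : ℕ) : GPoly n := X none

/-- The polynomial `|x|⁴ + 4 t²`, the fourth power of the gauge. -/
def gaugePoly (n : ℕ) : GPoly n := normSqPoly n ^ 2 + 4 * timePoly n ^ 2

open MvPolynomial in
/-- The Grushin operator `Δ_x + |x|² ∂_t²` on polynomials. -/
def lapPoly {n : ℕ} (g : GPoly n) : GPoly n :=
  ∑ i, pderiv (some i) (pderiv (some i) g) + normSqPoly n * pderiv none (pderiv none g)

open MvPolynomial in
/-- The carré du champ `⟨∇_G g, ∇_G h⟩` on polynomials. -/
def gammaPoly {n : ℕ} (g h : GPoly n) : GPoly n :=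
  ∑ i, pderiv (some i) g * pderiv (some i) h + normSqPoly n * (pderiv none g * pderiv none h)

open MvPolynomial in
/-- The generator `x · ∇_x + 2 t ∂_t` of the anisotropic dilations, as a derivation. -/
def eulerPoly (n : ℕ) : Derivation ℝ (GPoly n) (GPoly n) :=
  ∑ i : Fin n, (X (some i) : GPoly n) • pderiv (some i) + (2 * timePoly n) • pderiv none

section Algebra
open MvPolynomial
variable {n : ℕ}

lemma eulerPoly_apply (g : GPoly n) :
    eulerPoly n g = ∑ i, X (some i) * pderiv (some i) g + 2 * timePoly n * pderiv none g := by
  simp only [eulerPoly, Derivation.add_apply, Derivation.smul_apply, smul_eq_mul]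
  congr 1
  rw [← Derivation.coeFnAddMonoidHom_apply, map_sum, Finset.sum_apply]
  rfl

lemma lapPoly_add (g h : GPoly n) : lapPoly (g + h) = lapPoly g + lapPoly h := by
  simp only [lapPoly, map_add, Finset.sum_add_distrib]; ring

lemma lapPoly_smul (c : ℝ) (g : GPoly n) : lapPoly (c • g) = c • lapPoly g := by
  simp only [lapPoly, Derivation.map_smul, smul_add, Finset.smul_sum, mul_smul_comm]

lemma lapPoly_mul (g h : GPoly n) :
    lapPoly (g * h) = g * lapPoly h + h * lapPoly g + 2 * gammaPoly g h := by
  simp only [lapPoly, gammaPoly, pderiv_mul, map_add, mul_add, Finset.sum_add_distrib,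
    Finset.mul_sum]
  have e : ∀ a b : Fin n → GPoly n, (∑ i, a i * b i) = ∑ i, b i * a i := fun a b =>
    Finset.sum_congr rfl fun i _ => mul_comm _ _
  have h1 : ∑ i, 2 * (pderiv (some i) g * pderiv (some i) h) =
      2 * ∑ i, pderiv (some i) g * pderiv (some i) h := by rw [Finset.mul_sum]
  rw [h1, e (fun i => pderiv (some i) (pderiv (some i) g)) (fun _ => h)]
  ring

lemma gammaPoly_comm (g h : GPoly n) : gammaPoly g h = gammaPoly h g := by
  simp only [gammaPoly, mul_comm]

lemma gammaPoly_mul_right (g h k : GPoly n) :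
    gammaPoly g (h * k) = h * gammaPoly g k + k * gammaPoly g h := by
  simp only [gammaPoly, pderiv_mul, mul_add, Finset.sum_add_distrib, Finset.mul_sum]
  have h1 : ∀ i, pderiv (some i) g * (pderiv (some i) h * k) =
    k * (pderiv (some i) g * pderiv (some i) h) := fun i => by ring
  have h2 : ∀ i, pderiv (some i) g * (h * pderiv (some i) k) =
    h * (pderiv (some i) g * pderiv (some i) k) := fun i => by ring
  simp only [h1, h2]
  ring

lemma gammaPoly_pow_right (g h : GPoly n) (k : ℕ) :
    gammaPoly g (h ^ k) = k * h ^ (k - 1) * gammaPoly g h := by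
  simp only [gammaPoly, pderiv_pow, mul_add, Finset.mul_sum]
  refine congrArg₂ (· + ·) (Finset.sum_congr rfl fun i _ => ?_) ?_ <;> ring

lemma lapPoly_pow (g : GPoly n) (k : ℕ) :
    lapPoly (g ^ k) = k * g ^ (k - 1) * lapPoly g +
      (k * (k - 1) : ℝ) • (g ^ (k - 2) * gammaPoly g g) := by
  have hz : lapPoly (1 : GPoly n) = 0 := by simp [lapPoly]
  induction k with
  | zero => simp [hz]
  | succ k ih =>
    rw [pow_succ, lapPoly_mul, ih, gammaPoly_comm (g ^ k), gammaPoly_pow_right]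
    -- The exponents k − 1 and k − 2 are truncated; for small k the coefficients k and k(k−1)
    -- vanish, so those cases are checked apart.
    rcases k with _ | _ | k
    · simp
    · simp [MvPolynomial.smul_eq_C_mul, show (C 2 : GPoly n) = 2 from map_ofNat C 2]; ring
    · simp only [MvPolynomial.smul_eq_C_mul]
      push_cast
      simp only [map_add, map_sub, map_mul, map_natCast, map_one]
      ring

lemma pderiv_normSqPoly (i : Fin n) : pderiv (some i) (normSqPoly n) = 2 * X (some i) := by
  classical
  simp [normSqPoly, pderiv_X, Pi.single_apply]

lemma pderiv_none_normSqPoly : pderiv none (normSqPoly n) = 0 := by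
  classical
  simp [normSqPoly, pderiv_X]

lemma pderiv_timePoly (i : Fin n) : pderiv (some i) (timePoly n) = 0 := by
  classical
  simp [timePoly, pderiv_X]

lemma pderiv_none_timePoly : pderiv none (timePoly n) = 1 := by
  simp [timePoly]

lemma pderiv_gaugePoly (i : Fin n) :
    pderiv (some i) (gaugePoly n) = 4 * normSqPoly n * X (some i) := by
  simp only [gaugePoly, map_add, pderiv_pow, pderiv_mul, pderiv_normSqPoly, pderiv_timePoly]
  have : pderiv (some i) (4 : GPoly n) = 0 := by
    rw [← map_ofNat (C : ℝ →+* GPoly n)]; exact pderiv_C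
  rw [this]; push_cast; ring

lemma pderiv_none_gaugePoly : pderiv none (gaugePoly n) = 8 * timePoly n := by
  simp only [gaugePoly, map_add, pderiv_pow, pderiv_mul, pderiv_none_normSqPoly,
    pderiv_none_timePoly]
  have : pderiv none (4 : GPoly n) = 0 := by
    rw [← map_ofNat (C : ℝ →+* GPoly n)]; exact pderiv_C
  rw [this]; push_cast; ring

/-- The Grushin gradient of N = ϱ⁴ is dual to 4|x|² times the dilation field: ∇_x N = 4|x|² x and
|x|² ∂_t N = 4|x|²·2t. This is why polar coordinates along dilation rays separate the energy. -/
lemma gammaPoly_gaugePoly (g : GPoly n) :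
    gammaPoly g (gaugePoly n) = 4 * normSqPoly n * eulerPoly n g := by
  simp only [gammaPoly, pderiv_gaugePoly, pderiv_none_gaugePoly, eulerPoly_apply, mul_add,
    Finset.mul_sum]
  congr 1
  · exact Finset.sum_congr rfl fun i _ => by ring
  · ring

lemma eulerPoly_timePoly : eulerPoly n (timePoly n) = 2 * timePoly n := by
  rw [eulerPoly_apply, pderiv_none_timePoly]
  simp [pderiv_timePoly]

lemma eulerPoly_gaugePoly : eulerPoly n (gaugePoly n) = 4 * gaugePoly n := by
  rw [eulerPoly_apply, pderiv_none_gaugePoly]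
  simp only [pderiv_gaugePoly]
  have : ∑ i : Fin n, X (some i) * (4 * normSqPoly n * X (some i)) =
      4 * normSqPoly n * normSqPoly n := by
    conv_rhs => rw [normSqPoly, Finset.mul_sum]
    exact Finset.sum_congr rfl fun i _ => by rw [normSqPoly]; ring
  rw [this, gaugePoly]; ring

lemma lapPoly_timePoly : lapPoly (timePoly n) = 0 := by
  simp [lapPoly, pderiv_timePoly, pderiv_none_timePoly]

lemma gammaPoly_timePoly : gammaPoly (timePoly n) (timePoly n) = normSqPoly n := by
  simp [gammaPoly, pderiv_timePoly, pderiv_none_timePoly]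

/-- The Laplacian of |x|⁴ contributes 4(n+2)|x|² and |x|²∂_t²(4t²) contributes 8|x|². -/
lemma lapPoly_gaugePoly : lapPoly (gaugePoly n) = (4 * (n + 4) : ℝ) • normSqPoly n := by
  have h8 : pderiv none (8 : GPoly n) = 0 := by
    rw [← map_ofNat (C : ℝ →+* GPoly n)]; exact pderiv_C
  have h4 : ∀ i : Fin n, pderiv (some i) (4 : GPoly n) = 0 := fun i => by
    rw [← map_ofNat (C : ℝ →+* GPoly n)]; exact pderiv_C
  have : ∀ i : Fin n, pderiv (some i) (4 * normSqPoly n * X (some i)) =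
      8 * X (some i) ^ 2 + 4 * normSqPoly n := fun i => by
    rw [pderiv_mul, pderiv_mul, h4, pderiv_normSqPoly, pderiv_X_self]; ring
  simp only [lapPoly, pderiv_gaugePoly, pderiv_none_gaugePoly, this, Finset.sum_add_distrib,
    ← Finset.mul_sum, pderiv_mul, pderiv_none_timePoly, h8]
  simp only [Finset.sum_const, Finset.card_univ, Fintype.card_fin, smul_eq_C_mul, map_mul, map_add,
    map_ofNat, map_natCast, nsmul_eq_mul]
  rw [← normSqPoly]; ring

/-- The Grushin operator on `P t^e ϱ^{4i}` for `P` harmonic and homogeneous of degree `l` in `x`. -/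
lemma lapPoly_harmonic_mul {P : GPoly n} {l : ℕ} (hlap : lapPoly P = 0)
    (ht : pderiv none P = 0) (he : eulerPoly n P = (l : ℝ) • P) (e i : ℕ) :
    lapPoly (P * (timePoly n ^ e * gaugePoly n ^ i)) =
      normSqPoly n * P * (C (4 * i * (n + 2 * l + 4 * i + 4 * e) : ℝ) *
          (timePoly n ^ e * gaugePoly n ^ (i - 1)) +
        C (e * (e - 1) : ℝ) * (timePoly n ^ (e - 2) * gaugePoly n ^ i)) := by
  -- In the constant 4i(n + 2l + 4i + 4e), the part 4i(n+4i) comes from the operator on N^i, 8il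
  -- from pairing N^i with P, and 16ie from pairing N^i with t^e. There is no pairing of P with t.
  have hPt : gammaPoly P (timePoly n) = 0 := by
    simp [gammaPoly, pderiv_timePoly, ht]
  have hPe : gammaPoly P (timePoly n ^ e) = 0 := by rw [gammaPoly_pow_right, hPt, mul_zero]
  have hPN : gammaPoly P (gaugePoly n ^ i) =
      i * gaugePoly n ^ (i - 1) * (4 * normSqPoly n * ((l : ℝ) • P)) := by
    rw [gammaPoly_pow_right, gammaPoly_gaugePoly, he]
  have hTN : gammaPoly (timePoly n ^ e) (gaugePoly n ^ i) =
      i * gaugePoly n ^ (i - 1) * (4 * normSqPoly n * eulerPoly n (timePoly n ^ e)) := by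
    rw [gammaPoly_pow_right, gammaPoly_gaugePoly]
  rw [lapPoly_mul, hlap, lapPoly_mul, gammaPoly_mul_right, hPe, hPN, hTN,
    Derivation.leibniz_pow, eulerPoly_timePoly, lapPoly_pow, lapPoly_pow, lapPoly_timePoly,
    gammaPoly_timePoly, lapPoly_gaugePoly, gammaPoly_gaugePoly, eulerPoly_gaugePoly]
  simp only [smul_eq_C_mul, nsmul_eq_mul, smul_eq_mul, map_mul, map_add, map_sub, map_natCast,
    map_ofNat, map_one]
  rcases i with _ | _ | i
  · simp; ring
  · rcases e with _ | e
    · simp; ring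
    · simp only [Nat.add_sub_cancel]; push_cast; ring
  · rcases e with _ | e
    · simp only [Nat.add_sub_cancel, show i + 1 + 1 - 2 = i by omega]; push_cast; ring
    · simp only [Nat.add_sub_cancel, show i + 1 + 1 - 2 = i by omega]; push_cast; ring

lemma eulerPoly_harmonic_mul {P : GPoly n} {l : ℕ}
    (he : eulerPoly n P = (l : ℝ) • P) (e i : ℕ) :
    eulerPoly n (P * (timePoly n ^ e * gaugePoly n ^ i)) =
      ((l + 2 * e + 4 * i : ℕ) : ℝ) • (P * (timePoly n ^ e * gaugePoly n ^ i)) := by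
  simp only [Derivation.leibniz, Derivation.leibniz_pow, he, eulerPoly_timePoly,
    eulerPoly_gaugePoly, smul_eq_mul, nsmul_eq_mul, smul_eq_C_mul, map_natCast]
  push_cast
  rcases i with _ | i <;> rcases e with _ | e
  · simp
  · simp; ring
  · simp; ring
  · simp only [Nat.add_sub_cancel]; push_cast; ring

/-! ### Solid harmonics built from Gegenbauer polynomials -/

/-- The coefficients of the Gegenbauer polynomial `C_m^a` in powers of `2s`. -/
def gegenbauerCoeff (m : ℕ) (a : ℝ) (i : ℕ) : ℝ :=
  (-1) ^ i * (ascPochhammer ℝ (m - i)).eval a / (i.factorial * (m - 2 * i).factorial)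

/-- The Gegenbauer differential equation read on coefficients. Writing the degree as 2i+2+e removes
all truncated subtractions. -/
lemma gegenbauerCoeff_succ (a : ℝ) (i e : ℕ) :
    (i + 1) * (a + (i + 1 + e)) * gegenbauerCoeff (2 * i + 2 + e) a (i + 1) =
      -((e + 2) * (e + 1) * gegenbauerCoeff (2 * i + 2 + e) a i) := by
  simp only [gegenbauerCoeff, show 2 * i + 2 + e - (i + 1) = i + 1 + e by omega,
    show 2 * i + 2 + e - i = i + 1 + e + 1 by omega,
    show 2 * i + 2 + e - 2 * (i + 1) = e by omega, show 2 * i + 2 + e - 2 * i = e + 1 + 1 by omega,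
    ascPochhammer_succ_eval, Nat.factorial_succ]
  have h1 : ((i.factorial : ℕ) : ℝ) ≠ 0 := by positivity
  have h2 : ((e.factorial : ℕ) : ℝ) ≠ 0 := by positivity
  have h3 : ((e : ℝ) + 1) ≠ 0 := by positivity
  have h4 : ((i : ℝ) + 1) ≠ 0 := by positivity
  have h5 : ((e : ℝ) + 1 + 1) ≠ 0 := by positivity
  push_cast
  field_simp
  ring

/-- The polynomial `P(x) ϱ^{2m} C_m^{l/2+n/4}(2t/ϱ²)` in `(x, t)`, whose restriction to the gauge
sphere is the harmonic of order `l + 2m` built from `P`. -/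
def solidPoly (l m : ℕ) (P : MvPolynomial (Fin n) ℝ) : GPoly n :=
  ∑ i ∈ Finset.range (m / 2 + 1),
    C (gegenbauerCoeff m ((l : ℝ) / 2 + (n : ℝ) / 4) i * 4 ^ (m - 2 * i)) *
      (rename some P * (timePoly n ^ (m - 2 * i) * gaugePoly n ^ i))

lemma pderiv_none_rename (P : MvPolynomial (Fin n) ℝ) :
    pderiv none (rename some P : GPoly n) = 0 := by
  classical
  induction P using MvPolynomial.induction_on with
  | C a => simp
  | add p q hp hq => simp [hp, hq]
  | mul_X p i hp => simp [hp, pderiv_X]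

lemma lapPoly_rename (P : MvPolynomial (Fin n) ℝ) :
    lapPoly (rename some P : GPoly n) = rename some (∑ i, pderiv i (pderiv i P)) := by
  simp [lapPoly, pderiv_none_rename, pderiv_rename (Option.some_injective _)]

lemma eulerPoly_rename {P : MvPolynomial (Fin n) ℝ} {l : ℕ} (hP : P.IsHomogeneous l) :
    eulerPoly n (rename some P) = (l : ℝ) • (rename some P : GPoly n) := by
  rw [eulerPoly_apply, pderiv_none_rename, mul_zero, add_zero]
  have := congrArg (rename (some : Fin n → Option (Fin n))) hP.sum_X_mul_pderiv
  simp only [map_sum, map_mul, rename_X, map_nsmul] at this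
  simp only [pderiv_rename (Option.some_injective _), this]
  rw [← Nat.cast_smul_eq_nsmul ℝ]

lemma eulerPoly_solidPoly {P : MvPolynomial (Fin n) ℝ} {l : ℕ} (hP : P.IsHomogeneous l) (m : ℕ) :
    eulerPoly n (solidPoly l m P) = ((l + 2 * m : ℕ) : ℝ) • solidPoly l m P := by
  rw [solidPoly, map_sum, Finset.smul_sum]
  refine Finset.sum_congr rfl fun i hi => ?_
  have hi' : 2 * i ≤ m := by have := Finset.mem_range.1 hi; omega
  rw [← smul_eq_C_mul, Derivation.map_smul, eulerPoly_harmonic_mul (eulerPoly_rename hP),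
    smul_comm, show l + 2 * (m - 2 * i) + 4 * i = l + 2 * m by omega]

/-- The operator sends P t^{m−2i} N^i to a term with one N fewer and a term with t² fewer. The first
for i+1 and the second for i are the same monomial, and the coefficient recursion makes them cancel.
-/
lemma lapPoly_solidPoly {P : MvPolynomial (Fin n) ℝ} {l : ℕ} (hP : IsSolidHarmonic l P) (m : ℕ) :
    lapPoly (solidPoly l m P) = 0 := by
  set a : ℝ := (l : ℝ) / 2 + (n : ℝ) / 4 with ha
  set A : ℕ → GPoly n := fun i => C (gegenbauerCoeff m a i * 4 ^ (m - 2 * i) *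
      (4 * i * (n + 2 * l + 4 * i + 4 * (m - 2 * i : ℕ)))) *
    (timePoly n ^ (m - 2 * i) * gaugePoly n ^ (i - 1)) with hA
  set B : ℕ → GPoly n := fun i => C (gegenbauerCoeff m a i * 4 ^ (m - 2 * i) *
      ((m - 2 * i : ℕ) * ((m - 2 * i : ℕ) - 1))) *
    (timePoly n ^ (m - 2 * i - 2) * gaugePoly n ^ i) with hB
  have hsum : lapPoly (solidPoly l m P) = normSqPoly n * rename some P *
      ∑ i ∈ Finset.range (m / 2 + 1), (A i + B i) := by
    have hlin : ∀ (s : Finset ℕ) (F : ℕ → GPoly n), lapPoly (∑ i ∈ s, F i) =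
        ∑ i ∈ s, lapPoly (F i) := fun s F =>
      map_sum (AddMonoidHom.mk' (lapPoly (n := n)) lapPoly_add) F s
    rw [solidPoly, hlin, Finset.mul_sum]
    refine Finset.sum_congr rfl fun i _ => ?_
    rw [← smul_eq_C_mul, lapPoly_smul, lapPoly_harmonic_mul (l := l)
      (by rw [lapPoly_rename, hP.2, map_zero]) (pderiv_none_rename P) (eulerPoly_rename hP.1)]
    simp only [hA, hB, smul_eq_C_mul, map_mul]
    ring
  have hzero : ∑ i ∈ Finset.range (m / 2 + 1), (A i + B i) = 0 := by
    have hA0 : A 0 = 0 := by simp [hA]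
    -- The last exponent e = m − 2(m/2) is 0 or 1, so e(e−1) = 0 and the top term has no partner to
    -- cancel.
    have hBM : B (m / 2) = 0 := by
      rcases Nat.mod_two_eq_zero_or_one m with h | h
      · have : m - 2 * (m / 2) = 0 := by omega
        simp [hB, this]
      · have : m - 2 * (m / 2) = 1 := by omega
        simp [hB, this]
    rw [Finset.sum_add_distrib, Finset.sum_range_succ', Finset.sum_range_succ B, hA0, hBM,
      add_zero, add_zero, ← Finset.sum_add_distrib]
    refine Finset.sum_eq_zero fun i hi => ?_
    obtain ⟨e, rfl⟩ : ∃ e, m = 2 * i + 2 + e :=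
      ⟨m - (2 * i + 2), by have := Finset.mem_range.1 hi; omega⟩
    have h1 : 2 * i + 2 + e - 2 * (i + 1) = e := by omega
    have h2 : 2 * i + 2 + e - 2 * i = e + 2 := by omega
    simp only [hA, hB, h1, h2, Nat.add_sub_cancel]
    rw [← add_mul, ← C_add]
    convert zero_mul _ using 2
    rw [← C_0]
    congr 1
    have := gegenbauerCoeff_succ a i e
    push_cast
    -- This relation is what forces the Gegenbauer index a = l/2 + n/4; a common factor 16·4^e then
    -- comes out of both coefficients.
    have hn : (n : ℝ) + 2 * l = 4 * a := by rw [ha]; ring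
    rw [hn]
    linear_combination (16 * 4 ^ e) * this
  rw [hsum, hzero, mul_zero]

/-- The divergence of the tangential field `N ∇_G G - k |x|² G · (x, 2t)`, for `G` harmonic and
homogeneous of degree `k`. -/
lemma div_tangential {G : GPoly n} {k : ℕ} (hlap : lapPoly G = 0)
    (he : eulerPoly n G = (k : ℝ) • G) :
    ∑ i, pderiv (some i) (gaugePoly n * pderiv (some i) G -
        C (k : ℝ) * (normSqPoly n * X (some i) * G)) +
      pderiv none (gaugePoly n * (normSqPoly n * pderiv none G) -
        C (k : ℝ) * (normSqPoly n * (2 * timePoly n) * G)) =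
    -(C (k * (k + n) : ℝ) * (normSqPoly n * G)) := by
  -- The first half of the field contributes 4k|x|²G. The second contributes −k(2 + k + n + 2)|x|²G:
  -- degree 2 of |x|², degree k of G, and divergence n+2 of the dilation field.
  have h2 : pderiv none (2 : GPoly n) = 0 := by
    rw [← map_ofNat (C : ℝ →+* GPoly n)]; exact pderiv_C
  have h1 : ∀ i : Fin n, pderiv (some i) (gaugePoly n * pderiv (some i) G -
        C (k : ℝ) * (normSqPoly n * X (some i) * G)) =
      (4 * normSqPoly n - C (k : ℝ) * normSqPoly n) * (X (some i) * pderiv (some i) G) +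
      gaugePoly n * pderiv (some i) (pderiv (some i) G) -
      C (k : ℝ) * 2 * G * X (some i) ^ 2 - C (k : ℝ) * (normSqPoly n * G) := fun i => by
    rw [map_sub, pderiv_mul, pderiv_C_mul, pderiv_mul, pderiv_mul, pderiv_gaugePoly,
      pderiv_normSqPoly, pderiv_X_self]
    ring
  simp only [h1, Finset.sum_add_distrib, Finset.sum_sub_distrib, ← Finset.mul_sum]
  rw [show ∑ i : Fin n, (X (some i) : GPoly n) ^ 2 = normSqPoly n from rfl]
  rw [map_sub, pderiv_mul, pderiv_mul, pderiv_C_mul, pderiv_mul, pderiv_mul, pderiv_mul, h2,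
    pderiv_none_gaugePoly, pderiv_none_normSqPoly, pderiv_none_timePoly]
  rw [eulerPoly_apply, smul_eq_C_mul] at he
  rw [lapPoly] at hlap
  simp only [Finset.sum_const, Finset.card_univ, Fintype.card_fin, nsmul_eq_mul, map_mul, map_add,
    map_natCast] at he ⊢
  linear_combination (4 * normSqPoly n - (k : GPoly n) * normSqPoly n) * he +
    gaugePoly n * hlap

end Algebra

/-! ### Integration in polar coordinates -/

section PolarIntegration
open Real

/-- The measure `(sin φ)^{n/2-1} dφ dw` on `(0, π) × 𝕊^{n-1}`. -/
def angularMeasure (n : ℕ) : Measure (ℝ × Sphere n) :=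
  (((volume : Measure ℝ).restrict (Ioo 0 Real.pi)).withDensity
    (fun φ => ENNReal.ofReal (Real.sin φ ^ ((n : ℝ) / 2 - 1)))).prod
      (volume : Measure (EuclideanSpace ℝ (Fin n))).toSphere

/-- The measure `r^{n+1}/2 dr` on `(0, ∞)`. -/
def radialMeasure (n : ℕ) : Measure ℝ :=
  (volume.restrict (Ioi 0)).withDensity (fun r => ENNReal.ofReal (r ^ (n + 1) / 2))

instance (n : ℕ) : SFinite (angularMeasure n) := by unfold angularMeasure; infer_instance

instance (n : ℕ) : SFinite (radialMeasure n) := by unfold radialMeasure; infer_instance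

/-- For n ≥ 2 the exponent n/2 − 1 is nonnegative, so the density is at most 1. -/
lemma isFiniteMeasure_angularMeasure {n : ℕ} (hn : 2 ≤ n) :
    IsFiniteMeasure (angularMeasure n) := by
  have hfin : IsFiniteMeasure (((volume : Measure ℝ).restrict (Ioo 0 Real.pi)).withDensity
      (fun φ => ENNReal.ofReal (Real.sin φ ^ ((n : ℝ) / 2 - 1)))) := by
    apply isFiniteMeasure_withDensity
    apply ne_of_lt
    calc ∫⁻ φ in Ioo 0 Real.pi, ENNReal.ofReal (Real.sin φ ^ ((n : ℝ) / 2 - 1))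
        ≤ ∫⁻ φ in Ioo 0 Real.pi, 1 := by
          apply setLIntegral_mono measurable_const
          intro φ hφ
          have h0 := Real.sin_nonneg_of_mem_Icc (Ioo_subset_Icc_self hφ)
          rw [ENNReal.ofReal_le_one]
          refine Real.rpow_le_one h0 (Real.sin_le_one φ) ?_
          have : (2 : ℝ) ≤ n := by exact_mod_cast hn
          linarith
      _ < ⊤ := by simp
  unfold angularMeasure; infer_instance

lemma ae_angularMeasure (n : ℕ) : ∀ᵐ σ ∂angularMeasure n, σ.1 ∈ Ioo 0 Real.pi := by
  have h1 : ∀ᵐ φ ∂(((volume : Measure ℝ).restrict (Ioo 0 Real.pi)).withDensity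
      (fun φ => ENNReal.ofReal (Real.sin φ ^ ((n : ℝ) / 2 - 1)))), φ ∈ Ioo 0 Real.pi :=
    (withDensity_absolutelyContinuous _ _).ae_le (ae_restrict_mem measurableSet_Ioo)
  exact (Measure.quasiMeasurePreserving_fst
    (ν := (volume : Measure (EuclideanSpace ℝ (Fin n))).toSphere)).ae h1

/-- Lebesgue measure has angular density (sin φ)^{n/2−1}. The missing factor sin φ is |∇_G ϱ|² =
|x|²/ϱ², so weighted integrals over gauge spheres live in L²(dΩ). -/
lemma sphereMeasure_eq_withDensity (n : ℕ) :
    sphereMeasure n = (angularMeasure n).withDensity (fun σ => ENNReal.ofReal (sin σ.1)) := by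
  unfold sphereMeasure angularMeasure
  rw [← prod_withDensity_left (f := fun φ => ENNReal.ofReal (sin φ)) (by fun_prop),
    ← withDensity_mul _ (by fun_prop) (by fun_prop)]
  congr 1
  refine withDensity_congr_ae ?_
  filter_upwards [ae_restrict_mem measurableSet_Ioo] with φ hφ
  have hs := sin_pos_of_mem_Ioo hφ
  rw [Pi.mul_apply, ← ENNReal.ofReal_mul (by positivity), ← rpow_add_one hs.ne']
  congr 2; ring

lemma integral_sphereMeasure {n : ℕ} (g : ℝ × Sphere n → ℝ) :
    ∫ σ, g σ ∂sphereMeasure n = ∫ σ, sin σ.1 * g σ ∂angularMeasure n := by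
  rw [sphereMeasure_eq_withDensity, integral_withDensity_eq_integral_toReal_smul
    (by fun_prop) (by simp)]
  refine integral_congr_ae ?_
  filter_upwards [ae_angularMeasure n] with σ hσ
  rw [ENNReal.toReal_ofReal (sin_pos_of_mem_Ioo hσ).le, smul_eq_mul]

lemma ae_sphereMeasure (n : ℕ) : ∀ᵐ σ ∂sphereMeasure n, σ.1 ∈ Ioo 0 Real.pi := by
  rw [sphereMeasure_eq_withDensity]
  exact (withDensity_absolutelyContinuous _ _).ae_le (ae_angularMeasure n)

/-- The polar map in the half plane `{s > 0}` of points `(s, t) = (|x|, t)`. -/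
def planarPolar (q : ℝ × ℝ) : ℝ × ℝ := (q.1 * √(sin q.2), q.1 ^ 2 / 2 * cos q.2)

/-- The derivative of `planarPolar`. -/
def fderivPlanarPolar (q : ℝ × ℝ) : ℝ × ℝ →L[ℝ] ℝ × ℝ :=
  (Matrix.toLin (.finTwoProd ℝ) (.finTwoProd ℝ)
    !![√(sin q.2), q.1 * (cos q.2 / (2 * √(sin q.2)));
      q.1 * cos q.2, -(q.1 ^ 2 / 2 * sin q.2)]).toContinuousLinearMap

lemma hasFDerivAt_planarPolar {q : ℝ × ℝ} (hq : 0 < sin q.2) :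
    HasFDerivAt planarPolar (fderivPlanarPolar q) q := by
  unfold fderivPlanarPolar
  rw [Matrix.toLin_finTwoProd_toContinuousLinearMap]
  have h1 : HasFDerivAt (fun q : ℝ × ℝ => q.1) (ContinuousLinearMap.fst ℝ ℝ ℝ) q := hasFDerivAt_fst
  have hsnd : HasFDerivAt (fun q : ℝ × ℝ => q.2) (ContinuousLinearMap.snd ℝ ℝ ℝ) q :=
    hasFDerivAt_snd
  have h2 := ((hasDerivAt_sin q.2).sqrt hq.ne').comp_hasFDerivAt q hsnd
  have h3 := (hasDerivAt_cos q.2).comp_hasFDerivAt q hsnd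
  have h4 : HasFDerivAt (fun q : ℝ × ℝ => q.1 ^ 2 / 2) _ q :=
    ((h1.pow 2).mul_const (1 / 2)).congr_of_eventuallyEq
      (Filter.Eventually.of_forall fun q => by simp; ring)
  refine ((h1.mul h2).prodMk (h4.mul h3)).congr_fderiv ?_
  ext <;> simp
  all_goals ring

lemma abs_det_fderivPlanarPolar {q : ℝ × ℝ} (hq : 0 < sin q.2) :
    |(fderivPlanarPolar q).det| = q.1 ^ 2 / 2 * (√(sin q.2))⁻¹ := by
  have h : (fderivPlanarPolar q).det = -(q.1 ^ 2 / 2 * (√(sin q.2))⁻¹) := by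
    unfold fderivPlanarPolar
    simp only [LinearMap.det_toContinuousLinearMap, LinearMap.det_toLin, Matrix.det_fin_two_of]
    have hs : √(sin q.2) ≠ 0 := (sqrt_pos.2 hq).ne'
    have h2 : √(sin q.2) ^ 2 = sin q.2 := sq_sqrt hq.le
    field_simp
    rw [h2]
    linear_combination -q.1 ^ 2 * sin_sq_add_cos_sq q.2
  rw [h, abs_neg, abs_of_nonneg (by positivity)]

/-- The image point determines r² sin φ and r² cos φ, hence r⁴ as the sum of their squares, and then
cos φ on (0, π). -/
lemma injOn_planarPolar : InjOn planarPolar (Ioi 0 ×ˢ Ioo 0 π) := by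
  rintro ⟨r, φ⟩ ⟨hr, hφ⟩ ⟨r', φ'⟩ ⟨hr', hφ'⟩ h
  simp only [mem_Ioi] at hr hr' hφ hφ'
  simp only [planarPolar, Prod.mk.injEq] at h
  have hs := sin_pos_of_mem_Ioo hφ
  have hs' := sin_pos_of_mem_Ioo hφ'
  have h1 : r ^ 2 * sin φ = r' ^ 2 * sin φ' := by
    have := congrArg (· ^ 2) h.1
    simpa only [mul_pow, sq_sqrt hs.le, sq_sqrt hs'.le] using this
  have h2 : r ^ 2 * cos φ = r' ^ 2 * cos φ' := by linarith [h.2]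
  have h3 : r ^ 4 = r' ^ 4 := by
    have e1 : r ^ 4 = (r ^ 2 * sin φ) ^ 2 + (r ^ 2 * cos φ) ^ 2 := by
      linear_combination -r ^ 4 * sin_sq_add_cos_sq φ
    have e2 : r' ^ 4 = (r' ^ 2 * sin φ') ^ 2 + (r' ^ 2 * cos φ') ^ 2 := by
      linear_combination -r' ^ 4 * sin_sq_add_cos_sq φ'
    rw [e1, e2, h1, h2]
  have h4 : r = r' := (pow_left_inj₀ hr.le hr'.le (by norm_num)).1 h3
  subst h4
  have h5 : cos φ = cos φ' := mul_left_cancel₀ (by positivity) h2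
  rw [injOn_cos (Ioo_subset_Icc_self hφ) (Ioo_subset_Icc_self hφ') h5]

lemma image_planarPolar : planarPolar '' (Ioi 0 ×ˢ Ioo 0 π) = Ioi 0 ×ˢ univ := by
  ext ⟨s, t⟩
  simp only [mem_image, mem_prod, mem_Ioi, mem_univ, and_true, Prod.exists]
  constructor
  · rintro ⟨r, φ, ⟨hr, hφ⟩, h⟩
    simp only [planarPolar, Prod.mk.injEq] at h
    rw [← h.1]
    exact mul_pos hr (sqrt_pos.2 (sin_pos_of_mem_Ioo hφ))
  · intro hs
    -- The preimage is r = N^{1/4}, φ = arccos(2t/√N). Since s > 0, |2t| < √N strictly, which keeps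
    -- φ off both endpoints.
    set N := s ^ 4 + 4 * t ^ 2 with hN
    have hNpos : 0 < N := by positivity
    set m := √N with hm
    have hmpos : 0 < m := sqrt_pos.2 hNpos
    have hm2 : m ^ 2 = N := sq_sqrt hNpos.le
    have hlt : (2 * t / m) ^ 2 < 1 := by
      rw [div_pow, hm2, div_lt_one hNpos, hN]
      nlinarith [pow_pos hs 4]
    have hb := abs_lt.1 ((sq_lt_one_iff_abs_lt_one _).1 hlt)
    have hcos : cos (arccos (2 * t / m)) = 2 * t / m := cos_arccos hb.1.le hb.2.le
    have hsin : sin (arccos (2 * t / m)) = s ^ 2 / m := by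
      rw [sin_arccos, show 1 - (2 * t / m) ^ 2 = (s ^ 2 / m) ^ 2 by
        rw [div_pow, div_pow, hm2]; field_simp; rw [hN]; ring]
      exact sqrt_sq (by positivity)
    refine ⟨√m, arccos (2 * t / m), ⟨sqrt_pos.2 hmpos, arccos_pos.2 hb.2,
      lt_of_le_of_ne (arccos_le_pi _) fun h => ?_⟩, ?_⟩
    · rw [arccos_eq_pi] at h; linarith
    · simp only [planarPolar, hcos, hsin]
      rw [← sqrt_mul hmpos.le, sq_sqrt hmpos.le, mul_div_cancel₀ _ hmpos.ne', sqrt_sq hs.le]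
      congr 1
      field_simp

lemma lintegral_planarPolar (H : ℝ × ℝ → ℝ≥0∞) :
    ∫⁻ q in Ioi 0 ×ˢ univ, H q =
      ∫⁻ q in Ioi 0 ×ˢ Ioo 0 π,
        ENNReal.ofReal (q.1 ^ 2 / 2 * (√(sin q.2))⁻¹) * H (planarPolar q) := by
  have hs : MeasurableSet (Ioi (0 : ℝ) ×ˢ Ioo 0 π) := measurableSet_Ioi.prod measurableSet_Ioo
  rw [← image_planarPolar, lintegral_image_eq_lintegral_abs_det_fderiv_mul volume hs
    (fun q hq => (hasFDerivAt_planarPolar (sin_pos_of_mem_Ioo hq.2)).hasFDerivWithinAt)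
    injOn_planarPolar]
  refine setLIntegral_congr_fun hs fun q hq => ?_
  simp only [abs_det_fderivPlanarPolar (sin_pos_of_mem_Ioo hq.2)]

/-- Polar coordinates in a finite-dimensional space, for the Lebesgue integral. -/
lemma lintegral_toSphere_prod {E : Type*} [NormedAddCommGroup E] [NormedSpace ℝ E]
    [MeasurableSpace E] [BorelSpace E] [FiniteDimensional ℝ E] [Nontrivial E]
    (μ : Measure E) [μ.IsAddHaarMeasure] {F : E → ℝ≥0∞} (hF : Measurable F) :
    ∫⁻ x, F x ∂μ = ∫⁻ w, (∫⁻ s in Ioi (0 : ℝ),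
      ENNReal.ofReal (s ^ (Module.finrank ℝ E - 1)) * F (s • (w : E))) ∂μ.toSphere := by
  have h0 : μ {(0 : E)} = 0 := measure_singleton 0
  have hms : MeasurableSet ({0}ᶜ : Set E) := (measurableSet_singleton _).compl
  have hmeas : Measurable fun z : Metric.sphere (0 : E) 1 × Ioi (0 : ℝ) =>
      F ((z.2 : ℝ) • (z.1 : E)) := hF.comp (by fun_prop)
  calc ∫⁻ x, F x ∂μ = ∫⁻ x in {0}ᶜ, F x ∂μ := by
        rw [restrict_compl_singleton]
    _ = ∫⁻ x : ({0}ᶜ : Set E), F x ∂(μ.comap (↑)) := (lintegral_subtype_comap hms F).symm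
    _ = ∫⁻ x : ({0}ᶜ : Set E), F (((homeomorphUnitSphereProd E x).2 : ℝ) •
          ((homeomorphUnitSphereProd E x).1 : E)) ∂(μ.comap (↑)) := by
        refine lintegral_congr fun x => ?_
        have := (homeomorphUnitSphereProd E).symm_apply_apply x
        conv_lhs => rw [← this, homeomorphUnitSphereProd_symm_apply_coe]
    _ = ∫⁻ z, F ((z.2 : ℝ) • (z.1 : E)) ∂(μ.toSphere.prod
          (Measure.volumeIoiPow (Module.finrank ℝ E - 1))) :=
        μ.measurePreserving_homeomorphUnitSphereProd.lintegral_comp hmeas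
    _ = _ := by
        rw [lintegral_prod _ hmeas.aemeasurable]
        refine lintegral_congr fun w => ?_
        have hFw : Measurable fun s : Ioi (0 : ℝ) => F ((s : ℝ) • (w : E)) :=
          hF.comp (by fun_prop)
        rw [Measure.volumeIoiPow, lintegral_withDensity_eq_lintegral_mul _ (by fun_prop) hFw]
        exact lintegral_subtype_comap measurableSet_Ioi
          (fun s : ℝ => ENNReal.ofReal (s ^ (Module.finrank ℝ E - 1)) * F (s • (w : E)))

lemma continuous_polar_prod {n : ℕ} :
    Continuous fun q : ℝ × (ℝ × Sphere n) => polar q.1 q.2 := by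
  unfold polar; fun_prop

/-- The Lebesgue measure of `ℝ^{n+1}` in polar coordinates. -/
theorem measurePreserving_polar {n : ℕ} (hn : 1 ≤ n) :
    MeasurePreserving (fun q : ℝ × (ℝ × Sphere n) => polar q.1 q.2)
      ((radialMeasure n).prod (angularMeasure n)) volume := by
  have : Nonempty (Fin n) := ⟨⟨0, hn⟩⟩
  refine ⟨continuous_polar_prod.measurable, ?_⟩
  refine Measure.ext_of_lintegral _ fun F hF => ?_
  have hpm : Measurable fun q : ℝ × (ℝ × Sphere n) => polar q.1 q.2 :=
    continuous_polar_prod.measurable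
  rw [lintegral_map hF hpm]
  set τ := (volume : Measure (EuclideanSpace ℝ (Fin n))).toSphere
  -- Cylindrical coordinates x = s w first; then, for each fixed w, planar polar coordinates in the
  -- half plane of (s, t).
  have hrhs : ∫⁻ p, F p = ∫⁻ w, (∫⁻ q in Ioi (0 : ℝ) ×ˢ (univ : Set ℝ),
      ENNReal.ofReal (q.1 ^ (n - 1)) * F (q.1 • (w : EuclideanSpace ℝ (Fin n)), q.2)) ∂τ := by
    rw [Measure.volume_eq_prod, lintegral_prod_symm _ hF.aemeasurable]
    have h1 : ∀ t : ℝ, ∫⁻ x : EuclideanSpace ℝ (Fin n), F (x, t) = ∫⁻ w, (∫⁻ s in Ioi (0 : ℝ),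
        ENNReal.ofReal (s ^ (n - 1)) * F (s • (w : EuclideanSpace ℝ (Fin n)), t)) ∂τ := fun t => by
      rw [lintegral_toSphere_prod volume (F := fun x => F (x, t)) (hF.comp (by fun_prop)),
        finrank_euclideanSpace_fin]
    have hm : Measurable fun z : (ℝ × Sphere n) × ℝ => ENNReal.ofReal (z.2 ^ (n - 1)) *
        F (z.2 • (z.1.2 : EuclideanSpace ℝ (Fin n)), z.1.1) :=
      Measurable.mul (by fun_prop) (hF.comp (by fun_prop))
    simp only [h1]
    rw [lintegral_lintegral_swap]
    · refine lintegral_congr fun w => ?_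
      rw [Measure.volume_eq_prod, ← Measure.prod_restrict, Measure.restrict_univ,
        lintegral_prod_symm]
      exact (Measurable.mul (by fun_prop) (hF.comp (by fun_prop))).aemeasurable
    · exact hm.lintegral_prod_right'.aemeasurable
  rw [hrhs]
  have hassoc := (measurePreserving_prodAssoc (radialMeasure n)
    ((volume.restrict (Ioo 0 Real.pi)).withDensity
      (fun φ => ENNReal.ofReal (Real.sin φ ^ ((n : ℝ) / 2 - 1)))) τ)
  refine (hassoc.lintegral_comp (hF.comp hpm)).symm.trans ?_
  refine (lintegral_prod_symm _
    ((hF.comp hpm).comp MeasurableEquiv.prodAssoc.measurable).aemeasurable).trans ?_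
  refine lintegral_congr fun w => ?_
  rw [radialMeasure, prod_withDensity (by fun_prop) (by fun_prop), Measure.prod_restrict,
    ← Measure.volume_eq_prod, lintegral_withDensity_eq_lintegral_mul _ (by fun_prop),
    lintegral_planarPolar]
  swap
  · exact hF.comp (hpm.comp (by fun_prop))
  have hs : MeasurableSet (Ioi (0 : ℝ) ×ˢ Ioo 0 π) := measurableSet_Ioi.prod measurableSet_Ioo
  refine setLIntegral_congr_fun hs ?_
  rintro ⟨r, φ⟩ ⟨hr, hφ⟩
  simp only [mem_Ioi] at hr hφ
  have hsin := sin_pos_of_mem_Ioo hφ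
  simp only [Pi.mul_apply, planarPolar]
  rw [← mul_assoc, ← ENNReal.ofReal_mul (by positivity), ← ENNReal.ofReal_mul (by positivity)]
  refine congrArg₂ (· * ·) (congrArg ENNReal.ofReal ?_) rfl
  have hsq : 0 < √(sin φ) := sqrt_pos.2 hsin
  obtain ⟨m, rfl⟩ : ∃ m, n = m + 1 := ⟨n - 1, by omega⟩
  -- The cylindrical factor s^{n−1} = r^{n−1}(√sin φ)^{n−1} times the planar Jacobian (r²/2)/√sin φ
  -- gives (r^{n+1}/2)(sin φ)^{n/2−1}.
  have : sin φ ^ (((m + 1 : ℕ) : ℝ) / 2 - 1) = √(sin φ) ^ m * (√(sin φ))⁻¹ := by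
    rw [← rpow_natCast, ← rpow_neg_one (√(sin φ)), ← rpow_add hsq, sqrt_eq_rpow,
      ← rpow_mul hsin.le]
    congr 1; push_cast; ring
  rw [this, Nat.add_sub_cancel, mul_pow]
  ring

lemma ae_radialMeasure (n : ℕ) : ∀ᵐ r ∂radialMeasure n, 0 < r :=
  (withDensity_absolutelyContinuous _ _).ae_le (ae_restrict_mem measurableSet_Ioi)

lemma integral_radialMeasure (n : ℕ) (g : ℝ → ℝ) :
    ∫ r, g r ∂radialMeasure n = ∫ r in Ioi 0, r ^ (n + 1) / 2 * g r := by
  rw [radialMeasure, integral_withDensity_eq_integral_toReal_smul (by fun_prop) (by simp)]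
  refine setIntegral_congr_fun measurableSet_Ioi fun r hr => ?_
  have : (0 : ℝ) < r := hr
  simp only [smul_eq_mul]
  rw [ENNReal.toReal_ofReal (by positivity)]

lemma integrable_comp_polar {n : ℕ} (hn : 1 ≤ n) {F : Space n → ℝ} (hF : Integrable F) :
    Integrable (fun q : ℝ × (ℝ × Sphere n) => F (polar q.1 q.2))
      ((radialMeasure n).prod (angularMeasure n)) :=
  (measurePreserving_polar hn).integrable_comp_of_integrable hF

lemma integral_comp_polar {n : ℕ} (hn : 1 ≤ n) {F : Space n → ℝ} (hF : Integrable F) :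
    ∫ q : ℝ × (ℝ × Sphere n), F (polar q.1 q.2) ∂((radialMeasure n).prod (angularMeasure n)) =
      ∫ p, F p := by
  have h := measurePreserving_polar hn
  rw [← h.map_eq, integral_map h.measurable.aemeasurable]
  rw [h.map_eq]; exact hF.aestronglyMeasurable

/-- Integration over the gauge spheres, then over the radius. -/
lemma integral_eq_integral_radial {n : ℕ} (hn : 1 ≤ n) {F : Space n → ℝ} (hF : Integrable F) :
    ∫ p, F p = ∫ r, ∫ σ, F (polar r σ) ∂angularMeasure n ∂radialMeasure n := by
  rw [← integral_comp_polar hn hF, integral_prod _ (integrable_comp_polar hn hF)]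

/-- Integration along the dilation rays, then over the gauge sphere. -/
lemma integral_eq_integral_angular {n : ℕ} (hn : 1 ≤ n) {F : Space n → ℝ} (hF : Integrable F) :
    ∫ p, F p = ∫ σ, ∫ r, F (polar r σ) ∂radialMeasure n ∂angularMeasure n := by
  rw [← integral_comp_polar hn hF, integral_prod_symm _ (integrable_comp_polar hn hF)]

end PolarIntegration

/-! ### Polynomial functions on the Grushin space -/

section Calculus
open MvPolynomial
variable {n : ℕ}

instance : Measure.IsAddHaarMeasure (volume : Measure (Space n)) :=
  Measure.prod.instIsAddHaarMeasure _ _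

/-- The coordinates of a point, indexed by `Option (Fin n)`. -/
def coords (p : Space n) (o : Option (Fin n)) : ℝ := o.elim p.2 (fun i => p.1 i)

/-- The function on `ℝ^{n+1}` defined by a polynomial. -/
def polyFun (g : GPoly n) (p : Space n) : ℝ := eval (coords p) g

lemma polyFun_add (g h : GPoly n) (p : Space n) :
    polyFun (g + h) p = polyFun g p + polyFun h p := by simp [polyFun]

lemma polyFun_sub (g h : GPoly n) (p : Space n) :
    polyFun (g - h) p = polyFun g p - polyFun h p := by simp [polyFun]

lemma polyFun_neg (g : GPoly n) (p : Space n) : polyFun (-g) p = -polyFun g p := by simp [polyFun]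

lemma polyFun_mul (g h : GPoly n) (p : Space n) :
    polyFun (g * h) p = polyFun g p * polyFun h p := by simp [polyFun]

lemma polyFun_pow (g : GPoly n) (k : ℕ) (p : Space n) :
    polyFun (g ^ k) p = polyFun g p ^ k := by simp [polyFun]

lemma polyFun_sum {ι : Type*} (s : Finset ι) (g : ι → GPoly n) (p : Space n) :
    polyFun (∑ i ∈ s, g i) p = ∑ i ∈ s, polyFun (g i) p := by simp [polyFun]

lemma polyFun_C (c : ℝ) (p : Space n) : polyFun (C c) p = c := by simp [polyFun]

lemma polyFun_smul (c : ℝ) (g : GPoly n) (p : Space n) :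
    polyFun (c • g) p = c * polyFun g p := by simp [polyFun]

lemma polyFun_X_some (i : Fin n) (p : Space n) : polyFun (X (some i)) p = p.1 i := by
  simp [polyFun, coords]

lemma polyFun_timePoly (p : Space n) : polyFun (timePoly n) p = p.2 := by
  simp [polyFun, coords, timePoly]

lemma polyFun_normSqPoly (p : Space n) : polyFun (normSqPoly n) p = ‖p.1‖ ^ 2 := by
  rw [EuclideanSpace.norm_sq_eq]
  simp [polyFun, coords, normSqPoly]

lemma polyFun_gaugePoly (p : Space n) :
    polyFun (gaugePoly n) p = ‖p.1‖ ^ 4 + 4 * p.2 ^ 2 := by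
  rw [gaugePoly, polyFun_add, polyFun_pow, polyFun_mul, polyFun_pow, polyFun_normSqPoly,
    polyFun_timePoly, show (4 : GPoly n) = C 4 from (map_ofNat C 4).symm, polyFun_C]
  ring

lemma polyFun_rename (P : MvPolynomial (Fin n) ℝ) (p : Space n) :
    polyFun (rename some P) p = eval (fun i => p.1 i) P := by
  rw [polyFun, eval_rename]; rfl

lemma contDiff_polyFun (g : GPoly n) {m : WithTop ℕ∞} : ContDiff ℝ m (polyFun g) := by
  induction g using MvPolynomial.induction_on with
  | C a => simpa only [funext (polyFun_C a)] using contDiff_const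
  | add p q hp hq => simpa only [funext (polyFun_add p q)] using hp.add hq
  | mul_X p i hp =>
    rw [funext (polyFun_mul p (X i))]
    refine hp.mul ?_
    rcases i with _ | i
    · simp only [show (X none : GPoly n) = timePoly n from rfl, funext polyFun_timePoly]
      fun_prop
    · simp only [funext (polyFun_X_some i)]
      fun_prop

lemma continuous_polyFun (g : GPoly n) : Continuous (polyFun g) :=
  (contDiff_polyFun g (m := 0)).continuous

lemma differentiable_polyFun (g : GPoly n) : Differentiable ℝ (polyFun g) :=
  (contDiff_polyFun g (m := 1)).differentiable one_ne_zero

lemma fderiv_polyFun_eq_sum_option (g : GPoly n) (p v : Space n) :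
    fderiv ℝ (polyFun g) p v = ∑ o, coords v o * polyFun (pderiv o g) p := by
  classical
  induction g using MvPolynomial.induction_on with
  | C a => simp [funext (polyFun_C (n := n) a), polyFun]
  | add g h hg hh =>
    rw [funext (polyFun_add g h),
      fderiv_fun_add (differentiable_polyFun g p) (differentiable_polyFun h p)]
    simp only [_root_.add_apply, hg, hh, map_add, polyFun_add, mul_add, Finset.sum_add_distrib]
  | mul_X g o hg =>
    have hX : fderiv ℝ (polyFun (X o)) p v = coords v o := by
      rcases o with _ | i
      · simp only [show (X none : GPoly n) = timePoly n from rfl, funext polyFun_timePoly]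
        rw [(hasFDerivAt_snd (𝕜 := ℝ) (p := p)).fderiv]; rfl
      · have : (polyFun (X (some i)) : Space n → ℝ) =
            ((EuclideanSpace.proj i).comp (ContinuousLinearMap.fst ℝ _ ℝ) : Space n →L[ℝ] ℝ) := by
          ext p; simp [polyFun_X_some]
        rw [this, ContinuousLinearMap.fderiv]; rfl
    have hs : ∀ o', polyFun (Pi.single (M := fun _ => GPoly n) o 1 o') p =
        if o' = o then 1 else 0 := fun o' => by
      rcases eq_or_ne o' o with rfl | h
      · simp [polyFun]
      · simp [polyFun, h]
    rw [funext (polyFun_mul g (X o)),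
      fderiv_fun_mul (differentiable_polyFun g p) (differentiable_polyFun (X o) p)]
    simp only [_root_.add_apply, _root_.smul_apply, smul_eq_mul, hg, hX,
      pderiv_mul, polyFun_add, polyFun_mul, mul_add, Finset.sum_add_distrib, pderiv_X]
    have h1 : ∀ o', coords v o' * (polyFun g p * polyFun (Pi.single (M := fun _ => GPoly n) o' 1 o) p)
        = if o = o' then coords v o' * polyFun g p else 0 := fun o' => by
      rcases eq_or_ne o o' with rfl | h
      · simp [polyFun]
      · simp [polyFun, h]
    rw [Finset.sum_congr rfl fun o' _ => h1 o', Finset.sum_ite_eq, if_pos (Finset.mem_univ _),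
      Finset.mul_sum, add_comm, mul_comm (coords v o)]
    congr 1
    exact Finset.sum_congr rfl fun _ _ => by ring

lemma fderiv_polyFun (g : GPoly n) (p v : Space n) :
    fderiv ℝ (polyFun g) p v =
      ∑ i, v.1 i * polyFun (pderiv (some i) g) p + v.2 * polyFun (pderiv none g) p := by
  rw [fderiv_polyFun_eq_sum_option, Fintype.sum_option, add_comm]
  rfl

lemma fieldX_polyFun (g : GPoly n) (i : Fin n) (p : Space n) :
    fieldX i (polyFun g) p = polyFun (pderiv (some i) g) p := by
  simp [fieldX, fderiv_polyFun]

lemma fderiv_polyFun_time (g : GPoly n) (p : Space n) :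
    fderiv ℝ (polyFun g) p (0, 1) = polyFun (pderiv none g) p := by
  simp [fderiv_polyFun]

/-! ### The angular part of the Grushin gradient -/

/-- The generator `Z = x · ∇_x + 2 t ∂_t` of the anisotropic dilations. -/
def euler (u : Space n → ℝ) (p : Space n) : ℝ := fderiv ℝ u p (p.1, 2 * p.2)

/-- The inner product `⟨∇_G u, ∇_G v⟩`. -/
def gradInner (u v : Space n → ℝ) (p : Space n) : ℝ :=
  ∑ i, fieldX i u p * fieldX i v p +
    ‖p.1‖ ^ 2 * (fderiv ℝ u p (0, 1) * fderiv ℝ v p (0, 1))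

/-- The bilinear form `ϱ⁴ ⟨∇_G u, ∇_G v⟩ - |x|² Zu Zv`, which is `ϱ⁴` times the form of the
non-radial part of the Grushin gradient. -/
def angForm (u v : Space n → ℝ) (p : Space n) : ℝ :=
  (‖p.1‖ ^ 4 + 4 * p.2 ^ 2) * gradInner u v p - ‖p.1‖ ^ 2 * (euler u p * euler v p)

lemma gradSq_eq_gradInner (u : Space n → ℝ) (p : Space n) : gradSq u p = gradInner u u p := by
  simp only [gradSq, gradInner, fieldY, pow_two]
  ring

lemma euler_polyFun (g : GPoly n) (p : Space n) :
    euler (polyFun g) p = polyFun (eulerPoly n g) p := by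
  rw [euler, fderiv_polyFun, eulerPoly_apply]
  simp only [polyFun_add, polyFun_sum, polyFun_mul, polyFun_X_some, polyFun_timePoly]
  rw [show (2 : GPoly n) = C 2 from (map_ofNat C 2).symm, polyFun_C]

lemma fderiv_eq_sum_fieldX (u : Space n → ℝ) (p v : Space n) :
    fderiv ℝ u p v = ∑ i, v.1 i * fieldX i u p + v.2 * fderiv ℝ u p (0, 1) := by
  have hv : v = ∑ i, v.1 i • ((EuclideanSpace.single i (1 : ℝ), (0 : ℝ)) : Space n) +
      v.2 • ((0, 1) : Space n) := by
    refine Prod.ext ?_ ?_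
    · ext j
      simp [Prod.fst_sum, Pi.single_apply]
    · simp [Prod.snd_sum]
  conv_lhs => rw [hv]
  rw [map_add, map_sum, map_smul]
  simp only [map_smul, smul_eq_mul, fieldX]

lemma euler_eq (u : Space n → ℝ) (p : Space n) :
    euler u p = ∑ i, p.1 i * fieldX i u p + 2 * p.2 * fderiv ℝ u p (0, 1) :=
  fderiv_eq_sum_fieldX u p _

lemma angForm_comm (u v : Space n → ℝ) (p : Space n) : angForm u v p = angForm v u p := by
  simp only [angForm, gradInner, mul_comm]

/-- Cauchy–Schwarz: |x| Zu is the inner product of ∇_G u with the vector (|x|x, 2t), whose squared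
length is |x|⁴ + 4t² = ϱ⁴. -/
lemma angForm_self_nonneg (u : Space n → ℝ) (p : Space n) : 0 ≤ angForm u u p := by
  rw [angForm, gradInner, euler_eq]
  set b := fderiv ℝ u p (0, 1)
  set A := ∑ i, fieldX i u p * fieldX i u p with hA
  set B := ∑ i, p.1 i * fieldX i u p with hB
  have hS : ‖p.1‖ ^ 2 = ∑ i, p.1 i ^ 2 := by
    rw [EuclideanSpace.norm_sq_eq]; simp
  have hcs : B ^ 2 ≤ ‖p.1‖ ^ 2 * A := by
    rw [hS, hA]
    simpa only [pow_two] using Finset.sum_mul_sq_le_sq_mul_sq Finset.univ (fun i => p.1 i)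
      (fun i => fieldX i u p)
  have hA0 : 0 ≤ A := Finset.sum_nonneg fun i _ => mul_self_nonneg _
  set s := ‖p.1‖ ^ 2 with hs
  have hs0 : 0 ≤ s := by positivity
  rw [show ‖p.1‖ ^ 4 = s ^ 2 by rw [hs]; ring]
  have hexp : (s ^ 2 + 4 * p.2 ^ 2) * (A + s * (b * b)) -
      s * ((B + 2 * p.2 * b) * (B + 2 * p.2 * b)) =
      s * (s * A - B ^ 2) + (4 * p.2 ^ 2 * A - 4 * p.2 * b * s * B + s ^ 3 * b ^ 2) := by ring
  rw [hexp]
  -- Multiplied by s, the expression is 4t²(sA − B²) + (2tB − s²b)². The case s = 0 is separate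
  -- because one cannot divide by s there.
  have h1 : 0 ≤ 4 * p.2 ^ 2 * A - 4 * p.2 * b * s * B + s ^ 3 * b ^ 2 := by
    rcases hs0.eq_or_lt with h0 | hpos
    · rw [← h0]
      have := mul_nonneg (sq_nonneg p.2) hA0
      linarith
    · have : 0 ≤ s * (4 * p.2 ^ 2 * A - 4 * p.2 * b * s * B + s ^ 3 * b ^ 2) := by
        nlinarith [sq_nonneg (2 * p.2 * B - s ^ 2 * b), mul_nonneg (sq_nonneg p.2)
          (sub_nonneg.2 hcs)]
      exact nonneg_of_mul_nonneg_right this hpos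
  have h2 := mul_nonneg hs0 (sub_nonneg.2 hcs)
  linarith

lemma continuous_fderiv_apply_of_contDiff {u : Space n → ℝ} (hu : ContDiff ℝ 1 u)
    {v : Space n → Space n} (hv : Continuous v) : Continuous fun p => fderiv ℝ u p (v p) :=
  (hu.continuous_fderiv one_ne_zero).clm_apply hv

lemma continuous_euler {u : Space n → ℝ} (hu : ContDiff ℝ 1 u) : Continuous (euler u) :=
  continuous_fderiv_apply_of_contDiff hu (by fun_prop)

lemma continuous_gradInner {u v : Space n → ℝ} (hu : ContDiff ℝ 1 u) (hv : ContDiff ℝ 1 v) :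
    Continuous (gradInner u v) := by
  have h1 := fun i => continuous_fderiv_apply_of_contDiff hu
    (continuous_const (y := ((EuclideanSpace.single i 1, 0) : Space n)))
  have h2 := fun i => continuous_fderiv_apply_of_contDiff hv
    (continuous_const (y := ((EuclideanSpace.single i 1, 0) : Space n)))
  have h3 := continuous_fderiv_apply_of_contDiff hu (continuous_const (y := ((0, 1) : Space n)))
  have h4 := continuous_fderiv_apply_of_contDiff hv (continuous_const (y := ((0, 1) : Space n)))
  unfold gradInner fieldX
  fun_prop

lemma continuous_angForm {u v : Space n → ℝ} (hu : ContDiff ℝ 1 u) (hv : ContDiff ℝ 1 v) :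
    Continuous (angForm u v) := by
  have h1 := continuous_gradInner hu hv
  have h2 := continuous_euler hu
  have h3 := continuous_euler hv
  unfold angForm
  fun_prop

/-! ### The gauge -/

lemma gauge_eq_polyFun (p : Space n) : gauge p = polyFun (gaugePoly n) p ^ ((1 : ℝ) / 4) := by
  rw [polyFun_gaugePoly, gauge]

lemma polyFun_gaugePoly_pos {p : Space n} (hp : p ≠ 0) : 0 < polyFun (gaugePoly n) p := by
  rw [polyFun_gaugePoly]
  by_contra h
  have h1 : 0 ≤ ‖p.1‖ ^ 4 := by positivity
  have h2 : ‖p.1‖ ^ 4 = 0 := by nlinarith [sq_nonneg p.2]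
  have h3 : p.2 ^ 2 = 0 := by nlinarith [sq_nonneg p.2]
  exact hp (Prod.ext (by simpa using h2) (by simpa using h3))

lemma gauge_nonneg (p : Space n) : 0 ≤ gauge p := by unfold gauge; positivity

lemma gauge_pos {p : Space n} (hp : p ≠ 0) : 0 < gauge p := by
  rw [gauge_eq_polyFun]; exact Real.rpow_pos_of_pos (polyFun_gaugePoly_pos hp) _

lemma gauge_zero : gauge (0 : Space n) = 0 := by
  simp [gauge]

lemma gauge_pow_four (p : Space n) : gauge p ^ 4 = ‖p.1‖ ^ 4 + 4 * p.2 ^ 2 := by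
  rw [gauge, ← Real.rpow_natCast, ← Real.rpow_mul (by positivity)]
  norm_num

lemma continuous_gauge : Continuous (gauge (n := n)) := by
  unfold gauge
  exact Continuous.rpow_const (by fun_prop) fun _ => Or.inr (by norm_num)

lemma hasFDerivAt_gauge {p : Space n} (hp : p ≠ 0) :
    HasFDerivAt gauge ((1 / (4 * gauge p ^ 3)) • fderiv ℝ (polyFun (gaugePoly n)) p) p := by
  have h := (differentiable_polyFun (gaugePoly n) p).hasFDerivAt.rpow_const (p := (1 : ℝ) / 4)
    (Or.inl (polyFun_gaugePoly_pos hp).ne')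
  simp only [← gauge_eq_polyFun] at h
  refine h.congr_fderiv ?_
  have hg := gauge_pos hp
  have : polyFun (gaugePoly n) p ^ ((1 : ℝ) / 4 - 1) = (gauge p ^ 3)⁻¹ := by
    rw [gauge_eq_polyFun, ← Real.rpow_natCast, ← Real.rpow_mul (polyFun_gaugePoly_pos hp).le,
      ← Real.rpow_neg (polyFun_gaugePoly_pos hp).le]
    norm_num
  rw [this]
  congr 1
  field_simp

lemma contDiffAt_gauge {p : Space n} (hp : p ≠ 0) {m : WithTop ℕ∞} :
    ContDiffAt ℝ m gauge p := by
  rw [funext (gauge_eq_polyFun (n := n))]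
  exact (contDiff_polyFun _).contDiffAt.rpow_const_of_ne (polyFun_gaugePoly_pos hp).ne'

lemma gradSq_gauge {p : Space n} (hp : p ≠ 0) :
    gradSq gauge p = ‖p.1‖ ^ 2 / gauge p ^ 2 := by
  have hg := gauge_pos hp
  have h4 := gauge_pow_four p
  have hX : ∀ i, fieldX i gauge p = ‖p.1‖ ^ 2 / gauge p ^ 3 * p.1 i := fun i => by
    rw [fieldX, (hasFDerivAt_gauge hp).fderiv, _root_.smul_apply, ← fieldX, fieldX_polyFun,
      pderiv_gaugePoly, polyFun_mul, polyFun_mul, polyFun_X_some, polyFun_normSqPoly,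
      show (4 : GPoly n) = C 4 from (map_ofNat C 4).symm, polyFun_C, smul_eq_mul]
    field_simp
  have hY : fderiv ℝ gauge p (0, 1) = 2 * p.2 / gauge p ^ 3 := by
    rw [(hasFDerivAt_gauge hp).fderiv, _root_.smul_apply, fderiv_polyFun_time,
      pderiv_none_gaugePoly, polyFun_mul, polyFun_timePoly,
      show (8 : GPoly n) = C 8 from (map_ofNat C 8).symm, polyFun_C, smul_eq_mul]
    field_simp; ring
  have hS : ∑ i, p.1 i ^ 2 = ‖p.1‖ ^ 2 := by
    rw [EuclideanSpace.norm_sq_eq]; simp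
  rw [gradSq, fieldY, hY]
  simp only [hX, mul_pow]
  rw [← Finset.mul_sum, hS]
  have e : (‖p.1‖ ^ 2 / gauge p ^ 3) ^ 2 * ‖p.1‖ ^ 2 + ‖p.1‖ ^ 2 * (2 * p.2 / gauge p ^ 3) ^ 2 =
      ‖p.1‖ ^ 2 * (‖p.1‖ ^ 4 + 4 * p.2 ^ 2) / gauge p ^ 6 := by
    field_simp; ring
  rw [e, ← h4]
  field_simp

end Calculus

/-! ### Solid harmonics on gauge spheres -/

section Fiber
open MvPolynomial
variable {n : ℕ}

lemma integral_fderiv_apply_eq_zero {F : Space n → ℝ} (hF : ContDiff ℝ 1 F)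
    (hc : HasCompactSupport F) (v : Space n) : ∫ p, fderiv ℝ F p v = 0 := by
  have hcont : Continuous fun p => fderiv ℝ F p v :=
    continuous_fderiv_apply_of_contDiff hF continuous_const
  have h := integral_mul_fderiv_eq_neg_fderiv_mul_of_integrable (μ := volume) (f := fun _ => (1 : ℝ))
    (g := F) (v := v) (by simp)
    (by simpa using hcont.integrable_of_hasCompactSupport (hc.fderiv_apply (𝕜 := ℝ) v))
    (by simpa using hF.continuous.integrable_of_hasCompactSupport hc)
    (fun _ _ => differentiableAt_const _) (fun p _ => hF.differentiable one_ne_zero p)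
  simpa using h

lemma norm_le_of_gauge_le {p : Space n} {R : ℝ} (h : gauge p ≤ R) : ‖p‖ ≤ R + R ^ 2 := by
  have h0 := gauge_nonneg p
  have hR : 0 ≤ R := h0.trans h
  have h4 : ‖p.1‖ ^ 4 + 4 * p.2 ^ 2 ≤ R ^ 4 := by
    rw [← gauge_pow_four]; exact pow_le_pow_left₀ h0 h 4
  have h1 : ‖p.1‖ ≤ R := by
    refine (pow_le_pow_iff_left₀ (norm_nonneg _) hR (n := 4) (by norm_num)).1 ?_
    nlinarith [sq_nonneg p.2]
  have h2 : ‖p.2‖ ≤ R ^ 2 := by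
    refine abs_le_of_sq_le_sq ?_ (by positivity)
    nlinarith [sq_nonneg p.2, pow_nonneg (norm_nonneg p.1) 4]
  rw [Prod.norm_def]
  exact max_le (by nlinarith) (by linarith)

lemma hasCompactSupport_comp_gauge {ζ : ℝ → ℝ} (hc : HasCompactSupport ζ) :
    HasCompactSupport fun p : Space n => ζ (gauge p) := by
  obtain ⟨R, hR⟩ := hc.isCompact.isBounded.subset_closedBall 0
  refine HasCompactSupport.intro (isCompact_closedBall (0 : Space n) (R + R ^ 2)) fun p hp => ?_
  by_contra h
  have h1 := hR (subset_tsupport _ h)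
  rw [mem_closedBall_zero_iff, Real.norm_of_nonneg (gauge_nonneg p)] at h1
  exact hp (mem_closedBall_zero_iff.2 (norm_le_of_gauge_le h1))

/-- The gauge need not be differentiable at the origin. A cutoff supported in (0, ∞) makes the
composite vanish near it, which restores smoothness. -/
lemma comp_gauge_eventuallyEq_zero {ζ : ℝ → ℝ} (hs : tsupport ζ ⊆ Ioi 0) :
    (fun p : Space n => ζ (gauge p)) =ᶠ[nhds 0] fun _ => 0 := by
  have h0 : ζ =ᶠ[nhds (gauge (0 : Space n))] 0 := by
    rw [← notMem_tsupport_iff_eventuallyEq, gauge_zero]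
    exact fun h => lt_irrefl (0 : ℝ) (mem_Ioi.1 (hs h))
  exact continuous_gauge.continuousAt.eventually h0

lemma contDiff_comp_gauge {ζ : ℝ → ℝ} (hζ : ContDiff ℝ ∞ ζ) (hs : tsupport ζ ⊆ Ioi 0) :
    ContDiff ℝ ∞ fun p : Space n => ζ (gauge p) := by
  rw [contDiff_iff_contDiffAt]
  intro p
  rcases eq_or_ne p 0 with rfl | hp
  · exact contDiffAt_const.congr_of_eventuallyEq (comp_gauge_eventuallyEq_zero hs)
  · exact hζ.contDiffAt.comp p (contDiffAt_gauge hp)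

/-- Only proportionality to dN is needed: a field tangent to the gauge spheres then does not see the
cutoff. -/
lemma exists_fderiv_comp_gauge {ζ : ℝ → ℝ} (hζ : ContDiff ℝ ∞ ζ) (hs : tsupport ζ ⊆ Ioi 0)
    (p : Space n) : ∃ c : ℝ, ∀ v, fderiv ℝ (fun q : Space n => ζ (gauge q)) p v =
      c * fderiv ℝ (polyFun (gaugePoly n)) p v := by
  rcases eq_or_ne p 0 with rfl | hp
  · refine ⟨0, fun v => ?_⟩
    rw [(comp_gauge_eventuallyEq_zero hs).fderiv_eq]
    simp
  · refine ⟨deriv ζ (gauge p) * (1 / (4 * gauge p ^ 3)), fun v => ?_⟩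
    have h := ((hζ.differentiable (by simp)) (gauge p)).hasDerivAt.comp_hasFDerivAt p
      (hasFDerivAt_gauge hp)
    rw [show (fun q : Space n => ζ (gauge q)) = ζ ∘ gauge from rfl, h.fderiv]
    simp only [_root_.smul_apply, smul_eq_mul]
    ring

/-- A polynomial that is harmonic for the Grushin operator and homogeneous of degree `k` for the
anisotropic dilations. -/
structure IsSolid (k : ℕ) (G : GPoly n) : Prop where
  lap : lapPoly G = 0
  euler : eulerPoly n G = (k : ℝ) • G

lemma IsSolid.euler_polyFun {k : ℕ} {G : GPoly n} (hG : IsSolid k G) (p : Space n) :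
    Grushin.euler (polyFun G) p = k * polyFun G p := by
  rw [Grushin.euler_polyFun, hG.euler, polyFun_smul]

/-- The weak form of the eigenvalue equation, tested against radial functions. -/
lemma integral_cutoff_angForm {ζ : ℝ → ℝ} (hζ : ContDiff ℝ ∞ ζ) (hc : HasCompactSupport ζ)
    (hs : tsupport ζ ⊆ Ioi 0) {u : Space n → ℝ} (hu : ContDiff ℝ 1 u) {k : ℕ} {G : GPoly n}
    (hG : IsSolid k G) :
    ∫ p, ζ (gauge p) * (angForm u (polyFun G) p -
      k * (k + n) * (‖p.1‖ ^ 2 * (u p * polyFun G p))) = 0 := by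
  set χ : Space n → ℝ := fun p => ζ (gauge p) with hχ
  have hχc : ContDiff ℝ 1 χ := (contDiff_comp_gauge hζ hs).of_le (by exact_mod_cast le_top)
  have hχs : HasCompactSupport χ := hasCompactSupport_comp_gauge hc
  -- `A` and `B` are the components of the tangential field N∇G − k|x|²G·(x, 2t), with the
  -- t-component of the gradient weighted by |x|².
  set A : Fin n → GPoly n := fun i => gaugePoly n * pderiv (some i) G -
        C (k : ℝ) * (normSqPoly n * X (some i) * G) with hA
  set B : GPoly n := gaugePoly n * (normSqPoly n * pderiv none G) -
        C (k : ℝ) * (normSqPoly n * (2 * timePoly n) * G) with hB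
  have hdiv : ∑ i, pderiv (some i) (A i) + pderiv none B =
      -(C (k * (k + n) : ℝ) * (normSqPoly n * G)) := div_tangential hG.lap hG.euler
  -- Tangency to the gauge spheres: Euler's relation ZG = kG is exactly what cancels the component
  -- along dN.
  have htan : ∑ i, pderiv (some i) (gaugePoly n) * A i + pderiv none (gaugePoly n) * B = 0 := by
    have he := hG.euler
    rw [eulerPoly_apply, smul_eq_C_mul] at he
    have hi : ∀ i, pderiv (some i) (gaugePoly n) * A i =
        4 * normSqPoly n * gaugePoly n * (X (some i) * pderiv (some i) G) -
          4 * normSqPoly n * C (k : ℝ) * normSqPoly n * G * X (some i) ^ 2 := fun i => by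
      rw [pderiv_gaugePoly, hA]; ring
    rw [Finset.sum_congr rfl fun i _ => hi i, Finset.sum_sub_distrib, ← Finset.mul_sum,
      ← Finset.mul_sum, show ∑ i : Fin n, (X (some i) : GPoly n) ^ 2 = normSqPoly n from rfl,
      pderiv_none_gaugePoly, hB]
    have hN : gaugePoly n = normSqPoly n ^ 2 + 4 * timePoly n ^ 2 := rfl
    rw [hN]
    linear_combination (4 * normSqPoly n * (normSqPoly n ^ 2 + 4 * timePoly n ^ 2)) * he
  have hFc : ∀ g : GPoly n, ContDiff ℝ 1 fun p => χ p * (u p * polyFun g p) := fun g =>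
    hχc.mul (hu.mul (contDiff_polyFun g))
  have hFs : ∀ g : GPoly n, HasCompactSupport fun p => χ p * (u p * polyFun g p) := fun g =>
    hχs.mul_right
  have hFd : ∀ (g : GPoly n) (p v : Space n),
      fderiv ℝ (fun p => χ p * (u p * polyFun g p)) p v =
        χ p * (u p * fderiv ℝ (polyFun g) p v + polyFun g p * fderiv ℝ u p v) +
          u p * polyFun g p * fderiv ℝ χ p v := fun g p v => by
    have h1 := hχc.differentiable one_ne_zero p
    have h2 := hu.differentiable one_ne_zero p
    have h3 := differentiable_polyFun g p
    rw [fderiv_fun_mul h1 (h2.fun_mul h3), fderiv_fun_mul h2 h3]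
    simp only [_root_.add_apply, _root_.smul_apply, smul_eq_mul]
  have hint : ∀ (g : GPoly n) (v : Space n),
      Integrable fun p => fderiv ℝ (fun p => χ p * (u p * polyFun g p)) p v := fun g v =>
    (continuous_fderiv_apply_of_contDiff (hFc g) continuous_const).integrable_of_hasCompactSupport
      ((hFs g).fderiv_apply (𝕜 := ℝ) v)
  -- The divergence theorem for χu times the tangential field. Its divergence is χ(`angForm` −
  -- k(k+n)|x|²uG), because the derivative of χ drops out.
  have hzero : ∫ p, (∑ i, fderiv ℝ (fun p => χ p * (u p * polyFun (A i) p)) p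
        (EuclideanSpace.single i 1, 0) +
      fderiv ℝ (fun p => χ p * (u p * polyFun B p)) p (0, 1)) = 0 := by
    rw [integral_add (integrable_finsetSum _ fun i _ => hint _ _) (hint _ _),
      integral_finsetSum _ fun i _ => hint _ _, integral_fderiv_apply_eq_zero (hFc B) (hFs B),
      add_zero]
    exact Finset.sum_eq_zero fun i _ => integral_fderiv_apply_eq_zero (hFc _) (hFs _) _
  rw [← hzero]
  refine integral_congr_ae (Filter.Eventually.of_forall fun p => ?_)
  obtain ⟨c, hcχ⟩ : ∃ c : ℝ, ∀ v, fderiv ℝ χ p v = c * fderiv ℝ (polyFun (gaugePoly n)) p v :=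
    exists_fderiv_comp_gauge hζ hs p
  have hX : ∀ (g : GPoly n) (i : Fin n), fderiv ℝ (polyFun g) p (EuclideanSpace.single i 1, 0) =
      polyFun (pderiv (some i) g) p := fun g i => fieldX_polyFun g i p
  have hdivp := congrArg (fun g => polyFun g p) hdiv
  have htanp := congrArg (fun g => polyFun g p) htan
  simp only [polyFun_add, polyFun_sum, polyFun_mul, polyFun_neg, polyFun_C,
    polyFun_normSqPoly] at hdivp htanp
  rw [show polyFun (0 : GPoly n) p = 0 by simp [polyFun]] at htanp
  simp only [hFd, hcχ, hX, fderiv_polyFun_time]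
  have h2 : polyFun (2 : GPoly n) p = 2 := by
    rw [show (2 : GPoly n) = C 2 from (map_ofNat C 2).symm, polyFun_C]
  have hAp : ∀ i, polyFun (A i) p = (‖p.1‖ ^ 4 + 4 * p.2 ^ 2) * fieldX i (polyFun G) p -
      k * (‖p.1‖ ^ 2 * p.1 i * polyFun G p) := fun i => by
    simp only [hA, polyFun_sub, polyFun_mul, polyFun_C, polyFun_normSqPoly, polyFun_X_some,
      polyFun_gaugePoly, fieldX_polyFun]
  have hBp : polyFun B p = (‖p.1‖ ^ 4 + 4 * p.2 ^ 2) *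
      (‖p.1‖ ^ 2 * fderiv ℝ (polyFun G) p (0, 1)) -
      k * (‖p.1‖ ^ 2 * (2 * p.2) * polyFun G p) := by
    simp only [hB, polyFun_sub, polyFun_mul, polyFun_C, polyFun_normSqPoly, polyFun_timePoly,
      polyFun_gaugePoly, fderiv_polyFun_time, h2]
  have hform : ∑ i, polyFun (A i) p * fieldX i u p + polyFun B p * fderiv ℝ u p (0, 1) =
      angForm u (polyFun G) p := by
    have hi : ∀ i, polyFun (A i) p * fieldX i u p =
        (‖p.1‖ ^ 4 + 4 * p.2 ^ 2) * (fieldX i u p * fieldX i (polyFun G) p) -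
        k * ‖p.1‖ ^ 2 * polyFun G p * (p.1 i * fieldX i u p) := fun i => by rw [hAp]; ring
    rw [Finset.sum_congr rfl fun i _ => hi i, Finset.sum_sub_distrib, ← Finset.mul_sum,
      ← Finset.mul_sum, hBp, angForm, gradInner, hG.euler_polyFun, euler_eq u]
    ring
  have hsum : ∑ i, (χ p * (u p * polyFun (pderiv (some i) (A i)) p +
        polyFun (A i) p * fderiv ℝ u p (EuclideanSpace.single i 1, 0)) +
        u p * polyFun (A i) p * (c * polyFun (pderiv (some i) (gaugePoly n)) p)) =
      χ p * u p * (∑ i, polyFun (pderiv (some i) (A i)) p) +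
        χ p * (∑ i, polyFun (A i) p * fieldX i u p) +
        c * u p * (∑ i, polyFun (pderiv (some i) (gaugePoly n)) p * polyFun (A i) p) := by
    simp only [Finset.mul_sum, ← Finset.sum_add_distrib, fieldX]
    exact Finset.sum_congr rfl fun i _ => by ring
  rw [hsum]
  linear_combination (-χ p) * hform - χ p * u p * hdivp - c * u p * htanp

/-! ### Points in polar coordinates -/

lemma norm_polar_fst_sq (r : ℝ) {σ : ℝ × Sphere n} (hσ : 0 ≤ Real.sin σ.1) :
    ‖(polar r σ).1‖ ^ 2 = r ^ 2 * Real.sin σ.1 := by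
  have : ‖(σ.2 : EuclideanSpace ℝ (Fin n))‖ = 1 := by simp
  rw [polar, norm_smul, this, mul_one, Real.norm_eq_abs, sq_abs, mul_pow, Real.sq_sqrt hσ]

lemma gaugePow_polar (r : ℝ) {σ : ℝ × Sphere n} (hσ : 0 ≤ Real.sin σ.1) :
    ‖(polar r σ).1‖ ^ 4 + 4 * (polar r σ).2 ^ 2 = r ^ 4 := by
  rw [show ‖(polar r σ).1‖ ^ 4 = (‖(polar r σ).1‖ ^ 2) ^ 2 by ring, norm_polar_fst_sq r hσ, polar]
  linear_combination r ^ 4 * Real.sin_sq_add_cos_sq σ.1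

lemma gauge_polar {r : ℝ} (hr : 0 ≤ r) {σ : ℝ × Sphere n} (hσ : 0 ≤ Real.sin σ.1) :
    gauge (polar r σ) = r := by
  rw [gauge, gaugePow_polar r hσ, ← Real.rpow_natCast, ← Real.rpow_mul hr]
  norm_num

lemma continuous_integral_polar (hn : 2 ≤ n) {F : Space n → ℝ} (hF : Continuous F) :
    Continuous fun r => ∫ σ, F (polar r σ) ∂angularMeasure n := by
  have := isFiniteMeasure_angularMeasure hn
  have hs : IsCompact (Icc 0 Real.pi ×ˢ (univ : Set (Sphere n))) := isCompact_Icc.prod isCompact_univ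
  have h := continuous_parametric_integral_of_continuous (μ := angularMeasure n)
    (f := fun (r : ℝ) (σ : ℝ × Sphere n) => F (polar r σ)) (hF.comp continuous_polar_prod) hs
  have he : (angularMeasure n).restrict (Icc 0 Real.pi ×ˢ (univ : Set (Sphere n))) =
      angularMeasure n := by
    refine Measure.restrict_eq_self_of_ae_mem ?_
    filter_upwards [ae_angularMeasure n] with σ hσ
    exact ⟨Ioo_subset_Icc_self hσ, mem_univ _⟩
  rw [he] at h
  exact h

lemma integrable_comp_polar_const (hn : 2 ≤ n) {F : Space n → ℝ} (hF : Continuous F) (r : ℝ) :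
    Integrable (fun σ => F (polar r σ)) (angularMeasure n) := by
  have := isFiniteMeasure_angularMeasure hn
  have hc : Continuous fun σ : ℝ × Sphere n => F (polar r σ) := hF.comp (continuous_polar r)
  obtain ⟨C, hC⟩ := (isCompact_Icc (a := (0 : ℝ)) (b := Real.pi)).prod
    (isCompact_univ (X := Sphere n)) |>.exists_bound_of_continuousOn hc.continuousOn
  refine Integrable.of_bound hc.aestronglyMeasurable C ?_
  filter_upwards [ae_angularMeasure n] with σ hσ
  exact hC σ ⟨Ioo_subset_Icc_self hσ, mem_univ _⟩

/-- Passing to polar coordinates, the fundamental lemma of the calculus of variations in r gives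
vanishing for almost every r; continuity in r gives it for every r > 0. -/
lemma integral_polar_eq_zero_of_cutoff (hn : 2 ≤ n) {F : Space n → ℝ} (hF : Continuous F)
    (h : ∀ ζ : ℝ → ℝ, ContDiff ℝ ∞ ζ → HasCompactSupport ζ → tsupport ζ ⊆ Ioi 0 →
      ∫ p, ζ (gauge p) * F p = 0) {r : ℝ} (hr : 0 < r) :
    ∫ σ, F (polar r σ) ∂angularMeasure n = 0 := by
  set J : ℝ → ℝ := fun r => r ^ (n + 1) / 2 * ∫ σ, F (polar r σ) ∂angularMeasure n with hJ
  have hJc : Continuous J := by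
    have := continuous_integral_polar hn hF
    fun_prop
  have hae : ∀ᵐ r, r ∈ Ioi (0 : ℝ) → J r = 0 := by
    refine isOpen_Ioi.ae_eq_zero_of_integral_contDiff_smul_eq_zero
      (hJc.locallyIntegrable.locallyIntegrableOn _) fun ζ hζ hc hs => ?_
    have hi : Integrable fun p : Space n => ζ (gauge p) * F p :=
      ((hζ.continuous.comp continuous_gauge).mul hF).integrable_of_hasCompactSupport
        ((hasCompactSupport_comp_gauge hc).mul_right)
    have h0 := h ζ hζ hc hs
    rw [integral_eq_integral_radial (by omega) hi, integral_radialMeasure] at h0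
    rw [← h0, ← setIntegral_eq_integral_of_forall_compl_eq_zero (s := Ioi 0)]
    · refine setIntegral_congr_fun measurableSet_Ioi fun r hr => ?_
      have hr' : (0 : ℝ) ≤ r := le_of_lt hr
      have e : ∫ σ, ζ (gauge (polar r σ)) * F (polar r σ) ∂angularMeasure n =
          ζ r * ∫ σ, F (polar r σ) ∂angularMeasure n := by
        rw [← integral_const_mul]
        refine integral_congr_ae ?_
        filter_upwards [ae_angularMeasure n] with σ hσ
        rw [gauge_polar hr' (Real.sin_pos_of_mem_Ioo hσ).le]
      simp only [e, smul_eq_mul, hJ]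
      ring
    · intro r hr
      have : ζ r = 0 := by
        by_contra hne
        exact hr (hs (subset_tsupport _ hne))
      rw [this, zero_smul]
  have heq := Measure.eqOn_open_of_ae_eq (μ := volume) (f := J) (g := fun _ => 0) (U := Ioi 0)
    ((ae_restrict_iff' measurableSet_Ioi).2 hae) isOpen_Ioi hJc.continuousOn continuousOn_const
  have hr0 := heq (show r ∈ Ioi 0 from hr)
  have hne : r ^ (n + 1) / 2 ≠ 0 := by positivity
  exact (mul_eq_zero.1 hr0).resolve_left hne

/-- Solid harmonics are eigenfunctions of the angular form on every gauge sphere. -/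
lemma integral_angForm_solid (hn : 2 ≤ n) {u : Space n → ℝ} (hu : ContDiff ℝ 1 u) {k : ℕ}
    {G : GPoly n} (hG : IsSolid k G) {r : ℝ} (hr : 0 < r) :
    ∫ σ, angForm u (polyFun G) (polar r σ) ∂angularMeasure n =
      k * (k + n) * ∫ σ, ‖(polar r σ).1‖ ^ 2 * (u (polar r σ) * polyFun G (polar r σ))
        ∂angularMeasure n := by
  have hc1 : Continuous (angForm u (polyFun G)) := continuous_angForm hu (contDiff_polyFun G)
  have hc2 : Continuous fun p : Space n => ‖p.1‖ ^ 2 * (u p * polyFun G p) := by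
    have := hu.continuous
    have := continuous_polyFun G
    fun_prop
  have h := integral_polar_eq_zero_of_cutoff hn (F := fun p => angForm u (polyFun G) p -
      k * (k + n) * (‖p.1‖ ^ 2 * (u p * polyFun G p))) (hc1.sub (hc2.const_mul _))
    (fun ζ hζ hc hs => integral_cutoff_angForm hζ hc hs hu hG) hr
  rw [integral_sub (integrable_comp_polar_const hn hc1 r)
    ((integrable_comp_polar_const hn hc2 r).const_mul _), integral_const_mul] at h
  linarith

end Fiber

/-! ### The decomposition of homogeneous polynomials into harmonic ones -/

section Fischer
open MvPolynomial
variable {n : ℕ}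

/-- The polynomial `|x|²` in the variables `x` only. -/
def radPoly (n : ℕ) : MvPolynomial (Fin n) ℝ := ∑ i, X i ^ 2

/-- The Laplacian on polynomials in `x`, as a linear map. -/
def laplacianPoly (n : ℕ) : MvPolynomial (Fin n) ℝ →ₗ[ℝ] MvPolynomial (Fin n) ℝ :=
  ∑ i, (pderiv i).toLinearMap ∘ₗ (pderiv i).toLinearMap

lemma laplacianPoly_apply (p : MvPolynomial (Fin n) ℝ) :
    laplacianPoly n p = ∑ i, pderiv i (pderiv i p) := by
  simp [laplacianPoly]

/-- The Fischer inner product `∑ α! p_α q_α`, linear in `p`. -/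
def fischer (q : MvPolynomial (Fin n) ℝ) : MvPolynomial (Fin n) ℝ →ₗ[ℝ] ℝ :=
  (basisMonomials (Fin n) ℝ).constr ℝ fun α => (∏ i, ((α i).factorial : ℝ)) * coeff α q

lemma fischer_monomial (q : MvPolynomial (Fin n) ℝ) (α : Fin n →₀ ℕ) (c : ℝ) :
    fischer q (monomial α c) = c * ((∏ i, ((α i).factorial : ℝ)) * coeff α q) := by
  have h : fischer q (monomial α 1) = (∏ i, ((α i).factorial : ℝ)) * coeff α q := by
    have := (basisMonomials (Fin n) ℝ).constr_basis ℝ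
      (fun α => (∏ i, ((α i).factorial : ℝ)) * coeff α q) α
    rwa [coe_basisMonomials] at this
  rw [← mul_one c, ← smul_eq_mul, ← smul_monomial, map_smul, h, smul_eq_mul, smul_eq_mul, mul_one]

/-- Multiplication by a variable is adjoint to differentiation in it: raising α_i by one multiplies
α! by α_i + 1, the factor that the derivative produces. -/
lemma fischer_X_mul (q p : MvPolynomial (Fin n) ℝ) (i : Fin n) :
    fischer q (X i * p) = fischer (pderiv i q) p := by
  classical
  induction p using MvPolynomial.induction_on' with
  | add p p' hp hp' => rw [mul_add, map_add, map_add, hp, hp']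
  | monomial α c =>
    rw [X, monomial_mul, one_mul, fischer_monomial, fischer_monomial, coeff_pderiv, add_comm]
    have h : (∏ j, (((α + Finsupp.single i 1 : Fin n →₀ ℕ) j).factorial : ℝ)) =
        (∏ j, ((α j).factorial : ℝ)) * (α i + 1) := by
      have hj : ∀ j, (((α + Finsupp.single i 1 : Fin n →₀ ℕ) j).factorial : ℝ) =
          ((α j).factorial : ℝ) * if j = i then ((α i : ℝ) + 1) else 1 := fun j => by
        rcases eq_or_ne j i with rfl | hne
        · simp [Nat.factorial_succ]; ring
        · simp [hne]
      rw [Finset.prod_congr rfl fun j _ => hj j, Finset.prod_mul_distrib, Finset.prod_ite_eq']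
      simp
    rw [h]; ring

lemma fischer_radPoly_mul (q p : MvPolynomial (Fin n) ℝ) :
    fischer q (radPoly n * p) = fischer (laplacianPoly n q) p := by
  have hadd : ∀ (s : Finset (Fin n)) (f : Fin n → MvPolynomial (Fin n) ℝ),
      fischer (∑ i ∈ s, f i) p = ∑ i ∈ s, fischer (f i) p := fun s f => by
    induction p using MvPolynomial.induction_on' with
    | add p p' hp hp' => simp only [map_add, hp, hp', Finset.sum_add_distrib]
    | monomial α c => simp only [fischer_monomial, coeff_sum, Finset.mul_sum]
  rw [radPoly, Finset.sum_mul, map_sum, laplacianPoly_apply, hadd]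
  refine Finset.sum_congr rfl fun i _ => ?_
  rw [pow_two, mul_assoc, fischer_X_mul, fischer_X_mul]

lemma fischer_self_eq_zero {p : MvPolynomial (Fin n) ℝ} (h : fischer p p = 0) : p = 0 := by
  have hexp : fischer p p = ∑ α ∈ p.support,
      (∏ i, ((α i).factorial : ℝ)) * coeff α p ^ 2 := by
    conv_lhs => rw [p.as_sum, map_sum, ← p.as_sum]
    exact Finset.sum_congr rfl fun α _ => by rw [fischer_monomial]; ring
  rw [hexp, Finset.sum_eq_zero_iff_of_nonneg fun α _ => by positivity] at h
  ext α
  by_contra hα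
  have h1 := h α (mem_support_iff.2 hα)
  have h2 : (∏ i, ((α i).factorial : ℝ)) ≠ 0 :=
    Finset.prod_ne_zero_iff.2 fun i _ => by positivity
  exact hα (by simpa using (mul_eq_zero.1 h1).resolve_left h2)

lemma isHomogeneous_radPoly (n : ℕ) : (radPoly n).IsHomogeneous 2 :=
  IsHomogeneous.sum _ _ _ fun i _ => by simpa using (isHomogeneous_X ℝ i).pow 2

lemma radPoly_ne_zero (hn : 1 ≤ n) : radPoly n ≠ 0 := fun h => by
  have h1 := congrArg (eval fun _ => (1 : ℝ)) h
  simp [radPoly] at h1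
  omega

lemma isHomogeneous_laplacianPoly {p : MvPolynomial (Fin n) ℝ} {d : ℕ}
    (hp : p.IsHomogeneous (d + 2)) : (laplacianPoly n p).IsHomogeneous d := by
  rw [laplacianPoly_apply]
  exact IsHomogeneous.sum _ _ _ fun i _ => hp.pderiv.pderiv

/-- The map q ↦ Δ(|x|²q) preserves the finite-dimensional space of degree d, so injectivity
suffices. If Δ(|x|²q) = 0, adjointness gives ⟨|x|²q, |x|²q⟩ = ⟨Δ(|x|²q), q⟩ = 0, and the Fischer
product is definite. -/
lemma exists_laplacianPoly_radPoly_mul (hn : 1 ≤ n) {d : ℕ} {p : MvPolynomial (Fin n) ℝ}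
    (hp : p.IsHomogeneous d) :
    ∃ q : MvPolynomial (Fin n) ℝ, q.IsHomogeneous d ∧ laplacianPoly n (radPoly n * q) = p := by
  have : Module.Finite ℝ (homogeneousSubmodule (Fin n) ℝ d) :=
    Module.Finite.of_fg (homogeneousSubmodule_fg (Fin n) ℝ d)
  let T : MvPolynomial (Fin n) ℝ →ₗ[ℝ] MvPolynomial (Fin n) ℝ :=
    laplacianPoly n ∘ₗ LinearMap.mulLeft ℝ (radPoly n)
  have hT : ∀ q ∈ homogeneousSubmodule (Fin n) ℝ d, T q ∈ homogeneousSubmodule (Fin n) ℝ d :=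
    fun q hq => isHomogeneous_laplacianPoly (by
      rw [add_comm]; exact (isHomogeneous_radPoly n).mul hq)
  have hinj : Function.Injective (T.restrict hT) := by
    rw [injective_iff_map_eq_zero]
    intro q hq
    have h0 : laplacianPoly n (radPoly n * q) = 0 := congrArg Subtype.val hq
    have h1 : fischer (radPoly n * (q : MvPolynomial (Fin n) ℝ)) (radPoly n * q) = 0 := by
      rw [fischer_radPoly_mul, h0]
      have : fischer (0 : MvPolynomial (Fin n) ℝ) = 0 := by
        refine (basisMonomials (Fin n) ℝ).ext fun α => ?_
        rw [coe_basisMonomials]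
        simp only [fischer_monomial, coeff_zero, mul_zero, LinearMap.zero_apply]
      rw [this]; rfl
    exact Subtype.ext ((mul_eq_zero.1 (fischer_self_eq_zero h1)).resolve_left (radPoly_ne_zero hn))
  obtain ⟨q, hq⟩ := (LinearMap.injective_iff_surjective.1 hinj) ⟨p, hp⟩
  exact ⟨q, q.2, congrArg Subtype.val hq⟩

/-- Every homogeneous polynomial is the sum of a harmonic one and a multiple of `|x|²`. -/
lemma exists_eq_harmonic_add (hn : 1 ≤ n) {d : ℕ} {p : MvPolynomial (Fin n) ℝ}
    (hp : p.IsHomogeneous (d + 2)) : ∃ H q : MvPolynomial (Fin n) ℝ,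
      IsSolidHarmonic (d + 2) H ∧ q.IsHomogeneous d ∧ p = H + radPoly n * q := by
  obtain ⟨q, hq, h⟩ := exists_laplacianPoly_radPoly_mul hn (isHomogeneous_laplacianPoly hp)
  refine ⟨p - radPoly n * q, q, ⟨hp.sub ?_, ?_⟩, hq, by ring⟩
  · rw [add_comm]; exact (isHomogeneous_radPoly n).mul hq
  · rw [← laplacianPoly_apply, map_sub, h, sub_self]

lemma isSolidHarmonic_of_le_one {d : ℕ} (hd : d ≤ 1) {p : MvPolynomial (Fin n) ℝ}
    (hp : p.IsHomogeneous d) : IsSolidHarmonic d p := by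
  refine ⟨hp, Finset.sum_eq_zero fun i _ => ?_⟩
  have h : (pderiv i p).IsHomogeneous 0 := by
    have := hp.pderiv (i := i)
    rwa [show d - 1 = 0 by omega] at this
  rw [← totalDegree_zero_iff_isHomogeneous, totalDegree_eq_zero_iff_eq_C] at h
  rw [h, pderiv_C]

lemma eval_smul_of_isHomogeneous {d : ℕ} {p : MvPolynomial (Fin n) ℝ} (hp : p.IsHomogeneous d)
    (c : ℝ) (x : Fin n → ℝ) : eval (fun i => c * x i) p = c ^ d * eval x p := by
  rw [eval_eq', eval_eq', Finset.mul_sum]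
  refine Finset.sum_congr rfl fun α hα => ?_
  have h : ∑ i, α i = d := by
    rw [← hp (mem_support_iff.1 hα), Finsupp.weight_apply, Finsupp.sum_fintype] <;> simp
  simp only [mul_pow, Finset.prod_mul_distrib, Finset.prod_pow_eq_pow_sum, h]
  ring

end Fischer

/-! ### Completeness of the harmonics on gauge spheres -/

section Completeness
open MvPolynomial
variable {n : ℕ}

instance (n : ℕ) : IsFiniteMeasure (sphereMeasure n) := by
  have h := memLp_of_continuous (n := n) (F := fun _ => 1) continuous_const
  rw [memLp_const_iff (by norm_num) (by norm_num)] at h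
  exact ⟨h.resolve_left one_ne_zero⟩

/-- The span of the solid harmonics of degree `k`. -/
def solidSpace (n k : ℕ) : Submodule ℝ (GPoly n) :=
  Submodule.span ℝ {G | ∃ (l m : ℕ) (P : MvPolynomial (Fin n) ℝ), l + 2 * m = k ∧
    IsSolidHarmonic l P ∧ G = solidPoly l m P}

lemma isSolid_of_mem_solidSpace {k : ℕ} {G : GPoly n} (hG : G ∈ solidSpace n k) : IsSolid k G := by
  induction hG using Submodule.span_induction with
  | mem G h =>
    obtain ⟨l, m, P, rfl, hP, rfl⟩ := h
    exact ⟨lapPoly_solidPoly hP m, eulerPoly_solidPoly hP.1 m⟩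
  | zero => exact ⟨by simp [lapPoly], by simp⟩
  | add G H _ _ hG hH =>
    exact ⟨by rw [lapPoly_add, hG.lap, hH.lap, add_zero], by rw [map_add, hG.euler, hH.euler, smul_add]⟩
  | smul c G _ hG =>
    exact ⟨by rw [lapPoly_smul, hG.lap, smul_zero],
      by rw [Derivation.map_smul, hG.euler, smul_comm]⟩

/-- The algebra homomorphism from polynomials to continuous functions. -/
def polyMap (n : ℕ) : GPoly n →ₐ[ℝ] C(Space n, ℝ) where
  toFun g := ⟨polyFun g, continuous_polyFun g⟩
  map_one' := by ext p; simp [polyFun]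
  map_mul' g h := by ext p; simp [polyFun]
  map_zero' := by ext p; simp [polyFun]
  map_add' g h := by ext p; simp [polyFun]
  commutes' c := by ext p; simp [polyFun, algebraMap_eq]

lemma polyMap_apply (g : GPoly n) (p : Space n) : polyMap n g p = polyFun g p := rfl

/-- The class in `L²(Ω, dΩ)` of the restriction of a continuous function to the gauge sphere of
radius `r`. -/
def fiberLp (n : ℕ) (r : ℝ) : C(Space n, ℝ) →ₗ[ℝ] Lp ℝ 2 (sphereMeasure n) where
  toFun f := (memLp_of_continuous (f.continuous.comp (continuous_polar r))).toLp _
  map_add' f g := by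
    rw [← MemLp.toLp_add]; rfl
  map_smul' c f := by
    rw [RingHom.id_apply, ← MemLp.toLp_const_smul]; rfl

lemma coeFn_fiberLp (r : ℝ) (f : C(Space n, ℝ)) :
    fiberLp n r f =ᵐ[sphereMeasure n] fun σ => f (polar r σ) :=
  MemLp.coeFn_toLp (memLp_of_continuous (f.continuous.comp (continuous_polar r)))

lemma inner_fiberLp (r : ℝ) (f g : C(Space n, ℝ)) :
    inner ℝ (fiberLp n r f) (fiberLp n r g) =
      ∫ σ, f (polar r σ) * g (polar r σ) ∂sphereMeasure n := by
  rw [L2.inner_def]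
  refine integral_congr_ae ?_
  filter_upwards [coeFn_fiberLp r f, coeFn_fiberLp r g] with σ h1 h2
  simp only [h1, h2, RCLike.inner_apply, conj_trivial]; ring

lemma norm_fiberLp_le {r : ℝ} {f : C(Space n, ℝ)} {ε : ℝ} (hε : 0 ≤ ε)
    (h : ∀ σ : ℝ × Sphere n, σ.1 ∈ Ioo 0 Real.pi → |f (polar r σ)| ≤ ε) :
    ‖fiberLp n r f‖ ≤ (measureUnivNNReal (sphereMeasure n) : ℝ) ^ ((2 : ℝ)⁻¹) * ε := by
  have := Lp.norm_le_of_ae_bound (p := 2) (f := fiberLp n r f) hε (by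
    filter_upwards [coeFn_fiberLp r f, ae_sphereMeasure n] with σ h1 h2
    rw [h1]; exact h σ h2)
  simpa using this

/-- On the sphere of radius r one has N = r⁴ and 4t = r²·2cos φ; this is the origin of the factor
4^{m−2i} in `solidPoly`. -/
lemma polyFun_solidPoly_polar {l m : ℕ} {P : MvPolynomial (Fin n) ℝ} (hP : P.IsHomogeneous l)
    (r : ℝ) {σ : ℝ × Sphere n} (hσ : 0 ≤ Real.sin σ.1) :
    polyFun (solidPoly l m P) (polar r σ) =
      r ^ (l + 2 * m) * harmonicFun l (l + 2 * m) P σ := by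
  have hsq : √(Real.sin σ.1) ^ l = Real.sin σ.1 ^ ((l : ℝ) / 2) := by
    rw [Real.sqrt_eq_rpow, ← Real.rpow_natCast, ← Real.rpow_mul hσ]
    congr 1; ring
  have hP' : eval (fun i => (polar r σ).1 i) P = r ^ l * Real.sin σ.1 ^ ((l : ℝ) / 2) *
      eval (fun i => (σ.2 : EuclideanSpace ℝ (Fin n)) i) P := by
    rw [← hsq, ← mul_pow, ← eval_smul_of_isHomogeneous hP]
    simp [polar]
  have hm : (l + 2 * m - l) / 2 = m := by omega
  have hterm : ∀ i e : ℕ, 2 * i + e = m → ∀ c S E : ℝ,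
      c * 4 ^ e * (r ^ l * S * E * ((r ^ 2 / 2 * Real.cos σ.1) ^ e * (r ^ 4) ^ i)) =
        r ^ (l + 2 * m) * (S * (c * (2 * Real.cos σ.1) ^ e) * E) := by
    rintro i e rfl c S E
    have h4 : (4 : ℝ) ^ e * (r ^ 2 / 2 * Real.cos σ.1) ^ e =
        (r ^ 2) ^ e * (2 * Real.cos σ.1) ^ e := by
      rw [← mul_pow, ← mul_pow]; congr 1; ring
    have hr' : r ^ (l + 2 * (2 * i + e)) = r ^ l * (r ^ 2) ^ e * (r ^ 4) ^ i := by
      rw [← pow_mul, ← pow_mul, ← pow_add, ← pow_add]; congr 1; ring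
    rw [hr']
    linear_combination (c * r ^ l * S * E * (r ^ 4) ^ i) * h4
  have hG : gegenbauer m ((l : ℝ) / 2 + (n : ℝ) / 4) (Real.cos σ.1) =
      ∑ i ∈ Finset.range (m / 2 + 1), gegenbauerCoeff m ((l : ℝ) / 2 + (n : ℝ) / 4) i *
        (2 * Real.cos σ.1) ^ (m - 2 * i) := rfl
  rw [solidPoly, polyFun_sum, harmonicFun, hm, hG, Finset.mul_sum, Finset.sum_mul, Finset.mul_sum]
  refine Finset.sum_congr rfl fun i hi => ?_
  have hi' := Finset.mem_range.1 hi
  rw [← hterm i (m - 2 * i) (by omega), polyFun_mul, polyFun_mul, polyFun_mul, polyFun_pow,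
    polyFun_pow, polyFun_C, polyFun_rename, polyFun_timePoly, polyFun_gaugePoly,
    gaugePow_polar r hσ, hP']
  rfl

lemma fiberLp_mem_harmonics {k : ℕ} {G : GPoly n} (hG : G ∈ solidSpace n k) (r : ℝ) :
    fiberLp n r (polyMap n G) ∈ harmonics n k := by
  induction hG using Submodule.span_induction with
  | mem G h =>
    obtain ⟨l, m, P, rfl, hP, rfl⟩ := h
    have hmem : (memLp_of_continuous (continuous_harmonicFun l (l + 2 * m) P)).toLp _ ∈
        harmonics n (l + 2 * m) :=
      Submodule.le_topologicalClosure _ (Submodule.subset_span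
        ⟨l, P, by omega, by omega, hP, rfl⟩)
    have heq : fiberLp n r (polyMap n (solidPoly l m P)) =
        (r ^ (l + 2 * m)) • (memLp_of_continuous (continuous_harmonicFun l (l + 2 * m) P)).toLp _ := by
      rw [← MemLp.toLp_const_smul]
      refine MemLp.toLp_congr (memLp_of_continuous ((polyMap n (solidPoly l m P)).continuous.comp
        (continuous_polar r))) _ ?_
      filter_upwards [ae_sphereMeasure n] with σ hσ
      exact polyFun_solidPoly_polar hP.1 r (Real.sin_pos_of_mem_Ioo hσ).le
    rw [heq]
    exact Submodule.smul_mem _ _ hmem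
  | zero => simp
  | add G H _ _ hG hH => rw [map_add, map_add]; exact Submodule.add_mem _ hG hH
  | smul c G _ hG => rw [map_smul, map_smul]; exact Submodule.smul_mem _ _ hG

/-- The closed span in `L²(Ω, dΩ)` of all solid harmonics restricted to the gauge sphere of
radius `r`. -/
def solidClosure (n : ℕ) (r : ℝ) : Submodule ℝ (Lp ℝ 2 (sphereMeasure n)) :=
  ((⨆ k, solidSpace n k).map (fiberLp n r ∘ₗ (polyMap n).toLinearMap)).topologicalClosure

/-- The continuous functions whose restriction to the gauge sphere of radius `r` is in the closed
span of the solid harmonics. -/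
def approximable (n : ℕ) (r : ℝ) : Submodule ℝ C(Space n, ℝ) :=
  (solidClosure n r).comap (fiberLp n r)

/-- The measure dΩ is finite, so uniform approximation on the gauge sphere controls the L² distance,
and the closure is closed. -/
lemma mem_approximable_of_forall_near {r : ℝ} {f : C(Space n, ℝ)}
    (h : ∀ ε > 0, ∃ g ∈ approximable n r, ∀ σ : ℝ × Sphere n, σ.1 ∈ Ioo 0 Real.pi →
      |f (polar r σ) - g (polar r σ)| ≤ ε) : f ∈ approximable n r := by
  set c := (measureUnivNNReal (sphereMeasure n) : ℝ) ^ ((2 : ℝ)⁻¹) with hc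
  have hc0 : 0 ≤ c := by positivity
  have hclosed : IsClosed (solidClosure n r : Set (Lp ℝ 2 (sphereMeasure n))) :=
    Submodule.isClosed_topologicalClosure _
  change fiberLp n r f ∈ (solidClosure n r : Set (Lp ℝ 2 (sphereMeasure n)))
  rw [← hclosed.closure_eq, Metric.mem_closure_iff]
  intro ε hε
  obtain ⟨g, hg, hfg⟩ := h (ε / (c + 1)) (by positivity)
  refine ⟨fiberLp n r g, hg, ?_⟩
  rw [dist_eq_norm, ← map_sub]
  calc ‖fiberLp n r (f - g)‖ ≤ c * (ε / (c + 1)) := norm_fiberLp_le (by positivity) hfg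
    _ < ε := by
      rw [mul_div_assoc', div_lt_iff₀ (by positivity)]
      nlinarith

lemma mem_approximable_congr {r : ℝ} {f g : C(Space n, ℝ)} (hg : g ∈ approximable n r)
    (h : ∀ σ : ℝ × Sphere n, σ.1 ∈ Ioo 0 Real.pi → f (polar r σ) = g (polar r σ)) :
    f ∈ approximable n r :=
  mem_approximable_of_forall_near fun ε hε => ⟨g, hg, fun σ hσ => by
    rw [h σ hσ, sub_self, abs_zero]; exact hε.le⟩

lemma solid_mem_approximable {k : ℕ} {G : GPoly n} (hG : G ∈ solidSpace n k) (r : ℝ) :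
    polyMap n G ∈ approximable n r :=
  Submodule.le_topologicalClosure _
    (Submodule.mem_map_of_mem (Submodule.mem_iSup_of_mem k hG))

/-- On the gauge sphere N is the constant r⁴, so `solidPoly l m P` is a combination of P t^m, P
t^{m−2}, … with nonzero leading coefficient, as a > 0. Solving for P t^m by induction on m inverts
this triangular system. -/
lemma harmonic_mul_time_pow_mem (hn : 1 ≤ n) (r : ℝ) {l : ℕ} {P : MvPolynomial (Fin n) ℝ}
    (hP : IsSolidHarmonic l P) (m : ℕ) :
    polyMap n (rename some P * timePoly n ^ m) ∈ approximable n r := by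
  induction m using Nat.strong_induction_on with
  | _ m ih =>
  set a : ℝ := (l : ℝ) / 2 + (n : ℝ) / 4 with ha
  have ha0 : 0 < a := by
    have : (1 : ℝ) ≤ n := by exact_mod_cast hn
    positivity
  set d : ℕ → ℝ := fun i => gegenbauerCoeff m a i * 4 ^ (m - 2 * i) with hd
  have hd0 : d 0 ≠ 0 := by
    have := ascPochhammer_pos m a ha0
    simp only [hd, gegenbauerCoeff]
    positivity
  have hrest : (d 0)⁻¹ • (polyMap n (solidPoly l m P) - ∑ i ∈ Finset.range (m / 2),
      (d (i + 1) * (r ^ 4) ^ (i + 1)) •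
        polyMap n (rename some P * timePoly n ^ (m - 2 * (i + 1)))) ∈ approximable n r := by
    refine Submodule.smul_mem _ _ (Submodule.sub_mem _
      (solid_mem_approximable (Submodule.subset_span ⟨l, m, P, rfl, hP, rfl⟩) r)
      (Submodule.sum_mem _ fun i hi => Submodule.smul_mem _ _ (ih _ ?_)))
    have := Finset.mem_range.1 hi
    omega
  refine mem_approximable_congr hrest fun σ hσ => ?_
  have hs := (Real.sin_pos_of_mem_Ioo hσ).le
  rw [ContinuousMap.smul_apply, ContinuousMap.sub_apply, ContinuousMap.sum_apply, smul_eq_mul,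
    eq_inv_mul_iff_mul_eq₀ hd0, eq_sub_iff_add_eq', polyMap_apply, polyMap_apply, solidPoly,
    Finset.sum_range_succ', polyFun_add, polyFun_sum]
  congr 1
  · refine Finset.sum_congr rfl fun i _ => ?_
    rw [ContinuousMap.smul_apply, polyMap_apply, polyFun_mul, polyFun_mul, polyFun_mul,
      polyFun_mul, polyFun_C, polyFun_pow (gaugePoly n), polyFun_gaugePoly, gaugePow_polar r hs,
      smul_eq_mul]
    ring
  · rw [polyFun_mul (C _), polyFun_C, pow_zero, mul_one]
    simp [hd, ha]

/-- The product of a polynomial in `x` and a continuous function of `t`. -/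
def xtFun (p : MvPolynomial (Fin n) ℝ) (b : C(ℝ, ℝ)) : C(Space n, ℝ) :=
  polyMap n (rename some p) * b.comp ⟨Prod.snd, continuous_snd⟩

lemma xtFun_apply (p : MvPolynomial (Fin n) ℝ) (b : C(ℝ, ℝ)) (z : Space n) :
    xtFun p b z = eval (fun i => z.1 i) p * b z.2 := by
  rw [← polyFun_rename]; rfl

lemma xtFun_harmonic_mem (hn : 1 ≤ n) (r : ℝ) {l : ℕ} {P : MvPolynomial (Fin n) ℝ}
    (hP : IsSolidHarmonic l P) (b : C(ℝ, ℝ)) : xtFun P b ∈ approximable n r := by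
  obtain ⟨M, hM⟩ := (isCompact_Icc (a := (0 : ℝ)) (b := Real.pi)).prod
    (isCompact_univ (X := Sphere n)) |>.exists_bound_of_continuousOn
    ((continuous_polyFun (rename some P)).comp (continuous_polar r)).continuousOn
  have hM' : ∀ σ : ℝ × Sphere n, σ.1 ∈ Ioo 0 Real.pi →
      |polyFun (rename some P) (polar r σ)| ≤ |M| := fun σ hσ =>
    (hM σ ⟨Ioo_subset_Icc_self hσ, mem_univ _⟩).trans (le_abs_self M)
  refine mem_approximable_of_forall_near fun ε hε => ?_
  -- Weierstrass approximation on the range of t over the gauge sphere, with tolerance scaled by the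
  -- bound on P.
  obtain ⟨q, hq⟩ := exists_polynomial_near_of_continuousOn (-(r ^ 2 / 2)) (r ^ 2 / 2) b
    b.continuous.continuousOn (ε / (|M| + 1)) (by positivity)
  refine ⟨∑ i ∈ Finset.range (q.natDegree + 1),
    q.coeff i • polyMap n (rename some P * timePoly n ^ i),
    Submodule.sum_mem _ fun i _ => Submodule.smul_mem _ _ (harmonic_mul_time_pow_mem hn r hP i),
    fun σ hσ => ?_⟩
  have ht : (polar r σ).2 ∈ Icc (-(r ^ 2 / 2)) (r ^ 2 / 2) := by
    have h1 := Real.neg_one_le_cos σ.1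
    have h2 := Real.cos_le_one σ.1
    have h3 : 0 ≤ r ^ 2 / 2 := by positivity
    simp only [polar, mem_Icc]
    constructor <;> nlinarith
  have hsum : (∑ i ∈ Finset.range (q.natDegree + 1),
      q.coeff i • polyMap n (rename some P * timePoly n ^ i)) (polar r σ) =
      polyFun (rename some P) (polar r σ) * q.eval (polar r σ).2 := by
    rw [ContinuousMap.sum_apply, Polynomial.eval_eq_sum_range, Finset.mul_sum]
    refine Finset.sum_congr rfl fun i _ => ?_
    rw [ContinuousMap.smul_apply, polyMap_apply, polyFun_mul, polyFun_pow, polyFun_timePoly,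
      smul_eq_mul]
    ring
  rw [hsum, xtFun_apply, ← polyFun_rename, ← mul_sub, abs_mul, abs_sub_comm]
  calc _ ≤ |M| * (ε / (|M| + 1)) :=
        mul_le_mul (hM' σ hσ) (hq _ ht).le (abs_nonneg _) (abs_nonneg _)
    _ ≤ ε := by
      rw [mul_div_assoc', div_le_iff₀ (by positivity)]
      nlinarith

/-- Split p = H + |x|²q with H harmonic. On the gauge sphere |x|² = √(r⁴ − 4t²), a continuous
function of t, so it is absorbed into b and the degree drops by two. This is why the coefficient b
ranges over all continuous functions of t. -/
lemma xtFun_homogeneous_mem (hn : 1 ≤ n) (r : ℝ) (d : ℕ) :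
    ∀ {p : MvPolynomial (Fin n) ℝ}, p.IsHomogeneous d → ∀ b : C(ℝ, ℝ),
      xtFun p b ∈ approximable n r := by
  induction d using Nat.strong_induction_on with
  | _ d ih =>
  intro p hp b
  rcases lt_or_ge d 2 with hd | hd
  · exact xtFun_harmonic_mem hn r (isSolidHarmonic_of_le_one (by omega) hp) b
  · obtain ⟨d, rfl⟩ : ∃ e, d = e + 2 := ⟨d - 2, by omega⟩
    obtain ⟨H, q, hH, hq, rfl⟩ := exists_eq_harmonic_add hn hp
    set b' : C(ℝ, ℝ) := ⟨fun t => √(r ^ 4 - 4 * t ^ 2) * b t, by fun_prop⟩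
    refine mem_approximable_congr (Submodule.add_mem _ (xtFun_harmonic_mem hn r hH b)
      (ih d (by omega) hq b')) fun σ hσ => ?_
    have hs := (Real.sin_pos_of_mem_Ioo hσ).le
    have hrad : eval (fun i => (polar r σ).1 i) (radPoly n) =
        √(r ^ 4 - 4 * (polar r σ).2 ^ 2) := by
      have h1 : eval (fun i => (polar r σ).1 i) (radPoly n) = ‖(polar r σ).1‖ ^ 2 := by
        rw [EuclideanSpace.norm_sq_eq]; simp [radPoly]
      rw [h1, ← gaugePow_polar r hs, add_sub_cancel_right,
        show ‖(polar r σ).1‖ ^ 4 = (‖(polar r σ).1‖ ^ 2) ^ 2 by ring,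
        Real.sqrt_sq (by positivity)]
    rw [ContinuousMap.add_apply, xtFun_apply, xtFun_apply, xtFun_apply, map_add, map_mul, hrad,
      show ∀ t, b' t = √(r ^ 4 - 4 * t ^ 2) * b t from fun _ => rfl]
    ring

lemma xtFun_mem (hn : 1 ≤ n) (r : ℝ) (p : MvPolynomial (Fin n) ℝ) (b : C(ℝ, ℝ)) :
    xtFun p b ∈ approximable n r := by
  refine mem_approximable_congr (Submodule.sum_mem _ fun i (_ : i ∈ Finset.range
    (p.totalDegree + 1)) => xtFun_homogeneous_mem hn r i
      (homogeneousComponent_isHomogeneous i p) b) fun σ _ => ?_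
  rw [ContinuousMap.sum_apply]
  simp only [xtFun_apply]
  rw [← Finset.sum_mul, ← map_sum, sum_homogeneousComponent]

lemma polyMap_mem (hn : 1 ≤ n) (r : ℝ) (g : GPoly n) : polyMap n g ∈ approximable n r := by
  -- The extra factor p(x)b(t) strengthens the induction: each variable of g is moved into p or into
  -- b.
  have key : ∀ (p : MvPolynomial (Fin n) ℝ) (b : C(ℝ, ℝ)),
      polyMap n g * xtFun p b ∈ approximable n r := by
    induction g using MvPolynomial.induction_on with
    | C a =>
      intro p b
      rw [← algebraMap_eq, AlgHom.commutes, ← Algebra.smul_def]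
      exact Submodule.smul_mem _ _ (xtFun_mem hn r p b)
    | add g h hg hh =>
      intro p b
      rw [map_add, add_mul]
      exact Submodule.add_mem _ (hg p b) (hh p b)
    | mul_X g o hg =>
      intro p b
      rcases o with _ | i
      · convert hg p (ContinuousMap.id ℝ * b) using 1
        ext z
        simp only [map_mul, ContinuousMap.mul_apply, xtFun_apply, ContinuousMap.id_apply,
          polyMap_apply, show (X none : GPoly n) = timePoly n from rfl, polyFun_timePoly]
        ring
      · convert hg (X i * p) b using 1
        ext z
        simp only [map_mul, ContinuousMap.mul_apply, xtFun_apply, polyMap_apply, polyFun_X_some,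
          eval_X]
        ring
  have h := key 1 1
  convert h using 1
  ext z
  simp [xtFun_apply]

/-- The harmonics are complete on every gauge sphere. -/
theorem mem_approximable (hn : 1 ≤ n) (r : ℝ) (f : C(Space n, ℝ)) : f ∈ approximable n r := by
  -- The coordinates separate points, so Stone–Weierstrass applies on the compact image of the
  -- closed parameter range.
  have hsep : (polyMap n).range.SeparatesPoints := by
    intro z w hzw
    by_contra! h
    refine hzw (Prod.ext (PiLp.ext fun i => ?_) ?_)
    · have := h _ ⟨polyMap n (X (some i)), ⟨_, rfl⟩, rfl⟩
      simpa only [polyMap_apply, polyFun_X_some] using this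
    · have := h _ ⟨polyMap n (timePoly n), ⟨_, rfl⟩, rfl⟩
      simpa only [polyMap_apply, polyFun_timePoly] using this
  have hK : IsCompact (polar r '' (Icc 0 Real.pi ×ˢ (univ : Set (Sphere n)))) :=
    (isCompact_Icc.prod isCompact_univ).image (continuous_polar r)
  refine mem_approximable_of_forall_near fun ε hε => ?_
  obtain ⟨_, ⟨g, rfl⟩, hg⟩ :=
    ContinuousMap.exists_mem_subalgebra_near_continuous_of_isCompact_of_separatesPoints
      hsep f hK hε
  refine ⟨polyMap n g, polyMap_mem hn r g, fun σ hσ => ?_⟩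
  rw [abs_sub_comm]
  exact (hg _ ⟨σ, ⟨Ioo_subset_Icc_self hσ, mem_univ _⟩, rfl⟩).le

end Completeness

/-! ### The spectral gap on gauge spheres -/

section SpectralGap
variable {n : ℕ}

/-- A lower bound for a quadratic form that dominates the diagonal form with increasing
eigenvalues `a k` on an orthogonal family, on vectors orthogonal to the first `J` members. -/
lemma gap_of_orthogonal_family {H : Type*} [NormedAddCommGroup H] [InnerProductSpace ℝ H]
    {U : H} {g : ℕ → H} {s : Finset ℕ} {a : ℕ → ℝ} {A : ℝ} {J : ℕ} (ha0 : ∀ k, 0 ≤ a k)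
    (ha : Monotone a) (horth : ∀ i ∈ s, ∀ k ∈ s, i ≠ k → inner ℝ (g i) (g k) = 0)
    (hA : ∀ c : ℕ → ℝ, 2 * ∑ k ∈ s, c k * (a k * inner ℝ U (g k)) -
      ∑ k ∈ s, c k ^ 2 * (a k * ‖g k‖ ^ 2) ≤ A)
    (hU : ∀ k < J, inner ℝ U (g k) = 0) :
    a J * (‖U‖ ^ 2 - ‖U - ∑ k ∈ s, g k‖ ^ 2) ≤ A := by
  have hsum : ‖∑ k ∈ s, g k‖ ^ 2 = ∑ k ∈ s, ‖g k‖ ^ 2 := by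
    rw [← real_inner_self_eq_norm_sq, sum_inner]
    refine Finset.sum_congr rfl fun i hi => ?_
    rw [inner_sum, Finset.sum_eq_single i (fun k hk hne => horth i hi k hk hne.symm)
      (fun h => absurd hi h), real_inner_self_eq_norm_sq]
  have hexp : ‖U‖ ^ 2 - ‖U - ∑ k ∈ s, g k‖ ^ 2 =
      ∑ k ∈ s, (2 * inner ℝ U (g k) - ‖g k‖ ^ 2) := by
    rw [norm_sub_sq_real, hsum, inner_sum, Finset.sum_sub_distrib, ← Finset.mul_sum]
    ring
  rw [hexp, Finset.mul_sum]
  -- These are the coefficients of the projection of U, which maximise the lower bound for A. If g k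
  -- = 0, division by zero gives 0 and the term vanishes.
  refine le_trans ?_ (hA fun k => inner ℝ U (g k) / ‖g k‖ ^ 2)
  rw [Finset.mul_sum, ← Finset.sum_sub_distrib]
  refine Finset.sum_le_sum fun k _ => ?_
  rcases eq_or_ne (g k) 0 with h0 | h0
  · simp [h0]
  have hpos : 0 < ‖g k‖ ^ 2 := by have := norm_pos_iff.2 h0; positivity
  have hval : 2 * (inner ℝ U (g k) / ‖g k‖ ^ 2 * (a k * inner ℝ U (g k))) -
      (inner ℝ U (g k) / ‖g k‖ ^ 2) ^ 2 * (a k * ‖g k‖ ^ 2) =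
      a k * (inner ℝ U (g k) ^ 2 / ‖g k‖ ^ 2) := by
    field_simp; ring
  rw [hval]
  -- Below J the inner product vanishes and the left-hand term is nonpositive. From J on, 2x − y ≤
  -- x²/y together with monotonicity of the eigenvalues suffices.
  rcases lt_or_ge k J with hk | hk
  · rw [hU k hk]
    have := mul_nonneg (ha0 J) hpos.le
    simp only [mul_zero, zero_sub, mul_neg]
    have h2 : (0 : ℝ) ≤ a k * (0 ^ 2 / ‖g k‖ ^ 2) := by simp
    linarith
  · have h1 : 2 * inner ℝ U (g k) - ‖g k‖ ^ 2 ≤ inner ℝ U (g k) ^ 2 / ‖g k‖ ^ 2 := by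
      rw [le_div_iff₀ hpos]
      nlinarith [sq_nonneg (inner ℝ U (g k) - ‖g k‖ ^ 2)]
    have h2 : 0 ≤ inner ℝ U (g k) ^ 2 / ‖g k‖ ^ 2 := by positivity
    exact (mul_le_mul_of_nonneg_left h1 (ha0 J)).trans (mul_le_mul_of_nonneg_right (ha hk) h2)

/-- Since |x|² = r² sin φ, the weight |x|² turns the angular part of Lebesgue measure into dΩ. -/
lemma integral_normSq_mul_polar (r : ℝ) (u v : C(Space n, ℝ)) :
    ∫ σ, ‖(polar r σ).1‖ ^ 2 * (u (polar r σ) * v (polar r σ)) ∂angularMeasure n =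
      r ^ 2 * inner ℝ (fiberLp n r u) (fiberLp n r v) := by
  rw [inner_fiberLp, integral_sphereMeasure, ← integral_const_mul]
  refine integral_congr_ae ?_
  filter_upwards [ae_angularMeasure n] with σ hσ
  rw [norm_polar_fst_sq r (Real.sin_pos_of_mem_Ioo hσ).le]
  ring

lemma gradInner_add_right {u v w : Space n → ℝ} (hv : ContDiff ℝ 1 v) (hw : ContDiff ℝ 1 w)
    (p : Space n) : gradInner u (fun q => v q + w q) p = gradInner u v p + gradInner u w p := by
  have h : ∀ e, fderiv ℝ (fun q => v q + w q) p e = fderiv ℝ v p e + fderiv ℝ w p e := fun e => by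
    rw [fderiv_fun_add (hv.differentiable one_ne_zero p) (hw.differentiable one_ne_zero p)]; rfl
  simp only [gradInner, fieldX, h, mul_add, Finset.sum_add_distrib]
  ring

lemma angForm_add_right {u v w : Space n → ℝ} (hv : ContDiff ℝ 1 v) (hw : ContDiff ℝ 1 w)
    (p : Space n) : angForm u (fun q => v q + w q) p = angForm u v p + angForm u w p := by
  have h : ∀ e, fderiv ℝ (fun q => v q + w q) p e = fderiv ℝ v p e + fderiv ℝ w p e := fun e => by
    rw [fderiv_fun_add (hv.differentiable one_ne_zero p) (hw.differentiable one_ne_zero p)]; rfl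
  simp only [angForm, gradInner_add_right hv hw, euler, h]
  ring

lemma angForm_smul_right (u : Space n → ℝ) {v : Space n → ℝ} (hv : ContDiff ℝ 1 v) (c : ℝ)
    (p : Space n) : angForm u (fun q => c * v q) p = c * angForm u v p := by
  have h : ∀ e, fderiv ℝ (fun q => c * v q) p e = c * fderiv ℝ v p e := fun e => by
    rw [fderiv_const_mul (hv.differentiable one_ne_zero p)]; rfl
  simp only [angForm, gradInner, fieldX, euler, h]
  have : ∑ i, fderiv ℝ u p (EuclideanSpace.single i 1, 0) *
      (c * fderiv ℝ v p (EuclideanSpace.single i 1, 0)) =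
      c * ∑ i, fderiv ℝ u p (EuclideanSpace.single i 1, 0) *
        fderiv ℝ v p (EuclideanSpace.single i 1, 0) := by
    rw [Finset.mul_sum]; exact Finset.sum_congr rfl fun i _ => by ring
  rw [this]; ring

lemma angForm_polyFun_sum (u : Space n → ℝ) (s : Finset ℕ) (c : ℕ → ℝ) (G : ℕ → GPoly n)
    (p : Space n) : angForm u (polyFun (∑ k ∈ s, c k • G k)) p =
      ∑ k ∈ s, c k * angForm u (polyFun (G k)) p := by
  classical
  induction s using Finset.induction_on with
  | empty =>
    have : polyFun (0 : GPoly n) = fun q => 0 * polyFun (0 : GPoly n) q := by ext; simp [polyFun]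
    rw [Finset.sum_empty, Finset.sum_empty, this, angForm_smul_right u (contDiff_polyFun _),
      zero_mul]
  | insert k s hk ih =>
    rw [Finset.sum_insert hk, Finset.sum_insert hk, funext (polyFun_add _ _),
      angForm_add_right (contDiff_polyFun _) (contDiff_polyFun _), ih,
      funext (polyFun_smul _ _), angForm_smul_right u (contDiff_polyFun _)]

lemma angForm_sub_self {u v : Space n → ℝ} (hu : ContDiff ℝ 1 u) (hv : ContDiff ℝ 1 v)
    (p : Space n) : angForm (fun q => u q + -1 * v q) (fun q => u q + -1 * v q) p =
      angForm u u p - 2 * angForm u v p + angForm v v p := by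
  have hv' : ContDiff ℝ 1 fun q => -1 * v q := contDiff_const.mul hv
  have h1 : angForm (fun q => u q + -1 * v q) u p = angForm u u p + -1 * angForm u v p := by
    rw [angForm_comm, angForm_add_right hu hv', angForm_smul_right _ hv]
  have h2 : angForm (fun q => u q + -1 * v q) v p = angForm u v p + -1 * angForm v v p := by
    rw [angForm_comm, angForm_add_right hu hv', angForm_smul_right _ hv, angForm_comm v u]
  rw [angForm_add_right hu hv', angForm_smul_right _ hv, h1, h2]
  ring

/-- Functions orthogonal to the harmonics of order less than `J` on the gauge sphere of radius `r`
satisfy the Poincaré inequality with the `J`-th eigenvalue. -/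
theorem angular_gap (hn : 2 ≤ n) (u : C(Space n, ℝ)) (hu : ContDiff ℝ 1 u) {r : ℝ} (hr : 0 < r)
    {J : ℕ} (hJ : ∀ k < J, ∀ g ∈ harmonics n k, inner ℝ (fiberLp n r u) g = 0) :
    J * (J + n) * ∫ σ, ‖(polar r σ).1‖ ^ 2 * (u (polar r σ) * u (polar r σ)) ∂angularMeasure n ≤
      ∫ σ, angForm u u (polar r σ) ∂angularMeasure n := by
  set a : ℕ → ℝ := fun k => k * (k + n) with ha
  have ha0 : ∀ k, 0 ≤ a k := fun k => by positivity
  have hastrict : StrictMono a := fun i k hik => by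
    have h1 : (i : ℝ) < k := by exact_mod_cast hik
    have h2 : (2 : ℝ) ≤ n := by exact_mod_cast hn
    have h3 : (0 : ℝ) ≤ i := by positivity
    simp only [ha]
    nlinarith
  set A := ∫ σ, angForm u u (polar r σ) ∂angularMeasure n with hAdef
  have hr2 : 0 < r ^ 2 := by positivity
  have heig : ∀ (v : C(Space n, ℝ)), ContDiff ℝ 1 v → ∀ {k : ℕ} {G : GPoly n},
      G ∈ solidSpace n k → ∫ σ, angForm v (polyFun G) (polar r σ) ∂angularMeasure n =
        a k * (r ^ 2 * inner ℝ (fiberLp n r v) (fiberLp n r (polyMap n G))) := by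
    intro v hv k G hG
    rw [integral_angForm_solid hn hv (isSolid_of_mem_solidSpace hG) hr,
      ← integral_normSq_mul_polar]
    rfl
  -- Symmetry of the form evaluates the same integral with two distinct eigenvalues, which forces
  -- orthogonality.
  have horth : ∀ {i k : ℕ} {G G' : GPoly n}, i ≠ k → G ∈ solidSpace n i → G' ∈ solidSpace n k →
      inner ℝ (fiberLp n r (polyMap n G)) (fiberLp n r (polyMap n G')) = 0 := by
    intro i k G G' hik hG hG'
    have h1 := heig (polyMap n G) (contDiff_polyFun G) hG'
    have h2 := heig (polyMap n G') (contDiff_polyFun G') hG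
    have h3 : ∫ σ, angForm (polyMap n G) (polyFun G') (polar r σ) ∂angularMeasure n =
        ∫ σ, angForm (polyMap n G') (polyFun G) (polar r σ) ∂angularMeasure n :=
      integral_congr_ae (Filter.Eventually.of_forall fun σ => angForm_comm _ _ _)
    rw [h1, h2, real_inner_comm (fiberLp n r (polyMap n G))] at h3
    have hne : a k - a i ≠ 0 := sub_ne_zero.2 (hastrict.injective.ne hik.symm)
    have h4 : (a k - a i) * r ^ 2 *
        inner ℝ (fiberLp n r (polyMap n G)) (fiberLp n r (polyMap n G')) = 0 := by
      rw [real_inner_comm (fiberLp n r (polyMap n G'))]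
      rw [real_inner_comm (fiberLp n r (polyMap n G'))] at h3
      linarith
    exact (mul_eq_zero.1 h4).resolve_left (mul_ne_zero hne hr2.ne')
  have hint : ∀ {v w : Space n → ℝ}, ContDiff ℝ 1 v → ContDiff ℝ 1 w →
      Integrable (fun σ => angForm v w (polar r σ)) (angularMeasure n) := fun hv hw =>
    integrable_comp_polar_const hn (continuous_angForm hv hw) r
  have hsumint : ∀ (v : C(Space n, ℝ)), ContDiff ℝ 1 v → ∀ (s : Finset ℕ) (c : ℕ → ℝ)
      (G : ℕ → GPoly n), (∀ k, G k ∈ solidSpace n k) →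
      ∫ σ, angForm v (polyFun (∑ k ∈ s, c k • G k)) (polar r σ) ∂angularMeasure n =
        ∑ k ∈ s, c k * (a k * (r ^ 2 * inner ℝ (fiberLp n r v) (fiberLp n r (polyMap n (G k))))) := by
    intro v hv s c G hG
    simp only [angForm_polyFun_sum]
    rw [integral_finsetSum _ fun k _ => (hint hv (contDiff_polyFun _)).const_mul _]
    refine Finset.sum_congr rfl fun k _ => ?_
    rw [integral_const_mul, heig v hv (hG k)]
  have hkey : ∀ (s : Finset ℕ) (G : ℕ → GPoly n), (∀ k, G k ∈ solidSpace n k) →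
      a J * (‖fiberLp n r u‖ ^ 2 -
        ‖fiberLp n r u - ∑ k ∈ s, fiberLp n r (polyMap n (G k))‖ ^ 2) ≤ A / r ^ 2 := by
    intro s G hG
    refine gap_of_orthogonal_family ha0 hastrict.monotone
      (fun i _ k _ hik => horth hik (hG i) (hG k)) (fun c => ?_)
      (fun k hk => hJ k hk _ (fiberLp_mem_harmonics (hG k) r))
    rw [le_div_iff₀ hr2]
    set w := ∑ k ∈ s, c k • G k with hw
    -- Expanding the nonnegative form at u − w bounds the energy of u from below by its pairings
    -- with solid harmonics. The energy itself never has to be expanded in a series.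
    have hpos : 0 ≤ ∫ σ, angForm (fun q => u q + -1 * polyFun w q)
        (fun q => u q + -1 * polyFun w q) (polar r σ) ∂angularMeasure n :=
      integral_nonneg fun σ => angForm_self_nonneg _ _
    simp only [angForm_sub_self hu (contDiff_polyFun w)] at hpos
    have hI : Integrable (fun σ => angForm u u (polar r σ) - 2 * angForm u (polyFun w) (polar r σ))
        (angularMeasure n) := (hint hu hu).sub ((hint hu (contDiff_polyFun _)).const_mul 2)
    rw [integral_add hI (hint (contDiff_polyFun _) (contDiff_polyFun _)),
      integral_sub (hint hu hu) ((hint hu (contDiff_polyFun _)).const_mul 2),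
      integral_const_mul, hsumint u hu s c G hG] at hpos
    have hww : ∫ σ, angForm (polyFun w) (polyFun w) (polar r σ) ∂angularMeasure n =
        r ^ 2 * ∑ k ∈ s, c k ^ 2 * (a k * ‖fiberLp n r (polyMap n (G k))‖ ^ 2) := by
      have h := hsumint (polyMap n w) (contDiff_polyFun w) s c G hG
      rw [← hw] at h
      rw [show (∫ σ, angForm (polyFun w) (polyFun w) (polar r σ) ∂angularMeasure n) =
        ∫ σ, angForm (polyMap n w) (polyFun w) (polar r σ) ∂angularMeasure n from rfl, h,
        Finset.mul_sum]
      refine Finset.sum_congr rfl fun k hk => ?_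
      have hin : inner ℝ (fiberLp n r (polyMap n w)) (fiberLp n r (polyMap n (G k))) =
          c k * ‖fiberLp n r (polyMap n (G k))‖ ^ 2 := by
        rw [hw, map_sum, map_sum, sum_inner, Finset.sum_eq_single k]
        · rw [map_smul, map_smul, real_inner_smul_left, real_inner_self_eq_norm_sq]
        · intro i _ hik
          rw [map_smul, map_smul, real_inner_smul_left, horth hik (hG i) (hG k), mul_zero]
        · exact fun h => absurd hk h
      rw [hin]; ring
    rw [hww] at hpos
    have hlin : ∑ k ∈ s, c k * (a k * (r ^ 2 * inner ℝ (fiberLp n r u)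
          (fiberLp n r (polyMap n (G k))))) =
        r ^ 2 * ∑ k ∈ s, c k * (a k * inner ℝ (fiberLp n r u)
          (fiberLp n r (polyMap n (G k)))) := by
      rw [Finset.mul_sum]; exact Finset.sum_congr rfl fun k _ => by ring
    rw [hlin, ← hAdef] at hpos
    linarith
  -- By completeness the L² error of a finite sum of solid harmonics can be made so small that a J
  -- times its square is at most ε.
  have hfin : a J * ‖fiberLp n r u‖ ^ 2 ≤ A / r ^ 2 := by
    refine le_of_forall_pos_le_add fun ε hε => ?_
    have hmem : fiberLp n r u ∈ (solidClosure n r : Set (Lp ℝ 2 (sphereMeasure n))) :=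
      mem_approximable (by omega) r u
    rw [solidClosure, Submodule.topologicalClosure_coe, Metric.mem_closure_iff] at hmem
    obtain ⟨_, ⟨G, hG, rfl⟩, hdist⟩ := hmem (√(ε / (a J + 1)))
      (Real.sqrt_pos.2 (by have := ha0 J; positivity))
    -- Membership in the supremum gives one solid harmonic per degree, so the approximant is a sum
    -- over an orthogonal family.
    obtain ⟨f, hf, rfl⟩ := (Submodule.mem_iSup_iff_exists_finsupp _ _).1 hG
    have h := hkey f.support f hf
    have heq : (fiberLp n r ∘ₗ (polyMap n).toLinearMap) (f.sum fun _ x => x) =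
        ∑ k ∈ f.support, fiberLp n r (polyMap n (f k)) := by
      rw [Finsupp.sum, map_sum]; rfl
    rw [heq, dist_eq_norm] at hdist
    have h2 : ‖fiberLp n r u - ∑ k ∈ f.support, fiberLp n r (polyMap n (f k))‖ ^ 2 ≤
        ε / (a J + 1) := by
      rw [← Real.sq_sqrt (show 0 ≤ ε / (a J + 1) by have := ha0 J; positivity)]
      exact pow_le_pow_left₀ (norm_nonneg _) hdist.le 2
    have h3 : a J * (ε / (a J + 1)) ≤ ε := by
      have := ha0 J
      rw [mul_div_assoc', div_le_iff₀ (by positivity)]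
      nlinarith
    have h4 := mul_le_mul_of_nonneg_left h2 (ha0 J)
    linarith
  rw [integral_normSq_mul_polar, real_inner_self_eq_norm_sq]
  rw [le_div_iff₀ hr2] at hfin
  calc _ = a J * ‖fiberLp n r u‖ ^ 2 * r ^ 2 := by simp only [ha]; ring
    _ ≤ A := hfin

end SpectralGap

/-! ### Radial derivatives and the radial identity -/

section Radial
variable {n : ℕ}

lemma isOpen_radii (R : EReal) : IsOpen (radii R) := by
  have h : radii R = Ioi 0 ∩ (fun r : ℝ => (r : EReal)) ⁻¹' Iio R := rfl
  rw [h]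
  exact isOpen_Ioi.inter (isOpen_Iio.preimage continuous_coe_real_ereal)

lemma gauge_dilation {s : ℝ} (hs : 0 ≤ s) (p : Space n) : gauge (dilation s p) = s * gauge p := by
  have h : ‖(dilation s p).1‖ ^ 4 + 4 * (dilation s p).2 ^ 2 =
      s ^ 4 * (‖p.1‖ ^ 4 + 4 * p.2 ^ 2) := by
    simp only [dilation, norm_smul, Real.norm_eq_abs, mul_pow, Even.pow_abs (by decide : Even 4)]
    ring
  rw [gauge, h, Real.mul_rpow (by positivity) (by positivity), ← Real.rpow_natCast,
    ← Real.rpow_mul hs, gauge]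
  norm_num

lemma dilation_gauge_inv {p : Space n} (hp : p ≠ 0) :
    dilation (gauge p) (dilation (gauge p)⁻¹ p) = p := by
  have h := (gauge_pos hp).ne'
  refine Prod.ext ?_ ?_
  · simp [dilation, smul_smul, h]
  · simp only [dilation]; field_simp

lemma hasDerivAt_dilation (s : ℝ) (q : Space n) :
    HasDerivAt (fun s => dilation s q) (q.1, 2 * s * q.2) s := by
  have h1 : HasDerivAt (fun s : ℝ => s • q.1) q.1 s := by
    simpa using (hasDerivAt_id s).smul_const q.1
  have h2 : HasDerivAt (fun s : ℝ => s ^ 2 * q.2) (2 * s * q.2) s := by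
    simpa using (hasDerivAt_pow 2 s).mul_const q.2
  exact h1.prodMk h2

/-- The dilation ray through p has velocity ϱ⁻¹(x, 2t) at p, so ∂_ϱ = ϱ⁻¹Z. -/
lemma hasDerivAt_comp_dilation {u : Space n → ℝ} {p : Space n} (hu : DifferentiableAt ℝ u p)
    (hp : p ≠ 0) :
    HasDerivAt (fun s => u (dilation s (dilation (gauge p)⁻¹ p))) ((gauge p)⁻¹ * euler u p)
      (gauge p) := by
  have hg := (gauge_pos hp).ne'
  have h1 := hasDerivAt_dilation (gauge p) (dilation (gauge p)⁻¹ p)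
  have h2 : HasFDerivAt u (fderiv ℝ u p) (dilation (gauge p) (dilation (gauge p)⁻¹ p)) := by
    rw [dilation_gauge_inv hp]; exact hu.hasFDerivAt
  have h3 := h2.comp_hasDerivAt (gauge p) h1
  have hv : ((dilation (gauge p)⁻¹ p).1, 2 * gauge p * (dilation (gauge p)⁻¹ p).2) =
      (gauge p)⁻¹ • ((p.1, 2 * p.2) : Space n) := by
    refine Prod.ext rfl ?_
    simp only [dilation, Prod.smul_mk, smul_eq_mul]
    field_simp
  rw [hv, map_smul, smul_eq_mul] at h3
  exact h3

lemma radialDeriv_div {u : Space n → ℝ} {p : Space n} (hu : DifferentiableAt ℝ u p)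
    (hp : p ≠ 0) {f : ℝ → ℝ} (hf : DifferentiableAt ℝ f (gauge p)) (hf0 : f (gauge p) ≠ 0) :
    radialDeriv (fun q => u q / f (gauge q)) p =
      (gauge p)⁻¹ * euler u p / f (gauge p) - u p * deriv f (gauge p) / f (gauge p) ^ 2 := by
  have hg := gauge_pos hp
  have h1 := (hasDerivAt_comp_dilation hu hp).div hf.hasDerivAt hf0
  have h2 : (fun s => u (dilation s (dilation (gauge p)⁻¹ p)) /
      f (gauge (dilation s (dilation (gauge p)⁻¹ p)))) =ᶠ[nhds (gauge p)]
      ((fun s => u (dilation s (dilation (gauge p)⁻¹ p))) / f) := by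
    filter_upwards [Ioi_mem_nhds hg] with s hs
    rw [gauge_dilation (le_of_lt hs), gauge_dilation (by positivity), inv_mul_cancel₀ hg.ne',
      mul_one, Pi.div_apply]
  rw [radialDeriv, (h1.congr_of_eventuallyEq h2).deriv, dilation_gauge_inv hp]
  field_simp

/-- Off the support the quotient vanishes along the ray near p, whatever f does there. At the origin
the ray is constant, so the derivative is again 0. -/
lemma radialDeriv_eq_zero {u : Space n → ℝ} {p : Space n} (hp : p ∉ tsupport u) (f : ℝ → ℝ) :
    radialDeriv (fun q => u q / f (gauge q)) p = 0 := by
  rcases eq_or_ne p 0 with rfl | h0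
  · have : ∀ s, dilation s (dilation (gauge (0 : Space n))⁻¹ (0 : Space n)) = 0 := fun s => by
      simp [dilation]
    simp only [radialDeriv, this, deriv_const]
  · have h1 : ContinuousAt (fun s => dilation s (dilation (gauge p)⁻¹ p)) (gauge p) :=
      (hasDerivAt_dilation _ _).continuousAt
    have h2 : u =ᶠ[nhds (dilation (gauge p) (dilation (gauge p)⁻¹ p))] 0 := by
      rw [dilation_gauge_inv h0]; exact notMem_tsupport_iff_eventuallyEq.1 hp
    have h3 : (fun s => u (dilation s (dilation (gauge p)⁻¹ p)) /
        f (gauge (dilation s (dilation (gauge p)⁻¹ p)))) =ᶠ[nhds (gauge p)] fun _ => 0 := by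
      filter_upwards [h1.eventually h2] with s hs
      rw [hs]; simp
    rw [radialDeriv, h3.deriv_eq, deriv_const]

lemma hasDerivAt_comp_polar {u : Space n → ℝ} {r : ℝ} (hr : r ≠ 0) {σ : ℝ × Sphere n}
    (hu : DifferentiableAt ℝ u (polar r σ)) :
    HasDerivAt (fun s => u (polar s σ)) (r⁻¹ * euler u (polar r σ)) r := by
  have h1 : HasDerivAt (fun s => polar s σ) (r⁻¹ • ((polar r σ).1, 2 * (polar r σ).2)) r := by
    have e1 : HasDerivAt (fun s : ℝ => (s * √(Real.sin σ.1)) • (σ.2 : EuclideanSpace ℝ (Fin n)))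
        (r⁻¹ • (polar r σ).1) r := by
      have := ((hasDerivAt_id r).mul_const (√(Real.sin σ.1))).smul_const
        (σ.2 : EuclideanSpace ℝ (Fin n))
      refine this.congr_deriv ?_
      simp [polar, smul_smul, hr]
    have e2 : HasDerivAt (fun s : ℝ => s ^ 2 / 2 * Real.cos σ.1) (r⁻¹ • (2 * (polar r σ).2)) r := by
      have := ((hasDerivAt_pow 2 r).div_const 2).mul_const (Real.cos σ.1)
      refine this.congr_deriv ?_
      simp only [polar, smul_eq_mul]
      field_simp
      norm_num
      ring
    exact e1.prodMk e2
  have h3 := hu.hasFDerivAt.comp_hasDerivAt r h1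
  rw [map_smul, smul_eq_mul] at h3
  exact h3

/-! ### Vanishing and integrability off the support -/

lemma eq_zero_of_notMem_tsupport {u : Space n → ℝ} {p : Space n} (hp : p ∉ tsupport u) :
    u p = 0 ∧ fderiv ℝ u p = 0 :=
  ⟨image_eq_zero_of_notMem_tsupport hp,
    image_eq_zero_of_notMem_tsupport fun h => hp (tsupport_fderiv_subset ℝ h)⟩

lemma euler_eq_zero_of_notMem_tsupport {u : Space n → ℝ} {p : Space n} (hp : p ∉ tsupport u) :
    euler u p = 0 := by
  rw [euler, (eq_zero_of_notMem_tsupport hp).2]; rfl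

lemma gradInner_eq_zero_of_notMem_tsupport {u : Space n → ℝ} {p : Space n}
    (hp : p ∉ tsupport u) : gradInner u u p = 0 := by
  simp [gradInner, fieldX, (eq_zero_of_notMem_tsupport hp).2]

lemma angForm_eq_zero_of_notMem_tsupport {u : Space n → ℝ} {p : Space n}
    (hp : p ∉ tsupport u) : angForm u u p = 0 := by
  rw [angForm, gradInner_eq_zero_of_notMem_tsupport hp, euler_eq_zero_of_notMem_tsupport hp]
  ring

/-- The weights are controlled only on (0, R); continuity is therefore available only on the compact
support, where the gauge stays in that interval. -/
lemma integrable_of_continuousOn_tsupport {K : Set (Space n)} (hK : IsCompact K)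
    {F : Space n → ℝ} (hF : ContinuousOn F K) (h0 : ∀ p ∉ K, F p = 0) : Integrable F := by
  rw [← integrableOn_iff_integrable_of_support_subset (s := K)
    fun p hp => by_contra fun h => hp (h0 p h)]
  exact hF.integrableOn_compact hK

/-- The one-dimensional identity of a Bessel pair, along a dilation ray. -/
lemma integral_ray_eq_zero {R : EReal} {V W f : ℝ → ℝ} (hB : IsBesselPair (n + 2) R V W f)
    {u : Space n → ℝ} (hu : ContDiff ℝ 1 u) (hc : HasCompactSupport u)
    (hs : tsupport u ⊆ gaugeBall n R \ {0}) {σ : ℝ × Sphere n} (hσ : σ.1 ∈ Ioo 0 Real.pi) :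
    ∫ r in Ioi 0, r ^ (n + 1) * (V r * (r⁻¹ * euler u (polar r σ)) ^ 2 -
      W r * u (polar r σ) ^ 2 - V r * (r⁻¹ * euler u (polar r σ) / f r -
        u (polar r σ) * deriv f r / f r ^ 2) ^ 2 * f r ^ 2) = 0 := by
  have hsin := (Real.sin_pos_of_mem_Ioo hσ).le
  set h' : ℝ → ℝ := fun r => r ^ (n + 1) * (V r * (r⁻¹ * euler u (polar r σ)) ^ 2 -
      W r * u (polar r σ) ^ 2 - V r * (r⁻¹ * euler u (polar r σ) / f r -
        u (polar r σ) * deriv f r / f r ^ 2) ^ 2 * f r ^ 2) with hh'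
  -- The integral of a non-integrable function is 0 by convention, so only the integrable case
  -- carries content.
  by_cases hint : IntegrableOn h' (Ioi 0)
  swap
  · exact integral_undef hint
  -- The primitive r^{n+1} V f' u²/f. The equation turns (r^{n+1}Vf')' into the W term, and the
  -- derivative of u²/f completes the square.
  set h : ℝ → ℝ := fun r => r ^ (n + 2 - 1) * V r * deriv f r * (u (polar r σ) ^ 2 / f r) with hh
  have hpc : Continuous fun r : ℝ => polar r σ := by unfold polar; fun_prop
  have hloc : ∀ r, polar r σ ∉ tsupport u → h =ᶠ[nhds r] fun _ => 0 := fun r hr => by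
    filter_upwards [hpc.continuousAt.eventually (notMem_tsupport_iff_eventuallyEq.1 hr)] with s hs
    simp only [hh, hs]; simp
  have hderiv : ∀ r ∈ Ioi (0 : ℝ), HasDerivAt h (h' r) r := by
    intro r hr
    have hr0 : (0 : ℝ) < r := hr
    by_cases hmem : polar r σ ∈ tsupport u
    · have hrad : r ∈ radii R := by
        refine ⟨hr, ?_⟩
        have := (hs hmem).1
        rwa [gaugeBall, mem_ofPred_eq, gauge_polar hr0.le hsin] at this
      have hfpos := hB.pos r hrad
      have hfd : HasDerivAt f (deriv f r) r :=
        ((hB.contDiffOn_f.differentiableOn one_ne_zero r hrad).differentiableAt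
          ((isOpen_radii R).mem_nhds hrad)).hasDerivAt
      have hud := hasDerivAt_comp_polar hr0.ne' (hu.differentiable one_ne_zero (polar r σ))
      have := (hB.ode r hrad).mul ((hud.pow 2).div hfd hfpos.ne')
      refine this.congr_deriv ?_
      simp only [hh', Pi.pow_apply, Pi.div_apply, show n + 2 - 1 = n + 1 by omega]
      field_simp
      ring
    · have h0 : h' r = 0 := by
        simp only [hh', (eq_zero_of_notMem_tsupport hmem).1, euler_eq_zero_of_notMem_tsupport hmem]
        ring
      rw [h0]
      exact (hasDerivAt_const r (0 : ℝ)).congr_of_eventuallyEq (hloc r hmem)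
  -- The support avoids the origin and is bounded, so `h` vanishes near 0 and near infinity: no
  -- boundary terms.
  have hzero : polar 0 σ ∉ tsupport u := fun hm => by
    refine (hs hm).2 ?_
    simp [polar]
  have hcont : ContinuousWithinAt h (Ici 0) 0 :=
    (continuousAt_const.congr (hloc 0 hzero).symm).continuousWithinAt
  obtain ⟨M, hM⟩ := (hc.isCompact.image (continuous_gauge (n := n))).isBounded.subset_closedBall 0
  have htend : Filter.Tendsto h Filter.atTop (nhds 0) := by
    refine tendsto_const_nhds.congr' ?_
    filter_upwards [Filter.eventually_gt_atTop (max M 0)] with r hr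
    have hr0 : 0 < r := (le_max_right _ _).trans_lt hr
    have hnot : polar r σ ∉ tsupport u := fun hm => by
      have := hM ⟨_, hm, rfl⟩
      rw [gauge_polar hr0.le hsin, mem_closedBall_zero_iff, Real.norm_of_nonneg hr0.le] at this
      exact absurd ((le_max_left M 0).trans_lt hr) (not_lt.2 this)
    exact ((hloc r hnot).self_of_nhds).symm
  rw [integral_Ioi_of_hasDerivAt_of_tendsto hcont hderiv hint htend,
    (hloc 0 hzero).self_of_nhds, sub_zero]

end Radial

/-! ### The improved Hardy inequality for Bessel pairs -/

section Main
variable {n : ℕ}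

lemma integral_mono_radial (hn : 1 ≤ n) {F G : Space n → ℝ} (hF : Integrable F)
    (hG : Integrable G) (h : ∀ r, 0 < r → ∫ σ, F (polar r σ) ∂angularMeasure n ≤
      ∫ σ, G (polar r σ) ∂angularMeasure n) : ∫ p, F p ≤ ∫ p, G p := by
  rw [integral_eq_integral_radial hn hF, integral_eq_integral_radial hn hG]
  refine integral_mono_ae (integrable_comp_polar hn hF).integral_prod_left
    (integrable_comp_polar hn hG).integral_prod_left ?_
  filter_upwards [ae_radialMeasure n] with r hr
  exact h r hr

lemma IsInS.inner_eq_zero {j : ℤ} {U : Set (Space n)} {u : Space n → ℝ} (hu : IsInS j U u)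
    {k : ℕ} (hk : (k : ℤ) ≤ j) {r : ℝ} (hr : 0 < r) {g : Lp ℝ 2 (sphereMeasure n)}
    (hg : g ∈ harmonics n k) :
    inner ℝ (fiberLp n r ⟨u, hu.smooth.continuous⟩) g = 0 := by
  have h : (harmonics n k).starProjection (fiberLp n r ⟨u, hu.smooth.continuous⟩) = 0 :=
    hu.proj_eq_zero k hk r hr
  rw [Submodule.starProjection_apply_eq_zero_iff] at h
  rw [real_inner_comm]
  exact h g hg

section Integrands
variable {R : EReal} {V W f : ℝ → ℝ} {u : Space n → ℝ}

lemma gauge_mem_radii (hs : tsupport u ⊆ gaugeBall n R \ {0}) {p : Space n}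
    (hp : p ∈ tsupport u) : p ≠ 0 ∧ gauge p ∈ radii R :=
  ⟨(hs hp).2, gauge_pos (hs hp).2, (hs hp).1⟩

lemma continuousOn_comp_gauge (hs : tsupport u ⊆ gaugeBall n R \ {0}) {g : ℝ → ℝ}
    (hg : ContinuousOn g (radii R)) : ContinuousOn (fun p => g (gauge p)) (tsupport u) :=
  hg.comp continuous_gauge.continuousOn fun _ hp => (gauge_mem_radii hs hp).2

lemma setIntegral_gaugeBall (hs : tsupport u ⊆ gaugeBall n R \ {0}) {F : Space n → ℝ}
    (h0 : ∀ p ∉ tsupport u, F p = 0) : ∫ p in gaugeBall n R, F p = ∫ p, F p :=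
  setIntegral_eq_integral_of_forall_compl_eq_zero fun p hp =>
    h0 p fun hm => hp (hs hm).1

/-- The formula |∇_G ϱ|² = |x|²/ϱ² is known only off the origin, but u vanishes there. -/
lemma weight_gradSq_gauge (hs : tsupport u ⊆ gaugeBall n R \ {0}) (g : ℝ → ℝ) :
    (fun p => g (gauge p) * u p ^ 2 * gradSq gauge p) =
      fun p => g (gauge p) * u p ^ 2 * (‖p.1‖ ^ 2 / gauge p ^ 2) := by
  ext p
  by_cases hp : p ∈ tsupport u
  · rw [gradSq_gauge (gauge_mem_radii hs hp).1]
  · rw [(eq_zero_of_notMem_tsupport hp).1]; ring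

lemma weight_radialGradSq (hB : IsBesselPair (n + 2) R V W f) (hu : ContDiff ℝ 1 u)
    (hs : tsupport u ⊆ gaugeBall n R \ {0}) :
    (fun p => V (gauge p) * radialGradSq (fun q => u q / f (gauge q)) p * f (gauge p) ^ 2) =
      fun p => V (gauge p) * ((‖p.1‖ ^ 2 / gauge p ^ 2) * ((gauge p)⁻¹ * euler u p / f (gauge p) -
        u p * deriv f (gauge p) / f (gauge p) ^ 2) ^ 2) * f (gauge p) ^ 2 := by
  ext p
  by_cases hp : p ∈ tsupport u
  · obtain ⟨h0, hr⟩ := gauge_mem_radii hs hp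
    have hfd : DifferentiableAt ℝ f (gauge p) :=
      (hB.contDiffOn_f.differentiableOn one_ne_zero _ hr).differentiableAt
        ((isOpen_radii R).mem_nhds hr)
    rw [radialGradSq, gradSq_gauge h0,
      radialDeriv_div (hu.differentiable one_ne_zero p) h0 hfd (hB.pos _ hr).ne']
  · rw [radialGradSq, radialDeriv_eq_zero hp, (eq_zero_of_notMem_tsupport hp).1,
      euler_eq_zero_of_notMem_tsupport hp]
    ring

lemma integrable_weight_mul (hc : HasCompactSupport u) (hs : tsupport u ⊆ gaugeBall n R \ {0})
    {g : ℝ → ℝ} (hg : ContinuousOn g (radii R)) {F : Space n → ℝ} (hF : Continuous F)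
    (h0 : ∀ p ∉ tsupport u, F p = 0) : Integrable fun p => g (gauge p) * F p :=
  integrable_of_continuousOn_tsupport hc.isCompact
    ((continuousOn_comp_gauge hs hg).mul hF.continuousOn) fun p hp => by rw [h0 p hp, mul_zero]

lemma continuousOn_normSq_div_gauge (hs : tsupport u ⊆ gaugeBall n R \ {0}) :
    ContinuousOn (fun p : Space n => ‖p.1‖ ^ 2 / gauge p ^ 2) (tsupport u) :=
  ContinuousOn.div (by fun_prop) (continuous_gauge.continuousOn.pow 2) fun _ hp =>
    pow_ne_zero 2 (gauge_mem_radii hs hp).2.1.ne'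

lemma integrable_weight_sq (hu : Continuous u) (hc : HasCompactSupport u)
    (hs : tsupport u ⊆ gaugeBall n R \ {0}) {g : ℝ → ℝ} (hg : ContinuousOn g (radii R)) :
    Integrable fun p => g (gauge p) * u p ^ 2 * (‖p.1‖ ^ 2 / gauge p ^ 2) :=
  integrable_of_continuousOn_tsupport hc.isCompact
    (((continuousOn_comp_gauge hs hg).mul (hu.continuousOn.pow 2)).mul
      (continuousOn_normSq_div_gauge hs))
    fun p hp => by rw [(eq_zero_of_notMem_tsupport hp).1]; ring

lemma integrable_weight_radial (hB : IsBesselPair (n + 2) R V W f) (hu : ContDiff ℝ 1 u)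
    (hc : HasCompactSupport u) (hs : tsupport u ⊆ gaugeBall n R \ {0}) :
    Integrable fun p => V (gauge p) * ((‖p.1‖ ^ 2 / gauge p ^ 2) *
      ((gauge p)⁻¹ * euler u p / f (gauge p) -
        u p * deriv f (gauge p) / f (gauge p) ^ 2) ^ 2) * f (gauge p) ^ 2 := by
  have hV := continuousOn_comp_gauge hs hB.contDiffOn_V.continuousOn
  have hf := continuousOn_comp_gauge hs hB.contDiffOn_f.continuousOn
  have hf' := continuousOn_comp_gauge hs
    (hB.contDiffOn_f.continuousOn_deriv_of_isOpen (isOpen_radii R) le_rfl)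
  have hf0 : ∀ p ∈ tsupport u, f (gauge p) ≠ 0 := fun p hp =>
    (hB.pos _ (gauge_mem_radii hs hp).2).ne'
  have hgi : ContinuousOn (fun p : Space n => (gauge p)⁻¹) (tsupport u) :=
    continuous_gauge.continuousOn.inv₀ fun _ hp => (gauge_mem_radii hs hp).2.1.ne'
  refine integrable_of_continuousOn_tsupport hc.isCompact ?_ fun p hp => ?_
  · refine (hV.mul ((continuousOn_normSq_div_gauge hs).mul (ContinuousOn.pow ?_ 2))).mul (hf.pow 2)
    exact ((hgi.mul (continuous_euler hu).continuousOn).div hf hf0).sub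
      ((hu.continuous.continuousOn.mul hf').div (hf.pow 2) fun p hp => pow_ne_zero 2 (hf0 p hp))
  · rw [(eq_zero_of_notMem_tsupport hp).1, euler_eq_zero_of_notMem_tsupport hp]; ring

/-- The radial part of the energy equals the potential term plus the remainder. -/
lemma integral_radial_identity (hn : 2 ≤ n) (hB : IsBesselPair (n + 2) R V W f)
    (hu : ContDiff ℝ 1 u) (hc : HasCompactSupport u) (hs : tsupport u ⊆ gaugeBall n R \ {0}) :
    (∫ p, W (gauge p) * u p ^ 2 * (‖p.1‖ ^ 2 / gauge p ^ 2)) +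
      (∫ p, V (gauge p) * ((‖p.1‖ ^ 2 / gauge p ^ 2) * ((gauge p)⁻¹ * euler u p / f (gauge p) -
        u p * deriv f (gauge p) / f (gauge p) ^ 2) ^ 2) * f (gauge p) ^ 2) =
    ∫ p, V (gauge p) / gauge p ^ 4 * (‖p.1‖ ^ 2 * euler u p ^ 2) := by
  have hg4 : ContinuousOn (fun r => V r / r ^ 4) (radii R) :=
    hB.contDiffOn_V.continuousOn.div (by fun_prop) fun r hr => pow_ne_zero 4 hr.1.ne'
  have h1 := integrable_weight_sq hu.continuous hc hs hB.contDiffOn_W.continuousOn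
  have h2 := integrable_weight_radial hB hu hc hs
  have h3 : Integrable fun p => V (gauge p) / gauge p ^ 4 * (‖p.1‖ ^ 2 * euler u p ^ 2) :=
    integrable_weight_mul hc hs hg4 (by have := continuous_euler hu; fun_prop) fun p hp => by
      rw [euler_eq_zero_of_notMem_tsupport hp]; ring
  have h12 : Integrable fun p => W (gauge p) * u p ^ 2 * (‖p.1‖ ^ 2 / gauge p ^ 2) +
      V (gauge p) * ((‖p.1‖ ^ 2 / gauge p ^ 2) * ((gauge p)⁻¹ * euler u p / f (gauge p) -
        u p * deriv f (gauge p) / f (gauge p) ^ 2) ^ 2) * f (gauge p) ^ 2 := h1.add h2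
  rw [← integral_add h1 h2, ← sub_eq_zero, ← integral_sub h12 h3]
  refine (integral_eq_integral_angular (by omega) (h12.sub h3)).trans ?_
  refine integral_eq_zero_of_ae ?_
  filter_upwards [ae_angularMeasure n] with σ hσ
  have hsin := (Real.sin_pos_of_mem_Ioo hσ).le
  rw [integral_radialMeasure]
  have key := integral_ray_eq_zero hB hu hc hs hσ
  -- The factor is sin φ from |x|²/r² and 1/2 from the radial density r^{n+1}/2; the sign reflects
  -- the order of the subtraction.
  refine Eq.trans ?_ ((congrArg (-(Real.sin σ.1 / 2) * ·) key).trans (mul_zero _))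
  rw [← integral_const_mul]
  refine setIntegral_congr_fun measurableSet_Ioi fun r hr => ?_
  have hr0 : (0 : ℝ) < r := hr
  simp only [Pi.sub_apply, gauge_polar hr0.le hsin, norm_polar_fst_sq r hsin]
  have e1 : r ^ 2 * Real.sin σ.1 / r ^ 2 = Real.sin σ.1 := by field_simp
  have e2 : V r / r ^ 4 * (r ^ 2 * Real.sin σ.1 * euler u (polar r σ) ^ 2) =
      Real.sin σ.1 * (V r * (r⁻¹ * euler u (polar r σ)) ^ 2) := by field_simp
  rw [e1, e2]
  ring

/-- The angular part of the energy, integrated against the weight `V`. -/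
lemma integral_angular_gap (hn : 2 ≤ n) (hV : ContinuousOn V (radii R))
    (hV0 : ∀ r ∈ radii R, 0 ≤ V r) {j : ℤ} (hj : -1 ≤ j)
    (hu : IsInS j (gaugeBall n R \ {0}) u) :
    ((j : ℝ) + 1) * ((n + 2 : ℕ) + j - 1) *
      (∫ p, V (gauge p) / gauge p ^ 2 * u p ^ 2 * (‖p.1‖ ^ 2 / gauge p ^ 2)) ≤
    ∫ p, V (gauge p) / gauge p ^ 4 * angForm u u p := by
  have hu1 : ContDiff ℝ 1 u := hu.smooth.of_le (by exact_mod_cast le_top)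
  have hs := hu.tsupport_subset
  have hc := hu.hasCompactSupport
  have hg2 : ContinuousOn (fun r => V r / r ^ 2) (radii R) :=
    hV.div (by fun_prop) fun r hr => pow_ne_zero 2 hr.1.ne'
  have hg4 : ContinuousOn (fun r => V r / r ^ 4) (radii R) :=
    hV.div (by fun_prop) fun r hr => pow_ne_zero 4 hr.1.ne'
  have h1 := integrable_weight_sq hu1.continuous hc hs hg2
  have h2 : Integrable fun p => V (gauge p) / gauge p ^ 4 * angForm u u p :=
    integrable_weight_mul hc hs hg4 (continuous_angForm hu1 hu1) fun p hp =>
      angForm_eq_zero_of_notMem_tsupport hp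
  rw [← integral_const_mul]
  refine integral_mono_radial (by omega) (h1.const_mul _) h2 fun r hr => ?_
  -- With J = j + 1 the vanishing orders 0, …, j are those below J, and J(J+n) = (j+1)(Q+j−1). For j
  -- = −1 this is J = 0 and no condition.
  obtain ⟨J, hJ⟩ := Int.eq_ofNat_of_zero_le (show 0 ≤ j + 1 by omega)
  have hJr : (j : ℝ) + 1 = J := by exact_mod_cast hJ
  have hgap := angular_gap hn ⟨u, hu1.continuous⟩ hu1 hr (J := J) fun k hk g hg =>
    hu.inner_eq_zero (by omega) hr hg
  have e1 : ∫ σ, ((j : ℝ) + 1) * ((n + 2 : ℕ) + j - 1) * (V (gauge (polar r σ)) /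
        gauge (polar r σ) ^ 2 * u (polar r σ) ^ 2 *
        (‖(polar r σ).1‖ ^ 2 / gauge (polar r σ) ^ 2)) ∂angularMeasure n =
      V r / r ^ 4 * (J * (J + n) * ∫ σ, ‖(polar r σ).1‖ ^ 2 * (u (polar r σ) * u (polar r σ))
        ∂angularMeasure n) := by
    rw [← mul_assoc, ← integral_const_mul]
    refine integral_congr_ae ?_
    filter_upwards [ae_angularMeasure n] with σ hσ
    rw [gauge_polar hr.le (Real.sin_pos_of_mem_Ioo hσ).le, hJr,
      show (j : ℝ) = J - 1 by linarith]
    push_cast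
    field_simp
    ring
  have e2 : ∫ σ, V (gauge (polar r σ)) / gauge (polar r σ) ^ 4 * angForm u u (polar r σ)
        ∂angularMeasure n =
      V r / r ^ 4 * ∫ σ, angForm u u (polar r σ) ∂angularMeasure n := by
    rw [← integral_const_mul]
    refine integral_congr_ae ?_
    filter_upwards [ae_angularMeasure n] with σ hσ
    rw [gauge_polar hr.le (Real.sin_pos_of_mem_Ioo hσ).le]
  rw [e1, e2]
  -- Outside (0, R) the sign of V is unknown, but the gauge sphere then misses the support of u and
  -- both sides vanish.
  by_cases hrad : r ∈ radii R
  · have hVr : 0 ≤ V r / r ^ 4 := div_nonneg (hV0 r hrad) (by positivity)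
    exact mul_le_mul_of_nonneg_left hgap hVr
  · have hnot : ∀ σ : ℝ × Sphere n, σ.1 ∈ Ioo 0 Real.pi → polar r σ ∉ tsupport u := fun σ hσ hm =>
      hrad (by
        have := (gauge_mem_radii hs hm).2
        rwa [gauge_polar hr.le (Real.sin_pos_of_mem_Ioo hσ).le] at this)
    have z1 : ∫ σ, ‖(polar r σ).1‖ ^ 2 * (u (polar r σ) * u (polar r σ))
        ∂angularMeasure n = 0 := by
      refine integral_eq_zero_of_ae ?_
      filter_upwards [ae_angularMeasure n] with σ hσ
      rw [(eq_zero_of_notMem_tsupport (hnot σ hσ)).1]; simp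
    have z2 : ∫ σ, angForm u u (polar r σ) ∂angularMeasure n = 0 := by
      refine integral_eq_zero_of_ae ?_
      filter_upwards [ae_angularMeasure n] with σ hσ
      rw [angForm_eq_zero_of_notMem_tsupport (hnot σ hσ)]; rfl
    rw [z1, z2]; simp

/-- This is the pointwise splitting ϱ⁴|∇_G u|² = `angForm u u` + |x|²(Zu)², divided by ϱ⁴ on the
support, where ϱ > 0. -/
lemma integral_gradSq_eq (hV : ContinuousOn V (radii R)) (hu : ContDiff ℝ 1 u)
    (hc : HasCompactSupport u) (hs : tsupport u ⊆ gaugeBall n R \ {0}) :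
    ∫ p, V (gauge p) * gradSq u p = (∫ p, V (gauge p) / gauge p ^ 4 * angForm u u p) +
      ∫ p, V (gauge p) / gauge p ^ 4 * (‖p.1‖ ^ 2 * euler u p ^ 2) := by
  have hg4 : ContinuousOn (fun r => V r / r ^ 4) (radii R) :=
    hV.div (by fun_prop) fun r hr => pow_ne_zero 4 hr.1.ne'
  rw [← integral_add (integrable_weight_mul hc hs hg4 (continuous_angForm hu hu) fun p hp =>
      angForm_eq_zero_of_notMem_tsupport hp)
    (integrable_weight_mul hc hs hg4 (by have := continuous_euler hu; fun_prop) fun p hp => by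
      rw [euler_eq_zero_of_notMem_tsupport hp]; ring)]
  refine integral_congr_ae (Filter.Eventually.of_forall fun p => ?_)
  simp only [gradSq_eq_gradInner]
  by_cases hp : p ∈ tsupport u
  · have hg := (gauge_mem_radii hs hp).2.1
    simp only [angForm, ← gauge_pow_four]
    field_simp
    ring
  · simp only [gradInner_eq_zero_of_notMem_tsupport hp, angForm_eq_zero_of_notMem_tsupport hp,
      euler_eq_zero_of_notMem_tsupport hp]
    ring

end Integrands

/-- The Hardy inequality for a Bessel pair, on functions without low-order harmonics. -/
theorem besselPair_inequality (hn : 2 ≤ n) {j : ℤ} (hj : -1 ≤ j) {R : EReal} {V W f : ℝ → ℝ}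
    (hB : IsBesselPair (n + 2) R V W f) (hV0 : ∀ r ∈ radii R, 0 ≤ V r) {u : Space n → ℝ}
    (hu : IsInS j (gaugeBall n R \ {0}) u) :
    IntegrableOn (fun p => V (gauge p) * gradSq u p) (gaugeBall n R) ∧
    IntegrableOn (fun p => W (gauge p) * u p ^ 2 * gradSq gauge p) (gaugeBall n R) ∧
    IntegrableOn (fun p => V (gauge p) / gauge p ^ 2 * u p ^ 2 * gradSq gauge p)
      (gaugeBall n R) ∧
    IntegrableOn (fun p => V (gauge p) *
      radialGradSq (fun q => u q / f (gauge q)) p * f (gauge p) ^ 2) (gaugeBall n R) ∧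
    (∫ p in gaugeBall n R, W (gauge p) * u p ^ 2 * gradSq gauge p) +
      ((j : ℝ) + 1) * (((n + 2 : ℕ) : ℝ) + j - 1) *
        (∫ p in gaugeBall n R, V (gauge p) / gauge p ^ 2 * u p ^ 2 * gradSq gauge p) +
      (∫ p in gaugeBall n R, V (gauge p) *
        radialGradSq (fun q => u q / f (gauge q)) p * f (gauge p) ^ 2) ≤
    ∫ p in gaugeBall n R, V (gauge p) * gradSq u p := by
  have hu1 : ContDiff ℝ 1 u := hu.smooth.of_le (by exact_mod_cast le_top)
  have hs := hu.tsupport_subset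
  have hc := hu.hasCompactSupport
  have hV := hB.contDiffOn_V.continuousOn
  have hg2 : ContinuousOn (fun r => V r / r ^ 2) (radii R) :=
    hV.div (by fun_prop) fun r hr => pow_ne_zero 2 hr.1.ne'
  have hE1 : Integrable fun p => V (gauge p) * gradSq u p := by
    simp only [gradSq_eq_gradInner]
    exact integrable_weight_mul hc hs hV (continuous_gradInner hu1 hu1) fun p hp =>
      gradInner_eq_zero_of_notMem_tsupport hp
  have hz1 : ∀ p ∉ tsupport u, V (gauge p) * gradSq u p = 0 := fun p hp => by
    rw [gradSq_eq_gradInner, gradInner_eq_zero_of_notMem_tsupport hp, mul_zero]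
  have hz2 : ∀ g : ℝ → ℝ, ∀ p ∉ tsupport u,
      g (gauge p) * u p ^ 2 * (‖p.1‖ ^ 2 / gauge p ^ 2) = 0 := fun g p hp => by
    rw [(eq_zero_of_notMem_tsupport hp).1]; ring
  have hz4 : ∀ p ∉ tsupport u, V (gauge p) * ((‖p.1‖ ^ 2 / gauge p ^ 2) *
      ((gauge p)⁻¹ * euler u p / f (gauge p) -
        u p * deriv f (gauge p) / f (gauge p) ^ 2) ^ 2) * f (gauge p) ^ 2 = 0 := fun p hp => by
    rw [(eq_zero_of_notMem_tsupport hp).1, euler_eq_zero_of_notMem_tsupport hp]; ring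
  rw [weight_gradSq_gauge hs W, weight_gradSq_gauge hs fun r => V r / r ^ 2,
    weight_radialGradSq hB hu1 hs]
  refine ⟨hE1.integrableOn,
    (integrable_weight_sq hu1.continuous hc hs hB.contDiffOn_W.continuousOn).integrableOn,
    (integrable_weight_sq hu1.continuous hc hs hg2).integrableOn,
    (integrable_weight_radial hB hu1 hc hs).integrableOn, ?_⟩
  -- Once the ball integrals are extended to the whole space, the radial identity cancels the W term
  -- and the remainder exactly; only the angular inequality is left.
  rw [setIntegral_gaugeBall hs (hz2 W), setIntegral_gaugeBall hs (hz2 fun r => V r / r ^ 2),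
    setIntegral_gaugeBall hs hz4, setIntegral_gaugeBall hs hz1, integral_gradSq_eq hV hu1 hc hs,
    ← integral_radial_identity hn hB hu1 hc hs]
  have := integral_angular_gap hn hV hV0 hj hu
  linarith

/-! ### The Hardy pair and the scale-invariant inequality -/

/-- The Bessel pair of the Hardy inequality. -/
lemma isBesselPair_hardy (n : ℕ) : IsBesselPair (n + 2) ⊤ (fun _ => 1)
    (fun r => ((n : ℝ) / 2) ^ 2 / r ^ 2) (fun r => r ^ (-((n : ℝ) / 2))) where
  contDiffOn_V := contDiffOn_const
  contDiffOn_W := contDiffOn_const.div (contDiffOn_id.pow 2) fun r hr => pow_ne_zero 2 hr.1.ne'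
  contDiffOn_f := fun r hr => (Real.contDiffAt_rpow_const_of_ne hr.1.ne').contDiffWithinAt
  pos := fun r hr => Real.rpow_pos_of_pos hr.1 _
  ode := fun r hr => by
    have hr0 : 0 < r := hr.1
    set a : ℝ := (n : ℝ) / 2 with ha
    -- With a = n/2 = (Q−2)/2, the flux s^{n+1}f' is −a s^{n+1−a−1} = −a s^a, because n − a = a.
    -- This balance of exponents makes a² the constant in W.
    have h1 : (fun s : ℝ => s ^ (n + 2 - 1) * 1 * deriv (fun r : ℝ => r ^ (-a)) s) =ᶠ[nhds r]
        fun s => -a * s ^ a := by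
      filter_upwards [Ioi_mem_nhds hr0] with s hs
      have hs0 : (0 : ℝ) < s := hs
      rw [Real.deriv_rpow_const, mul_one, show n + 2 - 1 = n + 1 by omega,
        ← Real.rpow_natCast, mul_left_comm, ← Real.rpow_add hs0]
      congr 2
      push_cast; rw [ha]; ring
    have h2 : HasDerivAt (fun s : ℝ => -a * s ^ a) (-a * (a * r ^ (a - 1))) r :=
      (Real.hasDerivAt_rpow_const (Or.inl hr0.ne')).const_mul _
    refine (h2.congr_of_eventuallyEq h1).congr_deriv ?_
    have h3 : r ^ (n + 2 - 1) * (a ^ 2 / r ^ 2) * r ^ (-a) = a ^ 2 * r ^ (a - 1) := by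
      have : r ^ (a - 1) = r ^ (n + 1) / r ^ 2 * r ^ (-a) := by
        rw [← Real.rpow_natCast, ← Real.rpow_natCast, ← Real.rpow_sub hr0, ← Real.rpow_add hr0]
        congr 1
        push_cast; rw [ha]; ring
      rw [this, show n + 2 - 1 = n + 1 by omega]; ring
    rw [h3]; ring

/-- The Hardy inequality on functions without low-order harmonics. -/
theorem hardy_inequality (hn : 2 ≤ n) {j : ℤ} (hj : -1 ≤ j) {u : Space n → ℝ}
    (hu : IsInS j {0}ᶜ u) :
    ((n : ℝ) ^ 2 / 4 + ((j : ℝ) + 1) * (((n + 2 : ℕ) : ℝ) + j - 1)) *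
      (∫ p, u p ^ 2 / gauge p ^ 2 * gradSq gauge p) ≤ ∫ p, gradSq u p := by
  have hball : gaugeBall n ⊤ = univ := by
    ext p; simp [gaugeBall]
  have hu' : IsInS j (gaugeBall n ⊤ \ {0}) u :=
    ⟨hu.smooth, hu.hasCompactSupport, by
      rw [hball, ← compl_eq_univ_sdiff]; exact hu.tsupport_subset, hu.proj_eq_zero⟩
  obtain ⟨-, -, -, -, h⟩ := besselPair_inequality hn hj (isBesselPair_hardy n)
    (fun _ _ => zero_le_one) hu'
  simp only [hball, setIntegral_univ, one_mul] at h
  have hW : ∫ p, ((n : ℝ) / 2) ^ 2 / gauge p ^ 2 * u p ^ 2 * gradSq gauge p =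
      (n : ℝ) ^ 2 / 4 * ∫ p, u p ^ 2 / gauge p ^ 2 * gradSq gauge p := by
    rw [← integral_const_mul]
    exact integral_congr_ae (Filter.Eventually.of_forall fun p => by ring)
  have hV : ∫ p, 1 / gauge p ^ 2 * u p ^ 2 * gradSq gauge p =
      ∫ p, u p ^ 2 / gauge p ^ 2 * gradSq gauge p :=
    integral_congr_ae (Filter.Eventually.of_forall fun p => by ring)
  rw [hW, hV] at h
  -- The remainder term of the Bessel pair inequality is nonnegative and is discarded.
  have hnonneg : 0 ≤ ∫ p, radialGradSq (fun q => u q / gauge q ^ (-((n : ℝ) / 2))) p *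
      (gauge p ^ (-((n : ℝ) / 2))) ^ 2 := by
    refine integral_nonneg fun p => mul_nonneg ?_ (sq_nonneg _)
    rw [radialGradSq, gradSq]
    positivity
  linarith

end Main

end

end Grushin

theorem theorem3p2 (n Q : ℕ) (hQ : Q = n + 2) (hQ4 : 4 ≤ Q) (j : ℤ) (hj : -1 ≤ j) :
    (∀ (R : EReal), 0 < R → ∀ V W f : ℝ → ℝ, Grushin.IsBesselPair Q R V W f →
      (∀ r ∈ Grushin.radii R, 0 ≤ V r) →
      ∀ u : Grushin.Space n → ℝ, Grushin.IsInS j (Grushin.gaugeBall n R \ {0}) u →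
        IntegrableOn (fun p => V (Grushin.gauge p) * Grushin.gradSq u p)
          (Grushin.gaugeBall n R) ∧
        IntegrableOn (fun p => W (Grushin.gauge p) * u p ^ 2 * Grushin.gradSq Grushin.gauge p)
          (Grushin.gaugeBall n R) ∧
        IntegrableOn (fun p => V (Grushin.gauge p) / Grushin.gauge p ^ 2 * u p ^ 2 *
          Grushin.gradSq Grushin.gauge p) (Grushin.gaugeBall n R) ∧
        IntegrableOn (fun p => V (Grushin.gauge p) *
          Grushin.radialGradSq (fun q => u q / f (Grushin.gauge q)) p * f (Grushin.gauge p) ^ 2)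
          (Grushin.gaugeBall n R) ∧
        (∫ p in Grushin.gaugeBall n R,
            W (Grushin.gauge p) * u p ^ 2 * Grushin.gradSq Grushin.gauge p) +
          ((j : ℝ) + 1) * ((Q : ℝ) + j - 1) *
            (∫ p in Grushin.gaugeBall n R, V (Grushin.gauge p) / Grushin.gauge p ^ 2 * u p ^ 2 *
              Grushin.gradSq Grushin.gauge p) +
          (∫ p in Grushin.gaugeBall n R, V (Grushin.gauge p) *
            Grushin.radialGradSq (fun q => u q / f (Grushin.gauge q)) p *
              f (Grushin.gauge p) ^ 2) ≤
        ∫ p in Grushin.gaugeBall n R, V (Grushin.gauge p) * Grushin.gradSq u p) ∧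
    (∀ u : Grushin.Space n → ℝ, Grushin.IsInS j {0}ᶜ u →
      (((Q : ℝ) - 2) ^ 2 / 4 + ((j : ℝ) + 1) * ((Q : ℝ) + j - 1)) *
          (∫ p, u p ^ 2 / Grushin.gauge p ^ 2 * Grushin.gradSq Grushin.gauge p) ≤
        ∫ p, Grushin.gradSq u p) ∧
    (0 ≤ j → ((Q : ℝ) - 2) ^ 2 / 4 <
      ((Q : ℝ) - 2) ^ 2 / 4 + ((j : ℝ) + 1) * ((Q : ℝ) + j - 1)) := by
  subst hQ
  have hn : 2 ≤ n := by omega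
  refine ⟨fun R _ V W f hB hV u hu => Grushin.besselPair_inequality hn hj hB hV hu,
    fun u hu => ?_, fun h0 => ?_⟩
  · have h := Grushin.hardy_inequality hn hj hu
    rwa [show (n : ℝ) = ((n + 2 : ℕ) : ℝ) - 2 by push_cast; ring] at h
  · have h1 : (0 : ℝ) ≤ j := by exact_mod_cast h0
    have h2 : (4 : ℝ) ≤ ((n + 2 : ℕ) : ℝ) := by exact_mod_cast hQ4
    have h3 : 0 < ((j : ℝ) + 1) * (((n + 2 : ℕ) : ℝ) + j - 1) :=
      mul_pos (by linarith) (by linarith)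
    linarith
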